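/- Let $1<c<\frac{12}{11}$ and $\theta>1$ be fixed real numbers. For real $x>0$ put $$\Delta_1=e^{\pi\left[\frac{\log x}{\pi}\right]+\arctan 1},\qquad \Delta_2=e^{\pi\left[\frac{\log x}{\pi}\right]+\arctan 2},$$ where $[t]$ denotes the integer part (floor) of $t$, and let $S_c(x)$ be the number of integers $n$ with $\Delta_1\le n<\Delta_2$ for which $[n^c\tan^\theta(\log n)]$ is a prime number (for these $n$ one has $1\le\tan(\log n)<2$). Then $$S_c(x)\gg\frac{x}{\log x},$$ that is, there are constants $C>0$ and $x_0$, depending only on $c$ and $\theta$, such that $S_c(x)\ge C\,\frac{x}{\log x}$ for all real $x\ge x_0$. Consequently, there are infinitely many prime numbers $p$ of the form $p=[n^c\tan^\theta(\log n)]$ with $n$ a positive integer such that $\tan(\log n)>0$. -/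

import Mathlib

namespace TanPrimes

noncomputable section

/-- The endpoint `exp (π [log x / π] + arctan i)`; the two endpoints used are `i = 1` and `i = 2`. -/
def Delta (i x : ℝ) : ℝ :=
  Real.exp (Real.pi * (⌊Real.log x / Real.pi⌋ : ℝ) + Real.arctan i)

/-- The integer part `[n^c tan^θ(log n)]`. It is only used where `tan (log n) > 0`, so that the
real power is the ordinary one. -/
def term (c θ : ℝ) (n : ℕ) : ℤ :=
  ⌊(n : ℝ) ^ c * Real.tan (Real.log (n : ℝ)) ^ θ⌋

/-- The integers `n` with `Δ₁ ≤ n < Δ₂` for which `[n^c tan^θ(log n)]` is a prime number. -/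
def countedSet (c θ x : ℝ) : Set ℕ :=
  {n : ℕ | Delta 1 x ≤ (n : ℝ) ∧ (n : ℝ) < Delta 2 x ∧
    ∃ p : ℕ, p.Prime ∧ term c θ n = (p : ℤ)}

/-- The counted set is finite, so its `ncard` is its true number of elements. -/
theorem countedSet_finite (c θ x : ℝ) : (countedSet c θ x).Finite := by
  refine (Set.finite_lt_nat ⌈Delta 2 x⌉₊).subset ?_
  rintro n ⟨_, h, _⟩
  exact Nat.lt_ceil.mpr h

/-- On the range of summation the tangent lies in `[1, 2)`; in particular it is positive. -/
theorem tan_log_mem {x : ℝ} {n : ℕ} (h1 : Delta 1 x ≤ (n : ℝ)) (h2 : (n : ℝ) < Delta 2 x) :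
    1 ≤ Real.tan (Real.log (n : ℝ)) ∧ Real.tan (Real.log (n : ℝ)) < 2 := by
  have hn : (0 : ℝ) < n := lt_of_lt_of_le (Real.exp_pos _) h1
  have a1 := (Real.le_log_iff_exp_le hn).2 h1
  have a2 := (Real.log_lt_iff_lt_exp hn).2 h2
  set k : ℤ := ⌊Real.log x / Real.pi⌋
  set u : ℝ := Real.log (n : ℝ) - k * Real.pi with hu
  have ht : Real.tan (Real.log (n : ℝ)) = Real.tan u := by
    rw [hu, Real.tan_sub_int_mul_pi]
  have b1 : Real.arctan 1 ≤ u := by rw [hu]; linarith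
  have b2 : u < Real.arctan 2 := by rw [hu]; linarith
  have c1 := Real.neg_pi_div_two_lt_arctan 1
  have c2 := Real.arctan_lt_pi_div_two 2
  rw [ht]
  constructor
  · have := Real.strictMonoOn_tan.monotoneOn (Real.arctan_mem_Ioo 1)
      (show u ∈ Set.Ioo _ _ from ⟨by linarith, by linarith⟩) b1
    rwa [Real.tan_arctan] at this
  · have := Real.strictMonoOn_tan (show u ∈ Set.Ioo _ _ from ⟨by linarith, by linarith⟩)
      (Real.arctan_mem_Ioo 2) b2
    rwa [Real.tan_arctan] at this

/-- The counting function `S_c(x)`. -/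
def S (c θ x : ℝ) : ℕ := (countedSet c θ x).ncard

/-- The primes of the form `[n^c tan^θ(log n)]` with `n` a positive integer such that
`tan (log n) > 0`, so that the real power `tan^θ(log n)` is meaningful. -/
def T (c θ : ℝ) : Set ℕ :=
  {p : ℕ | p.Prime ∧ ∃ n : ℕ, 1 ≤ n ∧ 0 < Real.tan (Real.log (n : ℝ)) ∧ term c θ n = (p : ℤ)}

end

end TanPrimes

/-!
The proof is an instance of the Piatetski-Shapiro method. Let `k = ⌊log x / π⌋`, `Δ = e ^ (π k)` and
`N = Δ ^ c`, and write `n = Δ e ^ u`. Then `tan (log n) = tan u`, and `n ^ c * tan (log n) ^ θ` is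
`N` times the increasing function `exp (c u + θ log (tan u))`. Let `φ` be the inverse function,
`invTerm`. The integer part at `n` is the prime `p` exactly when `φ(p) ≤ n < φ(p + 1)`
(`exists_term_eq`), so it suffices to find `≫ Δ / log Δ` primes `p ≍ N` for which an integer
lies in `[φ(p), φ(p + 1))`, an interval of length `≫ Δ / N`.

A trigonometric minorant for the neighbourhood of the integers
(`weight_le_of_exponential_sums`) reduces this to a bound `o(Δ)` for the sums of
`log p * e(h φ(p))` over the primes, uniformly in `1 ≤ h ≪ N / Δ`. The total weight needed as
main term comes from Chebyshev's bounds alone (`eventually_sum_log_primes_ge`), which is why the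
range of `p` has to reach from `a N` to beyond `2 a N`, with `a = startRatio c` corresponding to
`tan u = 1`; it ends before `tan u = 1.61` for every `θ > 1` (`log_ratio_le_logTerm`).

The exponential sum is estimated by `M ^ (11/12 + ε)` with `M ≍ N`
(`exists_norm_vonMangoldt_sum_le`), and this is `o(Δ) = o(N ^ (1/c))` exactly because `c < 12/11`.
Vaughan's identity with both cut-offs at `M ^ (1/6)` leaves Type I sums, whose inner sums are
treated by van der Corput's second derivative test (`IsPhase.norm_typeI_le`), and Type II sums
(`IsPhase.norm_typeII_le`). In the latter the shorter variable is cut into blocks of length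
`M ^ (1/6)`; Cauchy's inequality, followed by the second derivative test for
`φ(n₂ m) - φ(n₁ m)`, saves a factor `M ^ (1/12)`.

Both tests need information on `y² φ''(y)`: it must be negative of exact order `Δ`, and decreasing
at a rate of exact order `Δ / N` (`IsPhase`, `exists_isPhase_invTerm`). In the coordinate
`s = log (tan u)` these are the inequalities `curvature_neg` and `curvatureSlope_neg`. The second
one holds for all `θ` as long as `tan u` stays below the golden ratio, and `1.61` does. The constants
in the orders are uniform by compactness.
-/

open Finset

namespace TanPrimes

noncomputable section

/-! ### Exponential sums: the Kusmin–Landau inequality and van der Corput's second derivative test -/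

/-- The additive character `e(x) = exp (2πix)`. -/
def ee (x : ℝ) : ℂ := Complex.exp (((2 * Real.pi * x : ℝ) : ℂ) * Complex.I)

lemma norm_ee (x : ℝ) : ‖ee x‖ = 1 := Complex.norm_exp_ofReal_mul_I _

lemma ee_add (x y : ℝ) : ee (x + y) = ee x * ee y := by
  unfold ee; rw [← Complex.exp_add]; congr 1; push_cast; ring

@[simp] lemma ee_zero : ee 0 = 1 := by simp [ee]

lemma ee_neg (x : ℝ) : ee (-x) = (starRingEnd ℂ) (ee x) := by
  unfold ee; rw [← Complex.exp_conj, map_mul, Complex.conj_ofReal, Complex.conj_I]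
  congr 1; push_cast; ring

lemma ee_sub (x y : ℝ) : ee (x - y) = ee x * (starRingEnd ℂ) (ee y) := by
  rw [sub_eq_add_neg, ee_add, ee_neg]

lemma ee_intCast (k : ℤ) : ee k = 1 := by
  unfold ee
  rw [Complex.exp_eq_one_iff]
  exact ⟨k, by push_cast; ring⟩

lemma ee_sub_int_mul (x : ℝ) (k : ℤ) (n : ℕ) : ee (x - k * n) = ee x := by
  have : (k * n : ℝ) = ((k * n : ℤ) : ℝ) := by push_cast; ring
  rw [ee_sub, this, ee_intCast]; simp

lemma ee_eq_sq (x : ℝ) :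
    ee x = ((Real.cos (Real.pi * x) : ℂ) + Real.sin (Real.pi * x) * Complex.I) ^ 2 := by
  unfold ee
  rw [Complex.ofReal_cos, Complex.ofReal_sin, ← Complex.exp_mul_I, ← Complex.exp_nat_mul]
  congr 1; push_cast; ring

/-- `1 / (1 - e(x))`, in the form `1/2 + (i/2) cot (πx)`. -/
def kw (x : ℝ) : ℂ :=
  1 / 2 + (Real.cos (Real.pi * x) / Real.sin (Real.pi * x) / 2 : ℝ) * Complex.I

lemma kw_mul (x : ℝ) (hx : 0 < Real.sin (Real.pi * x)) : kw x * (1 - ee x) = 1 := by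
  have h : (Real.sin (Real.pi * x) : ℂ) ≠ 0 := by exact_mod_cast hx.ne'
  have hcs : (Real.cos (Real.pi * x) : ℂ) ^ 2 = 1 - (Real.sin (Real.pi * x) : ℂ) ^ 2 := by
    have := Real.sin_sq_add_cos_sq (Real.pi * x)
    have h2 : Real.cos (Real.pi * x) ^ 2 = 1 - Real.sin (Real.pi * x) ^ 2 := by linarith
    exact_mod_cast h2
  rw [ee_eq_sq, kw]
  simp only [Complex.ofReal_div, Complex.ofReal_ofNat]
  set s := (Real.sin (Real.pi * x) : ℂ)
  set c := (Real.cos (Real.pi * x) : ℂ)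
  have hI : Complex.I ^ 2 = -1 := Complex.I_sq
  have : (s + c * Complex.I) * (1 - (c + s * Complex.I) ^ 2) = 2 * s := by
    have e : (s + c * Complex.I) * (1 - (c + s * Complex.I) ^ 2)
        = s + c * Complex.I - s * c ^ 2 - 2 * s ^ 2 * c * Complex.I - s ^ 3 * Complex.I ^ 2
          - c ^ 3 * Complex.I - 2 * c ^ 2 * s * Complex.I ^ 2
          - c * s ^ 2 * (Complex.I ^ 2) * Complex.I := by ring
    rw [e, hI]
    have e3 : c ^ 3 = c * c ^ 2 := by ring
    rw [e3, hcs]; ring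
  have e2 : (1 / 2 : ℂ) + c / s / 2 * Complex.I = (s + c * Complex.I) / (2 * s) := by
    field_simp
  rw [e2, div_mul_eq_mul_div, this, div_self (mul_ne_zero two_ne_zero h)]

lemma two_mul_le_sin_pi_mul {δ x : ℝ} (hδ : 0 < δ) (h1 : δ ≤ x) (h2 : x ≤ 1 - δ) :
    2 * δ ≤ Real.sin (Real.pi * x) := by
  have hpi := Real.pi_pos
  have key : ∀ y : ℝ, 0 ≤ y → y ≤ 1 / 2 → 2 * y ≤ Real.sin (Real.pi * y) := by
    intro y h0 hy
    have := Real.mul_le_sin (x := Real.pi * y) (by positivity) (by nlinarith)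
    calc 2 * y = 2 / Real.pi * (Real.pi * y) := by field_simp
      _ ≤ _ := this
  rcases le_total x (1 / 2) with h | h
  · exact le_trans (by linarith) (key x (by linarith) h)
  · have := key (1 - x) (by linarith) (by linarith)
    have e : Real.sin (Real.pi * (1 - x)) = Real.sin (Real.pi * x) := by
      rw [mul_sub, mul_one, Real.sin_pi_sub]
    rw [e] at this; linarith

lemma cot_pi_antitone {x y : ℝ} (hx : 0 < x) (hxy : x ≤ y) (hy : y < 1) :
    Real.cos (Real.pi * y) / Real.sin (Real.pi * y)
      ≤ Real.cos (Real.pi * x) / Real.sin (Real.pi * x) := by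
  have hpi := Real.pi_pos
  have sx : 0 < Real.sin (Real.pi * x) :=
    Real.sin_pos_of_pos_of_lt_pi (by positivity) (by nlinarith)
  have sy : 0 < Real.sin (Real.pi * y) :=
    Real.sin_pos_of_pos_of_lt_pi (mul_pos hpi (by linarith)) (by nlinarith)
  rw [div_le_div_iff₀ sy sx]
  have : 0 ≤ Real.sin (Real.pi * y - Real.pi * x) :=
    Real.sin_nonneg_of_nonneg_of_le_pi (by nlinarith) (by nlinarith)
  rw [Real.sin_sub] at this
  nlinarith

lemma norm_kw_sub {x y : ℝ} (hx : 0 < x) (hxy : x ≤ y) (hy : y < 1) :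
    ‖kw y - kw x‖ = (Real.cos (Real.pi * x) / Real.sin (Real.pi * x)
      - Real.cos (Real.pi * y) / Real.sin (Real.pi * y)) / 2 := by
  have e : kw y - kw x = (((Real.cos (Real.pi * y) / Real.sin (Real.pi * y)
      - Real.cos (Real.pi * x) / Real.sin (Real.pi * x)) / 2 : ℝ) : ℂ) * Complex.I := by
    unfold kw; push_cast; ring
  rw [e, norm_mul, Complex.norm_I, mul_one, Complex.norm_real, Real.norm_eq_abs, abs_of_nonpos]
  · ring
  · linarith [cot_pi_antitone hx hxy hy]

/-- The Kusmin–Landau inequality, when the first differences lie in `[δ, 1 - δ]`. -/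
lemma kusmin_landau_aux (f : ℕ → ℝ) (a b : ℕ) {δ : ℝ} (hδ : 0 < δ)
    (hg : ∀ n, a ≤ n → n < b → δ ≤ f (n + 1) - f n ∧ f (n + 1) - f n ≤ 1 - δ)
    (hmono : ∀ n, a ≤ n → n + 1 < b → f (n + 1) - f n ≤ f (n + 2) - f (n + 1)) :
    ‖∑ n ∈ Ico a b, ee (f n)‖ ≤ 1 / δ := by
  rcases Nat.lt_or_ge a b with hab | hab
  swap
  · rw [Ico_eq_empty_of_le hab]; simpa using hδ.le
  set g : ℕ → ℝ := fun n => f (n + 1) - f n with hgdef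
  have hsin : ∀ n, a ≤ n → n < b → 2 * δ ≤ Real.sin (Real.pi * g n) := fun n h1 h2 =>
    two_mul_le_sin_pi_mul hδ (hg n h1 h2).1 (hg n h1 h2).2
  have hE : ∀ n, a ≤ n → n < b → ee (f n) = kw (g n) * (ee (f n) - ee (f (n + 1))) := by
    intro n h1 h2
    have : ee (f (n + 1)) = ee (f n) * ee (g n) := by rw [← ee_add]; congr 1; simp [hgdef]
    rw [this]
    linear_combination (-ee (f n)) * kw_mul (g n) (by linarith [hsin n h1 h2])
  set ct : ℕ → ℝ := fun n => Real.cos (Real.pi * g n) / Real.sin (Real.pi * g n) with hct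
  -- Each term is `kw (g n) * (e(f n) - e(f (n + 1)))`. Summation by parts leaves two end terms and
  -- the total variation of `kw ∘ g`, which telescopes because the cotangent is monotone.
  have key : ∀ j : ℕ, a + j < b →
      ‖∑ n ∈ Ico a (a + j + 1), ee (f n)
        - (kw (g a) * ee (f a) - kw (g (a + j)) * ee (f (a + j + 1)))‖
        ≤ (ct a - ct (a + j)) / 2 := by
    intro j
    induction j with
    | zero =>
      intro h
      have h0 := hE a le_rfl h
      have : ∑ n ∈ Ico a (a + 0 + 1), ee (f n)
        - (kw (g a) * ee (f a) - kw (g (a + 0)) * ee (f (a + 0 + 1))) = 0 := by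
        simp only [add_zero, Nat.Ico_succ_singleton, sum_singleton]
        linear_combination h0
      rw [this]; simp
    | succ j ih =>
      intro h
      have ih' := ih (by omega)
      have h0 := hE (a + j + 1) (by omega) (by omega)
      have e : ∑ n ∈ Ico a (a + (j + 1) + 1), ee (f n)
        - (kw (g a) * ee (f a) - kw (g (a + (j + 1))) * ee (f (a + (j + 1) + 1)))
        = (∑ n ∈ Ico a (a + j + 1), ee (f n)
        - (kw (g a) * ee (f a) - kw (g (a + j)) * ee (f (a + j + 1))))
        + (kw (g (a + j + 1)) - kw (g (a + j))) * ee (f (a + j + 1)) := by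
        rw [← add_assoc a j 1, sum_Ico_succ_top (by omega)]
        linear_combination h0
      rw [e]
      refine (norm_add_le _ _).trans ?_
      rw [norm_mul, norm_ee, mul_one]
      have hb := hg (a + j) (by omega) (by omega)
      have hb' := hg (a + j + 1) (by omega) (by omega)
      have hm := hmono (a + j) (by omega) (by omega)
      rw [norm_kw_sub (x := g (a + j)) (y := g (a + j + 1)) (by simp only [hgdef]; linarith)
        (by simpa only [hgdef] using hm) (by simp only [hgdef]; linarith)]
      have : ct (a + (j + 1)) = ct (a + j + 1) := by rw [add_assoc]
      rw [this]
      simp only [hct] at ih' ⊢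
      linarith
  have hkw : ∀ n, a ≤ n → n < b → ‖kw (g n)‖ ≤ 1 / (4 * δ) := by
    intro n h1 h2
    have hs := hsin n h1 h2
    have h3 := kw_mul (g n) (by linarith)
    have h4 : ‖1 - ee (g n)‖ = 2 * Real.sin (Real.pi * g n) := by
      have e : 1 - ee (g n) = -(2 * (Real.sin (Real.pi * g n) : ℂ) * Complex.I) *
          ((Real.cos (Real.pi * g n) : ℂ) + Real.sin (Real.pi * g n) * Complex.I) := by
        rw [ee_eq_sq]
        have hcs : (Real.cos (Real.pi * g n) : ℂ) ^ 2 = 1 - (Real.sin (Real.pi * g n) : ℂ) ^ 2 := by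
          have := Real.sin_sq_add_cos_sq (Real.pi * g n)
          have h2 : Real.cos (Real.pi * g n) ^ 2 = 1 - Real.sin (Real.pi * g n) ^ 2 := by linarith
          exact_mod_cast h2
        linear_combination (-1 : ℂ) * hcs + (Real.sin (Real.pi * g n) : ℂ) ^ 2 * Complex.I_sq
      rw [e, norm_mul, norm_neg, norm_mul, norm_mul, Complex.norm_I, Complex.ofReal_cos,
        Complex.ofReal_sin, ← Complex.exp_mul_I,
        Complex.norm_exp_ofReal_mul_I, ← Complex.ofReal_sin, Complex.norm_real, Real.norm_eq_abs,
        abs_of_nonneg (by linarith)]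
      simp
    have h5 : ‖kw (g n)‖ * (2 * Real.sin (Real.pi * g n)) = 1 := by
      rw [← h4, ← norm_mul, h3, norm_one]
    rw [le_div_iff₀ (by positivity)]
    nlinarith [norm_nonneg (kw (g n))]
  have hctb : ∀ n, a ≤ n → n < b → |ct n| ≤ 1 / (2 * δ) := by
    intro n h1 h2
    have hs := hsin n h1 h2
    rw [hct]
    simp only
    rw [abs_div, abs_of_nonneg (a := Real.sin _) (by linarith)]
    exact div_le_div₀ zero_le_one (Real.abs_cos_le_one _) (by positivity) hs
  obtain ⟨j, rfl⟩ : ∃ j, b = a + j + 1 := ⟨b - a - 1, by omega⟩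
  have hk := key j (by omega)
  have n1 := hkw a le_rfl hab
  have n2 := hkw (a + j) (by omega) (by omega)
  have c1 := (abs_le.1 (hctb a le_rfl hab)).2
  have c2 := (abs_le.1 (hctb (a + j) (by omega) (by omega))).1
  have n3 : ‖kw (g a) * ee (f a) - kw (g (a + j)) * ee (f (a + j + 1))‖
      ≤ 1 / (4 * δ) + 1 / (4 * δ) := by
    refine (norm_sub_le _ _).trans ?_
    rw [norm_mul, norm_mul, norm_ee, norm_ee, mul_one, mul_one]
    exact add_le_add n1 n2
  have e1 : 1 / (4 * δ) = 1 / δ / 4 := by field_simp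
  have e2 : 1 / (2 * δ) = 1 / δ / 2 := by field_simp
  rw [e1] at n3
  rw [e2] at c1 c2
  calc _ = ‖(∑ n ∈ Ico a (a + j + 1), ee (f n)
        - (kw (g a) * ee (f a) - kw (g (a + j)) * ee (f (a + j + 1))))
        + (kw (g a) * ee (f a) - kw (g (a + j)) * ee (f (a + j + 1)))‖ := by rw [sub_add_cancel]
    _ ≤ _ := norm_add_le _ _
    _ ≤ _ := by linarith

/-- The Kusmin–Landau inequality for an increasing sequence of first differences that stays at
distance at least `δ` from the integers. -/
lemma kusmin_landau (f : ℕ → ℝ) (a b : ℕ) (k : ℤ) {δ : ℝ} (hδ : 0 < δ)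
    (hg : ∀ n, a ≤ n → n < b → k + δ ≤ f (n + 1) - f n ∧ f (n + 1) - f n ≤ k + 1 - δ)
    (hmono : ∀ n, a ≤ n → n + 1 < b → f (n + 1) - f n ≤ f (n + 2) - f (n + 1)) :
    ‖∑ n ∈ Ico a b, ee (f n)‖ ≤ 1 / δ := by
  have := kusmin_landau_aux (fun n => f n - k * n) a b hδ
    (fun n h1 h2 => by have := hg n h1 h2; push_cast; constructor <;> linarith)
    (fun n h1 h2 => by have := hmono n h1 h2; push_cast; linarith)
  simpa only [ee_sub_int_mul] using this

lemma le_sub_of_increments {g : ℕ → ℝ} {a b : ℕ} {l : ℝ}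
    (h : ∀ n, a ≤ n → n + 1 < b → l ≤ g (n + 1) - g n) {m n : ℕ} (ham : a ≤ m) (hmn : m ≤ n)
    (hnb : n < b) : l * (n - m : ℝ) ≤ g n - g m := by
  induction n, hmn using Nat.le_induction with
  | base => simp
  | succ n hmn ih =>
    have := ih (by omega)
    have h2 := h n (by omega) hnb
    push_cast
    nlinarith

/-- Few values of a sequence with increments at least `l` lie in an interval of length `δ`. -/
lemma card_le_of_increments {g : ℕ → ℝ} {a b : ℕ} {l δ x : ℝ} (hl : 0 < l) (hδ : 0 ≤ δ)
    (h : ∀ n, a ≤ n → n + 1 < b → l ≤ g (n + 1) - g n) (S : Finset ℕ)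
    (hS : ∀ n ∈ S, a ≤ n ∧ n < b ∧ x ≤ g n ∧ g n ≤ x + δ) : (S.card : ℝ) ≤ δ / l + 1 := by
  rcases S.eq_empty_or_nonempty with rfl | hne
  · simp; positivity
  have h1 := hS _ (S.min'_mem hne)
  have h2 := hS _ (S.max'_mem hne)
  have hle := S.min'_le _ (S.max'_mem hne)
  have hcard : S.card ≤ S.max' hne + 1 - S.min' hne := by
    rw [← Nat.card_Icc]
    exact card_le_card fun n hn => mem_Icc.2 ⟨S.min'_le _ hn, S.le_max' _ hn⟩
  have hc : (S.card : ℝ) ≤ (S.max' hne : ℝ) - S.min' hne + 1 := by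
    have : S.card + S.min' hne ≤ S.max' hne + 1 := by omega
    have : (S.card : ℝ) + S.min' hne ≤ S.max' hne + 1 := by exact_mod_cast this
    linarith
  have h3 := le_sub_of_increments h h1.1 hle h2.2.1
  have h4 : (S.max' hne : ℝ) - S.min' hne ≤ δ / l := by
    rw [le_div_iff₀ hl]; linarith [h1.2.2.1, h2.2.2.2]
  linarith

/-- Van der Corput's second derivative test, in terms of second differences. -/
lemma van_der_corput_discrete (f : ℕ → ℝ) (a b : ℕ) {l α : ℝ} (hl : 0 < l) (hα : 1 ≤ α)
    (hab : a ≤ b)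
    (h : ∀ n, a ≤ n → n + 2 < b → l ≤ f (n + 2) - 2 * f (n + 1) + f n ∧
      f (n + 2) - 2 * f (n + 1) + f n ≤ α * l) :
    ‖∑ n ∈ Ico a b, ee (f n)‖ ≤ 11 * (α * (b - a : ℝ) * √l + 1 / √l) := by
  have hs : 0 < √l := Real.sqrt_pos.2 hl
  have hss : √l * √l = l := Real.mul_self_sqrt hl.le
  have hba : (0 : ℝ) ≤ b - a := by
    have : (a : ℝ) ≤ b := by exact_mod_cast hab
    linarith
  have htriv : ∀ s : Finset ℕ, ‖∑ n ∈ s, ee (f n)‖ ≤ s.card := by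
    intro s
    refine (norm_sum_le _ _).trans ?_
    simp [norm_ee]
  -- For `l > 1` the claim is weaker than the trivial bound.
  rcases lt_or_ge 1 l with hl1 | hl1
  · refine (htriv _).trans ?_
    rw [Nat.card_Ico, Nat.cast_sub hab]
    have h1 : 1 ≤ √l := Real.one_le_sqrt.2 hl1.le
    have h2 : (b - a : ℝ) ≤ α * (b - a : ℝ) * √l := by
      calc (b - a : ℝ) = 1 * (b - a : ℝ) * 1 := by ring
        _ ≤ _ := by gcongr
    have h3 : 0 ≤ 1 / √l := by positivity
    have h4 : 0 ≤ α * (b - a : ℝ) * √l := by linarith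
    linarith
  have hs1 : √l ≤ 1 := Real.sqrt_le_one.2 hl1
  rcases hab.eq_or_lt with rfl | hab
  · simp
  -- The last index is set aside: its first difference involves a value outside the range.
  obtain ⟨d, rfl⟩ : ∃ d, b = d + 1 := ⟨b - 1, by omega⟩
  set g : ℕ → ℝ := fun n => f (n + 1) - f n with hg
  have hinc : ∀ n, a ≤ n → n + 1 < d → l ≤ g (n + 1) - g n := fun n h1 h2 => by
    have := (h n h1 (by omega)).1; simp only [hg]; linarith
  have hinc2 : ∀ n, a ≤ n → n + 1 < d → -(α * l) ≤ (-g) (n + 1) - (-g) n := fun n h1 h2 => by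
    have := (h n h1 (by omega)).2; simp only [hg, Pi.neg_apply]; linarith
  have hmono : ∀ m n, a ≤ m → m ≤ n → n < d → g m ≤ g n := fun m n h1 h2 h3 => by
    have h4 := le_sub_of_increments hinc h1 h2 h3
    have : (m : ℝ) ≤ n := by exact_mod_cast h2
    nlinarith
  have hfib : ∀ k : ℤ, ‖∑ n ∈ (Ico a d).filter (fun n => ⌊g n⌋ = k), ee (f n)‖ ≤ 5 / √l := by
    intro k
    -- On `A` and `B` the difference `g n` is within `√l` of an integer, which happens for few `n`;
    -- `Z` is an interval of indices on which the Kusmin–Landau inequality applies with `δ = √l`.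
    set F := (Ico a d).filter (fun n => ⌊g n⌋ = k) with hF
    set A := F.filter (fun n => g n < k + √l) with hA
    set B := (F.filter (fun n => ¬ g n < k + √l)).filter (fun n => k + 1 - √l < g n) with hB
    set Z := (F.filter (fun n => ¬ g n < k + √l)).filter (fun n => ¬ k + 1 - √l < g n) with hZ
    have hsum : ∑ n ∈ F, ee (f n)
        = ∑ n ∈ A, ee (f n) + (∑ n ∈ B, ee (f n) + ∑ n ∈ Z, ee (f n)) := by
      rw [sum_filter_add_sum_filter_not, sum_filter_add_sum_filter_not]
    have cA : (A.card : ℝ) ≤ √l / l + 1 := by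
      refine card_le_of_increments (x := k) hl hs.le hinc A fun n hn => ?_
      simp only [hA, hF, mem_filter, mem_Ico, Int.floor_eq_iff] at hn
      exact ⟨hn.1.1.1, hn.1.1.2, hn.1.2.1, hn.2.le⟩
    have cB : (B.card : ℝ) ≤ √l / l + 1 := by
      refine card_le_of_increments (x := k + 1 - √l) hl hs.le hinc B fun n hn => ?_
      simp only [hB, hF, mem_filter, mem_Ico, Int.floor_eq_iff] at hn
      exact ⟨hn.1.1.1.1, hn.1.1.1.2, hn.2.le, by linarith [hn.1.1.2.2]⟩
    have sZ : ‖∑ n ∈ Z, ee (f n)‖ ≤ 1 / √l := by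
      rcases Z.eq_empty_or_nonempty with hZe | hne
      · rw [hZe]; simp
      have hmem : ∀ n, n ∈ Z ↔ (a ≤ n ∧ n < d) ∧ k + √l ≤ g n ∧ g n ≤ k + 1 - √l := by
        intro n
        simp only [hZ, hF, mem_filter, mem_Ico, Int.floor_eq_iff, not_lt]
        constructor
        · rintro ⟨⟨⟨h1, h2⟩, h3⟩, h4⟩; exact ⟨h1, h3, h4⟩
        · rintro ⟨h1, h3, h4⟩; exact ⟨⟨⟨h1, by linarith, by linarith⟩, h3⟩, h4⟩
      have h1 := (hmem _).1 (Z.min'_mem hne)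
      have h2 := (hmem _).1 (Z.max'_mem hne)
      have hin : ∀ n, Z.min' hne ≤ n → n < Z.max' hne + 1 → n ∈ Z := by
        intro n h3 h4
        rw [hmem]
        refine ⟨⟨by omega, by omega⟩, ?_, ?_⟩
        · exact h1.2.1.trans (hmono _ _ h1.1.1 h3 (by omega))
        · exact (hmono n _ (by omega) (by omega) h2.1.2).trans h2.2.2
      have hZI : Z = Ico (Z.min' hne) (Z.max' hne + 1) := by
        ext n
        rw [mem_Ico]
        exact ⟨fun hn => ⟨Z.min'_le _ hn, Nat.lt_succ_of_le (Z.le_max' _ hn)⟩,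
          fun hn => hin n hn.1 hn.2⟩
      rw [hZI]
      refine kusmin_landau f _ _ k hs (fun n h3 h4 => ?_) (fun n h3 h4 => ?_)
      · have := (hmem n).1 (hin n h3 h4)
        exact this.2
      · exact hmono n (n + 1) (by omega) (by omega) (by omega)
    have e1 : √l / l = 1 / √l := by
      rw [div_eq_div_iff hl.ne' hs.ne']; linarith
    have e2 : 1 ≤ 1 / √l := by rw [le_div_iff₀ hs]; linarith
    rw [hsum]
    calc _ ≤ ‖∑ n ∈ A, ee (f n)‖ + (‖∑ n ∈ B, ee (f n)‖ + ‖∑ n ∈ Z, ee (f n)‖) :=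
          (norm_add_le _ _).trans (add_le_add le_rfl (norm_add_le _ _))
      _ ≤ (1 / √l + 1) + ((1 / √l + 1) + 1 / √l) := by
          rw [e1] at cA cB
          exact add_le_add ((htriv A).trans cA) (add_le_add ((htriv B).trans cB) sZ)
      _ ≤ 5 / √l := by
          have : 5 / √l = 5 * (1 / √l) := by ring
          rw [this]; linarith
  have hlast : ‖∑ n ∈ Ico a (d + 1), ee (f n)‖ ≤ ‖∑ n ∈ Ico a d, ee (f n)‖ + 1 := by
    rw [sum_Ico_succ_top (by omega)]
    refine (norm_add_le _ _).trans ?_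
    rw [norm_ee]
  have hone : 1 ≤ 1 / √l := by rw [le_div_iff₀ hs]; linarith
  have hmain : ‖∑ n ∈ Ico a d, ee (f n)‖ ≤ (α * l * (d - a : ℝ) + 2) * (5 / √l) := by
    rcases Nat.lt_or_ge a d with had | had
    swap
    · have : a = d := by omega
      subst this
      simp only [Ico_self, sum_empty, norm_zero, sub_self, mul_zero, zero_add]
      positivity
    have hmaps : ∀ n ∈ Ico a d, ⌊g n⌋ ∈ Icc ⌊g a⌋ ⌊g (d - 1)⌋ := by
      intro n hn
      rw [mem_Ico] at hn
      rw [mem_Icc]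
      exact ⟨Int.floor_le_floor (hmono _ _ le_rfl hn.1 hn.2),
        Int.floor_le_floor (hmono _ _ hn.1 (by omega) (by omega))⟩
    rw [← sum_fiberwise_of_maps_to hmaps]
    refine (norm_sum_le _ _).trans ?_
    refine (sum_le_sum fun k _ => hfib k).trans ?_
    rw [sum_const, nsmul_eq_mul]
    gcongr
    rw [Int.card_Icc]
    have hgle : g a ≤ g (d - 1) := hmono _ _ le_rfl (by omega) (by omega)
    have hfl : ⌊g a⌋ ≤ ⌊g (d - 1)⌋ := Int.floor_le_floor hgle
    have hcast : (((⌊g (d - 1)⌋ + 1 - ⌊g a⌋).toNat : ℕ) : ℝ)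
        = (⌊g (d - 1)⌋ : ℝ) + 1 - ⌊g a⌋ := by
      have : (((⌊g (d - 1)⌋ + 1 - ⌊g a⌋).toNat : ℕ) : ℤ) = ⌊g (d - 1)⌋ + 1 - ⌊g a⌋ :=
        Int.toNat_of_nonneg (by omega)
      exact_mod_cast this
    rw [hcast]
    have h1 := Int.floor_le (g (d - 1))
    have h2 := Int.lt_floor_add_one (g a)
    have h3 := le_sub_of_increments hinc2 le_rfl (show a ≤ d - 1 by omega) (by omega)
    simp only [Pi.neg_apply] at h3
    have h4 : ((d - 1 : ℕ) : ℝ) ≤ d := by exact_mod_cast Nat.sub_le d 1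
    have h5 : α * l * (((d - 1 : ℕ) : ℝ) - a) ≤ α * l * (d - a : ℝ) := by gcongr
    linarith
  have e3 : l * (1 / √l) = √l := by
    rw [mul_one_div, div_eq_iff hs.ne']; linarith
  have e4 : (α * l * (d - a : ℝ) + 2) * (5 / √l) = 5 * (α * (d - a : ℝ) * √l) + 10 * (1 / √l) := by
    calc _ = 5 * (α * (d - a : ℝ) * (l * (1 / √l))) + 10 * (1 / √l) := by ring
      _ = _ := by rw [e3]
  have h6 : α * (d - a : ℝ) * √l ≤ α * (((d + 1 : ℕ) : ℝ) - a) * √l := by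
    gcongr; linarith
  have h7 : 0 ≤ α * (((d + 1 : ℕ) : ℝ) - a) * √l := by positivity
  rw [e4] at hmain
  linarith

/-- A second difference is a value of the second derivative. -/
lemma exists_second_difference_eq {f f1 f2 : ℝ → ℝ} {x : ℝ}
    (h1 : ∀ y ∈ Set.Icc x (x + 2), HasDerivAt f (f1 y) y)
    (h2 : ∀ y ∈ Set.Icc x (x + 2), HasDerivAt f1 (f2 y) y) :
    ∃ z ∈ Set.Icc x (x + 2), f (x + 2) - 2 * f (x + 1) + f x = f2 z := by
  have hk : ∀ y ∈ Set.Icc x (x + 1), HasDerivAt (fun t => f (t + 1) - f t) (f1 (y + 1) - f1 y) y := by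
    intro y hy
    have a1 := (h1 (y + 1) ⟨by linarith [hy.1], by linarith [hy.2]⟩).comp_add_const y 1
    exact a1.sub (h1 y ⟨hy.1, by linarith [hy.2]⟩)
  obtain ⟨ξ, hξ, e1⟩ := exists_hasDerivAt_eq_slope (fun t => f (t + 1) - f t)
    (fun y => f1 (y + 1) - f1 y) (show x < x + 1 by linarith)
    (fun y hy => (hk y hy).continuousAt.continuousWithinAt)
    (fun y hy => hk y ⟨hy.1.le, hy.2.le⟩)
  obtain ⟨z, hz, e2⟩ := exists_hasDerivAt_eq_slope f1 f2 (show ξ < ξ + 1 by linarith)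
    (fun y hy => (h2 y ⟨by linarith [hy.1, hξ.1], by linarith [hy.2, hξ.2]⟩).continuousAt.continuousWithinAt)
    (fun y hy => h2 y ⟨by linarith [hy.1, hξ.1], by linarith [hy.2, hξ.2]⟩)
  refine ⟨z, ⟨by linarith [hz.1, hξ.1], by linarith [hz.2, hξ.2]⟩, ?_⟩
  simp only [add_sub_cancel_left, div_one] at e1 e2
  rw [e2, e1]
  rw [show x + 1 + 1 = x + 2 by ring]
  ring

/-- Van der Corput's second derivative test for a phase with negative second derivative. -/
lemma van_der_corput {f f1 f2 : ℝ → ℝ} (a b : ℕ) {l α : ℝ} (hl : 0 < l) (hα : 1 ≤ α)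
    (hab : a ≤ b)
    (h1 : ∀ y : ℝ, (a + 1 : ℝ) ≤ y → y ≤ b → HasDerivAt f (f1 y) y)
    (h2 : ∀ y : ℝ, (a + 1 : ℝ) ≤ y → y ≤ b → HasDerivAt f1 (f2 y) y)
    (h3 : ∀ y : ℝ, (a + 1 : ℝ) ≤ y → y ≤ b → l ≤ -f2 y ∧ -f2 y ≤ α * l) :
    ‖∑ n ∈ Ioc a b, ee (f n)‖ ≤ 11 * (α * (b - a : ℝ) * √l + 1 / √l) := by
  have hI : Ioc a b = Ico (a + 1) (b + 1) := by ext n; simp only [mem_Ioc, mem_Ico]; omega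
  have hconj : ‖∑ n ∈ Ioc a b, ee (f n)‖ = ‖∑ n ∈ Ico (a + 1) (b + 1), ee (-f n)‖ := by
    rw [hI, ← RCLike.norm_conj, map_sum]
    simp_rw [ee_neg]
  rw [hconj]
  have := van_der_corput_discrete (fun n => -f n) (a + 1) (b + 1) hl hα (by omega) ?_
  · simpa using this
  intro n hn1 hn2
  have c1 : (a + 1 : ℝ) ≤ n := by exact_mod_cast hn1
  have c2 : (n + 2 : ℝ) ≤ b := by exact_mod_cast (by omega : n + 2 ≤ b)
  obtain ⟨z, hz, e⟩ := exists_second_difference_eq (f := f) (f1 := f1) (f2 := f2) (x := n)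
    (fun y hy => h1 y (by linarith [hy.1]) (by linarith [hy.2]))
    (fun y hy => h2 y (by linarith [hy.1]) (by linarith [hy.2]))
  have := h3 z (by linarith [hz.1]) (by linarith [hz.2])
  push_cast
  constructor <;> linarith

end

end TanPrimes

open Finset

namespace TanPrimes

noncomputable section

/-! ### Bilinear exponential sums -/

/-- A phase `Φ` of size `T` on `[M, M']`, with first and second derivatives `Φ1` and `Φ2`: the
function `y² Φ''(y)` is negative of exact order `T`, and it decreases at a rate of exact order
`T / M`. The constants in both orders are `κ` and `K`. -/
structure IsPhase (κ K T : ℝ) (M M' : ℕ) (Φ Φ1 Φ2 : ℝ → ℝ) : Prop where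
  pos_M : 0 < M
  M'_le : M' ≤ 3 * M
  pos_κ : 0 < κ
  κ_le : κ ≤ K
  pos_T : 0 < T
  hasDeriv : ∀ y : ℝ, (M : ℝ) ≤ y → y ≤ M' → HasDerivAt Φ (Φ1 y) y
  hasDeriv' : ∀ y : ℝ, (M : ℝ) ≤ y → y ≤ M' → HasDerivAt Φ1 (Φ2 y) y
  bound : ∀ y : ℝ, (M : ℝ) ≤ y → y ≤ M' → κ * T ≤ -(y ^ 2 * Φ2 y) ∧ -(y ^ 2 * Φ2 y) ≤ K * T
  bound' : ∀ y z : ℝ, (M : ℝ) ≤ y → y ≤ z → z ≤ M' →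
    κ * T * (z - y) / M ≤ y ^ 2 * Φ2 y - z ^ 2 * Φ2 z ∧
      y ^ 2 * Φ2 y - z ^ 2 * Φ2 z ≤ K * T * (z - y) / M

variable {κ K T : ℝ} {M M' : ℕ} {Φ Φ1 Φ2 : ℝ → ℝ}

lemma hasDerivAt_comp_mul {f : ℝ → ℝ} {f' c y : ℝ} (h : HasDerivAt f f' (c * y)) :
    HasDerivAt (fun t => f (c * t)) (c * f') y := by
  have := h.comp y ((hasDerivAt_id y).const_mul c)
  rw [mul_one, mul_comm] at this
  exact this

/-- The inner sum of a Type I sum, by the second derivative test. -/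
lemma IsPhase.norm_sum_mul_le (h : IsPhase κ K T M M' Φ Φ1 Φ2) {m a b : ℕ} (hm : 0 < m)
    (ha : M ≤ m * (a + 1)) (hb : m * b ≤ M') :
    ‖∑ n ∈ Ioc a b, ee (Φ (m * n))‖
      ≤ 11 * (9 * K / κ * √(κ * T) + 3 * M / (m * √(κ * T))) := by
  have hκ := h.pos_κ
  have hK : 0 < K := hκ.trans_le h.κ_le
  have hT := h.pos_T
  have hM : (0 : ℝ) < M := by exact_mod_cast h.pos_M
  have hm' : (0 : ℝ) < m := by exact_mod_cast hm
  have hM' : (M' : ℝ) ≤ 3 * M := by exact_mod_cast h.M'_le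
  have hs : 0 < √(κ * T) := Real.sqrt_pos.2 (by positivity)
  rcases Nat.lt_or_ge b a with hab | hab
  · rw [Ioc_eq_empty_of_le hab.le, sum_empty, norm_zero]; positivity
  have ha' : (M : ℝ) ≤ m * (a + 1) := by exact_mod_cast ha
  have hb' : (m * b : ℝ) ≤ M' := by exact_mod_cast hb
  have hin : ∀ y : ℝ, (a + 1 : ℝ) ≤ y → y ≤ b → (M : ℝ) ≤ m * y ∧ m * y ≤ M' := fun y h1 h2 =>
    ⟨ha'.trans (by gcongr), le_trans (by gcongr) hb'⟩
  have hsq : √(κ * T * (m / (3 * M)) ^ 2) = √(κ * T) * (m / (3 * M)) := by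
    rw [Real.sqrt_mul (by positivity), Real.sqrt_sq (by positivity)]
  have key := van_der_corput (f := fun y => Φ (m * y)) (f1 := fun y => m * Φ1 (m * y))
    (f2 := fun y => m * (m * Φ2 (m * y))) a b (l := κ * T * (m / (3 * M)) ^ 2) (α := 9 * K / κ)
    (by positivity) (by rw [le_div_iff₀ hκ]; linarith [h.κ_le]) hab
    (fun y h1 h2 => hasDerivAt_comp_mul (h.hasDeriv _ (hin y h1 h2).1 (hin y h1 h2).2))
    (fun y h1 h2 =>
      (hasDerivAt_comp_mul (h.hasDeriv' _ (hin y h1 h2).1 (hin y h1 h2).2)).const_mul _)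
    (fun y h1 h2 => by
      obtain ⟨i1, i2⟩ := hin y h1 h2
      obtain ⟨b1, b2⟩ := h.bound _ i1 i2
      have hx : 0 < (m * y : ℝ) := hM.trans_le i1
      have hy : 0 < y := pos_of_mul_pos_right hx hm'.le
      have e : -(m * (m * Φ2 (m * y))) = -((m * y) ^ 2 * Φ2 (m * y)) * (m / (m * y)) ^ 2 := by
        field_simp
      have b0 : 0 ≤ -((m * y) ^ 2 * Φ2 (m * y)) := le_trans (by positivity) b1
      rw [e]
      constructor
      · have i4 : (m : ℝ) / (3 * M) ≤ m / (m * y) :=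
          div_le_div_of_nonneg_left hm'.le hx (i2.trans hM')
        gcongr
      · have e2 : 9 * K / κ * (κ * T * (m / (3 * M)) ^ 2) = K * T * (m / M : ℝ) ^ 2 := by
          field_simp; ring
        rw [e2]
        gcongr)
  rw [hsq] at key
  refine key.trans ?_
  have hL : (b - a : ℝ) ≤ 3 * M / m := by
    rw [le_div_iff₀ hm']
    have : 0 ≤ (a : ℝ) * m := by positivity
    nlinarith
  have hab' : (0 : ℝ) ≤ b - a := by
    have : (a : ℝ) ≤ b := by exact_mod_cast hab
    linarith
  refine mul_le_mul_of_nonneg_left (add_le_add ?_ ?_) (by norm_num)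
  · calc 9 * K / κ * (b - a : ℝ) * (√(κ * T) * (m / (3 * M)))
        ≤ 9 * K / κ * (3 * M / m) * (√(κ * T) * (m / (3 * M))) := by gcongr
      _ = _ := by field_simp
  · apply le_of_eq; field_simp

/-- The correlation of two columns of a Type II sum. As a function of `m`, the phase
`Φ(n₂ m) - Φ(n₁ m)` has second derivative `((n₂ m)² Φ''(n₂ m) - (n₁ m)² Φ''(n₁ m)) / m²`, which is
what `IsPhase.bound'` controls. -/
lemma IsPhase.norm_sum_sub_le (h : IsPhase κ K T M M' Φ Φ1 Φ2) {ν Q n₁ n₂ : ℕ} (hν : 0 < ν)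
    (h1 : ν ≤ n₁) (h12 : n₁ < n₂) (h2 : n₂ < ν + Q) (hQ : Q ≤ ν) :
    ‖∑ m ∈ Ioc (M / n₁) (M' / n₂), ee (Φ (n₂ * m) - Φ (n₁ * m))‖
      ≤ 11 * (18 * K / (κ * ν) * √(κ * T * Q * ν / 3) + M / √(κ * T * ν / 3)) := by
  have hκ := h.pos_κ
  have hK : 0 < K := hκ.trans_le h.κ_le
  have hT := h.pos_T
  have hM : (0 : ℝ) < M := by exact_mod_cast h.pos_M
  have hν' : (0 : ℝ) < ν := by exact_mod_cast hν
  have hM' : (M' : ℝ) ≤ 3 * M := by exact_mod_cast h.M'_le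
  have hn1 : (0 : ℝ) < n₁ := by exact_mod_cast (by omega : 0 < n₁)
  have hn2 : (0 : ℝ) < n₂ := by exact_mod_cast (by omega : 0 < n₂)
  have hd : (1 : ℝ) ≤ n₂ - n₁ := by
    have : (n₁ + 1 : ℝ) ≤ n₂ := by exact_mod_cast h12
    linarith
  have hd0 : (0 : ℝ) < n₂ - n₁ := by linarith
  have hdQ : (n₂ - n₁ : ℝ) ≤ Q := by
    have h3 : (n₂ : ℝ) ≤ ν + Q := by exact_mod_cast h2.le
    have h4 : (ν : ℝ) ≤ n₁ := by exact_mod_cast h1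
    linarith
  have hs : 0 < √(κ * T * ν / 3) := Real.sqrt_pos.2 (by positivity)
  rcases Nat.lt_or_ge (M' / n₂) (M / n₁) with hab | hab
  · rw [Ioc_eq_empty_of_le hab.le, sum_empty, norm_zero]; positivity
  have hνn1 : (ν : ℝ) ≤ n₁ := by exact_mod_cast h1
  have hνn2 : (ν : ℝ) ≤ n₂ := by linarith
  have hn1ν : (n₁ : ℝ) ≤ 2 * ν := by exact_mod_cast (by omega : n₁ ≤ 2 * ν)
  have hlow : (M : ℝ) ≤ n₁ * ((M / n₁ : ℕ) + 1) := by
    have := (Nat.lt_mul_div_succ M (show 0 < n₁ by omega)).le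
    exact_mod_cast this
  have hupp : (n₂ * (M' / n₂ : ℕ) : ℝ) ≤ M' := by exact_mod_cast Nat.mul_div_le M' n₂
  have hin : ∀ y : ℝ, ((M / n₁ : ℕ) + 1 : ℝ) ≤ y → y ≤ (M' / n₂ : ℕ) →
      0 < y ∧ (M : ℝ) ≤ n₁ * y ∧ (n₁ * y : ℝ) ≤ n₂ * y ∧ (n₂ * y : ℝ) ≤ M' := by
    intro y h3 h4
    have hy : 0 < y := lt_of_lt_of_le (by positivity) h3
    exact ⟨hy, hlow.trans (by gcongr), by gcongr, le_trans (by gcongr) hupp⟩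
  have hl : 0 < κ * T * (n₂ - n₁) * ν / 3 / (M : ℝ) ^ 2 := by positivity
  have hsq : √(κ * T * (n₂ - n₁) * ν / 3 / (M : ℝ) ^ 2) = √(κ * T * (n₂ - n₁) * ν / 3) / M := by
    rw [Real.sqrt_div (by positivity), Real.sqrt_sq hM.le]
  have key := van_der_corput (f := fun y => Φ (n₂ * y) - Φ (n₁ * y))
    (f1 := fun y => n₂ * Φ1 (n₂ * y) - n₁ * Φ1 (n₁ * y))
    (f2 := fun y => n₂ * (n₂ * Φ2 (n₂ * y)) - n₁ * (n₁ * Φ2 (n₁ * y)))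
    (M / n₁) (M' / n₂) (α := 6 * K / κ) hl
    (by rw [le_div_iff₀ hκ]; linarith [h.κ_le]) hab
    (fun y h3 h4 => by
      obtain ⟨i0, i1, i2, i3⟩ := hin y h3 h4
      exact (hasDerivAt_comp_mul (h.hasDeriv _ (i1.trans i2) i3)).sub
        (hasDerivAt_comp_mul (h.hasDeriv _ i1 (i2.trans i3))))
    (fun y h3 h4 => by
      obtain ⟨i0, i1, i2, i3⟩ := hin y h3 h4
      exact ((hasDerivAt_comp_mul (h.hasDeriv' _ (i1.trans i2) i3)).const_mul _).sub
        ((hasDerivAt_comp_mul (h.hasDeriv' _ i1 (i2.trans i3))).const_mul _))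
    (fun y h3 h4 => by
      obtain ⟨i0, i1, i2, i3⟩ := hin y h3 h4
      obtain ⟨b1, b2⟩ := h.bound' _ _ i1 i2 i3
      have e : -(n₂ * (n₂ * Φ2 (n₂ * y)) - n₁ * (n₁ * Φ2 (n₁ * y)))
          = ((n₁ * y) ^ 2 * Φ2 (n₁ * y) - (n₂ * y) ^ 2 * Φ2 (n₂ * y)) / y ^ 2 := by
        field_simp; ring
      have e1 : ∀ c : ℝ, c * T * (n₂ * y - n₁ * y) / M / y ^ 2 = c * T * (n₂ - n₁) / M / y := by
        intro c; field_simp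
      have y1 : y ≤ 3 * M / ν := by
        rw [le_div_iff₀ hν']
        nlinarith
      have y2 : M / (2 * ν) ≤ y := by
        rw [div_le_iff₀ (by positivity)]
        nlinarith
      rw [e]
      constructor
      · calc κ * T * (n₂ - n₁) * ν / 3 / (M : ℝ) ^ 2
            = κ * T * (n₂ - n₁) / M / (3 * M / ν) := by field_simp
          _ ≤ κ * T * (n₂ - n₁) / M / y := by gcongr
          _ = κ * T * (n₂ * y - n₁ * y) / M / y ^ 2 := (e1 κ).symm
          _ ≤ _ := by gcongr
      · calc _ ≤ K * T * (n₂ * y - n₁ * y) / M / y ^ 2 := by gcongr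
          _ = K * T * (n₂ - n₁) / M / y := e1 K
          _ ≤ K * T * (n₂ - n₁) / M / (M / (2 * ν)) := by gcongr
          _ = _ := by field_simp; ring)
  rw [hsq] at key
  refine key.trans ?_
  have hL : ((M' / n₂ : ℕ) - (M / n₁ : ℕ) : ℝ) ≤ 3 * M / ν := by
    rw [le_div_iff₀ hν']
    have i1 : (0 : ℝ) ≤ (M / n₁ : ℕ) := by positivity
    have i2 : (0 : ℝ) ≤ (M' / n₂ : ℕ) := by positivity
    nlinarith
  have hL0 : (0 : ℝ) ≤ (M' / n₂ : ℕ) - (M / n₁ : ℕ) := by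
    have : ((M / n₁ : ℕ) : ℝ) ≤ (M' / n₂ : ℕ) := by exact_mod_cast hab
    linarith
  refine mul_le_mul_of_nonneg_left (add_le_add ?_ ?_) (by norm_num)
  · calc 6 * K / κ * ((M' / n₂ : ℕ) - (M / n₁ : ℕ) : ℝ) * (√(κ * T * (n₂ - n₁) * ν / 3) / M)
        ≤ 6 * K / κ * (3 * M / ν) * (√(κ * T * Q * ν / 3) / M) := by gcongr
      _ = _ := by field_simp; ring
  · rw [one_div_div]
    have i1 : κ * T * ν ≤ κ * T * (n₂ - n₁) * ν := by
      calc κ * T * ν = κ * T * 1 * ν := by ring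
        _ ≤ _ := by gcongr
    gcongr

/-- One block of columns of a Type II sum. Cauchy's inequality in `m` removes the coefficients `A`;
expanding the square leaves the diagonal and the correlations of `IsPhase.norm_sum_sub_le`. -/
lemma IsPhase.norm_block_sq_le (h : IsPhase κ K T M M' Φ Φ1 Φ2) {ν Q : ℕ} (hν : 0 < ν)
    (hQ : Q ≤ ν) {A B : ℕ → ℝ} {A₀ B₀ : ℝ} (hB₀ : 0 ≤ B₀)
    (hA : ∀ m, 0 < m → m ≤ M' → |A m| ≤ A₀) (hB : ∀ n ∈ Ico ν (ν + Q), |B n| ≤ B₀) :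
    ‖∑ n ∈ Ico ν (ν + Q), ∑ m ∈ Ioc (M / n) (M' / n), (A m * B n : ℂ) * ee (Φ (n * m))‖ ^ 2
      ≤ A₀ ^ 2 * B₀ ^ 2 * (3 * M / ν) * (Q * (3 * M / ν) + Q ^ 2 *
        (11 * (18 * K / (κ * ν) * √(κ * T * Q * ν / 3) + M / √(κ * T * ν / 3)))) := by
  have hκ := h.pos_κ
  have hK : 0 < K := hκ.trans_le h.κ_le
  have hT := h.pos_T
  have hM : (0 : ℝ) < M := by exact_mod_cast h.pos_M
  have hν' : (0 : ℝ) < ν := by exact_mod_cast hν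
  have hM' : (M' : ℝ) ≤ 3 * M := by exact_mod_cast h.M'_le
  set W : ℝ := 11 * (18 * K / (κ * ν) * √(κ * T * Q * ν / 3) + M / √(κ * T * ν / 3)) with hW
  have hW0 : 0 ≤ W := by positivity
  set I := Ico ν (ν + Q) with hI
  set J := Ioc 0 (M' / ν) with hJ
  have hIpos : ∀ n ∈ I, 0 < n := fun n hn => by rw [hI, mem_Ico] at hn; omega
  have hJc : (J.card : ℝ) ≤ 3 * M / ν := by
    rw [hJ, Nat.card_Ioc, Nat.sub_zero]
    exact Nat.cast_div_le.trans (by gcongr)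
  set P : ℕ → ℕ → Prop := fun m n => M < n * m ∧ n * m ≤ M' with hP
  set z : ℕ → ℕ → ℂ := fun m n => if P m n then (B n : ℂ) * ee (Φ (n * m)) else 0 with hz
  have hfil : ∀ n ∈ I, Ioc (M / n) (M' / n) = J.filter (fun m => P m n) := by
    intro n hn
    have hn0 := hIpos n hn
    ext m
    simp only [mem_Ioc, hJ, mem_filter, hP, Nat.div_lt_iff_lt_mul hn0, Nat.le_div_iff_mul_le hn0,
      mul_comm m n]
    constructor
    · rintro ⟨h1, h2⟩
      refine ⟨⟨Nat.pos_of_ne_zero fun h0 => by simp [h0] at h1, ?_⟩, h1, h2⟩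
      rw [Nat.le_div_iff_mul_le hν]
      rw [hI, mem_Ico] at hn
      calc m * ν ≤ m * n := Nat.mul_le_mul_left _ hn.1
        _ ≤ M' := by rwa [mul_comm]
    · exact fun h3 => h3.2
  have hS : ∑ n ∈ I, ∑ m ∈ Ioc (M / n) (M' / n), (A m * B n : ℂ) * ee (Φ (n * m))
      = ∑ m ∈ J, (A m : ℂ) * ∑ n ∈ I, z m n := by
    simp_rw [mul_sum]
    rw [sum_comm]
    refine sum_congr rfl fun n hn => ?_
    rw [hfil n hn, sum_filter]
    refine sum_congr rfl fun m _ => ?_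
    simp only [hz]
    split_ifs
    · ring
    · simp
  rw [hS]
  have hCS : ‖∑ m ∈ J, (A m : ℂ) * ∑ n ∈ I, z m n‖ ^ 2
      ≤ (∑ m ∈ J, |A m| ^ 2) * ∑ m ∈ J, ‖∑ n ∈ I, z m n‖ ^ 2 := by
    refine le_trans ?_ (sum_mul_sq_le_sq_mul_sq J _ _)
    gcongr
    refine (norm_sum_le _ _).trans (le_of_eq ?_)
    simp
  have h1 : ∑ m ∈ J, |A m| ^ 2 ≤ A₀ ^ 2 * (3 * M / ν) := by
    calc _ ≤ ∑ m ∈ J, A₀ ^ 2 := by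
          refine sum_le_sum fun m hm => ?_
          rw [hJ, mem_Ioc] at hm
          gcongr
          exact hA m hm.1 (hm.2.trans (Nat.div_le_self _ _))
      _ = A₀ ^ 2 * J.card := by rw [sum_const, nsmul_eq_mul, mul_comm]
      _ ≤ _ := by gcongr
  have hoff : ∀ n₁ ∈ I, ∀ n₂ ∈ I, n₁ < n₂ →
      ‖∑ m ∈ J, (if P m n₁ ∧ P m n₂ then ee (Φ (n₂ * m) - Φ (n₁ * m)) else 0)‖ ≤ W := by
    intro n₁ hn1 n₂ hn2 hlt
    have hn1' := hIpos _ hn1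
    have hn2' := hIpos _ hn2
    have : J.filter (fun m => P m n₁ ∧ P m n₂) = Ioc (M / n₁) (M' / n₂) := by
      have e1 := hfil n₁ hn1
      have e2 := hfil n₂ hn2
      rw [filter_and, ← e1, ← e2]
      ext m
      simp only [mem_inter, mem_Ioc]
      have m1 : M / n₂ ≤ M / n₁ := Nat.div_le_div_left hlt.le hn1'
      have m2 : M' / n₂ ≤ M' / n₁ := Nat.div_le_div_left hlt.le hn1'
      constructor
      · rintro ⟨⟨a1, a2⟩, a3, a4⟩; exact ⟨a1, a4⟩
      · rintro ⟨a1, a2⟩; exact ⟨⟨a1, a2.trans m2⟩, m1.trans_lt a1, a2⟩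
    rw [← sum_filter, this]
    rw [hI, mem_Ico] at hn1 hn2
    exact h.norm_sum_sub_le hν hn1.1 hlt hn2.2 hQ
  have hker : ∀ n₁ ∈ I, ∀ n₂ ∈ I,
      ‖∑ m ∈ J, z m n₁ * (starRingEnd ℂ) (z m n₂)‖
        ≤ B₀ ^ 2 * (if n₁ = n₂ then (3 * M / ν : ℝ) else W) := by
    intro n₁ hn1 n₂ hn2
    have e : ∑ m ∈ J, z m n₁ * (starRingEnd ℂ) (z m n₂) = (B n₁ * B n₂ : ℂ) *
        ∑ m ∈ J, (if P m n₁ ∧ P m n₂ then ee (Φ (n₁ * m) - Φ (n₂ * m)) else 0) := by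
      rw [mul_sum]
      refine sum_congr rfl fun m _ => ?_
      simp only [hz]
      by_cases p1 : P m n₁ <;> by_cases p2 : P m n₂ <;> simp [p1, p2, ee_sub]
      ring
    rw [e, norm_mul, norm_mul, Complex.norm_real, Complex.norm_real, Real.norm_eq_abs,
      Real.norm_eq_abs]
    have hBB : |B n₁| * |B n₂| ≤ B₀ ^ 2 := by
      rw [sq]; exact mul_le_mul (hB _ hn1) (hB _ hn2) (abs_nonneg _) hB₀
    refine mul_le_mul hBB ?_ (norm_nonneg _) (by positivity)
    split_ifs with heq
    · refine (norm_sum_le _ _).trans (le_trans (sum_le_sum (g := fun _ => (1 : ℝ)) ?_) ?_)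
      · intro m _
        split_ifs
        · rw [norm_ee]
        · simp
      · simpa using hJc
    · rcases Nat.lt_or_gt_of_ne heq with hlt | hlt
      · rw [← RCLike.norm_conj, map_sum]
        refine le_trans (le_of_eq ?_) (hoff n₁ hn1 n₂ hn2 hlt)
        congr 1
        refine sum_congr rfl fun m _ => ?_
        split_ifs
        · rw [← ee_neg, neg_sub]
        · simp
      · refine le_trans (le_of_eq ?_) (hoff n₂ hn2 n₁ hn1 hlt)
        congr 1
        refine sum_congr rfl fun m _ => ?_
        simp only [and_comm]
  have h2 : ∑ m ∈ J, ‖∑ n ∈ I, z m n‖ ^ 2 ≤ B₀ ^ 2 * (Q * (3 * M / ν) + Q ^ 2 * W) := by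
    have e : ((∑ m ∈ J, ‖∑ n ∈ I, z m n‖ ^ 2 : ℝ) : ℂ)
        = ∑ n₁ ∈ I, ∑ n₂ ∈ I, ∑ m ∈ J, z m n₁ * (starRingEnd ℂ) (z m n₂) := by
      push_cast
      calc _ = ∑ m ∈ J, ∑ n₁ ∈ I, ∑ n₂ ∈ I, z m n₁ * (starRingEnd ℂ) (z m n₂) := by
            refine sum_congr rfl fun m _ => ?_
            rw [← Complex.mul_conj', map_sum, sum_mul_sum]
        _ = _ := by
            rw [sum_comm]
            exact sum_congr rfl fun _ _ => sum_comm
    have e2 : ∑ m ∈ J, ‖∑ n ∈ I, z m n‖ ^ 2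
        = ‖∑ n₁ ∈ I, ∑ n₂ ∈ I, ∑ m ∈ J, z m n₁ * (starRingEnd ℂ) (z m n₂)‖ := by
      rw [← e, Complex.norm_real, Real.norm_of_nonneg (by positivity)]
    rw [e2]
    calc _ ≤ ∑ n₁ ∈ I, ∑ n₂ ∈ I, B₀ ^ 2 * (if n₁ = n₂ then (3 * M / ν : ℝ) else W) := by
          refine (norm_sum_le _ _).trans (sum_le_sum fun n₁ hn1 => ?_)
          exact (norm_sum_le _ _).trans (sum_le_sum fun n₂ hn2 => hker n₁ hn1 n₂ hn2)
      _ ≤ ∑ n₁ ∈ I, ∑ n₂ ∈ I, B₀ ^ 2 * ((if n₁ = n₂ then (3 * M / ν : ℝ) else 0) + W) := by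
          refine sum_le_sum fun n₁ _ => sum_le_sum fun n₂ _ => ?_
          gcongr
          split_ifs
          · linarith
          · linarith
      _ = _ := by
          have hc : I.card = Q := by rw [hI, Nat.card_Ico]; omega
          simp_rw [← mul_sum, sum_add_distrib, sum_const, hc, nsmul_eq_mul]
          congr 1
          rw [sum_congr rfl fun n₁ hn1 => by rw [sum_ite_eq, if_pos hn1], sum_const, hc,
            nsmul_eq_mul]
          ring
  refine hCS.trans ?_
  calc _ ≤ (A₀ ^ 2 * (3 * M / ν)) * (B₀ ^ 2 * (Q * (3 * M / ν) + Q ^ 2 * W)) := by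
        gcongr
    _ = _ := by ring

end

end TanPrimes

open Finset

namespace TanPrimes

noncomputable section

variable {κ K T : ℝ} {M M' : ℕ} {Φ Φ1 Φ2 : ℝ → ℝ}

/-- The constant in the Type II estimate. -/
def typeIIConst (κ K : ℝ) : ℝ := 9 + 1188 * K ^ 2 / κ + 33 * √(6 / κ)

/-- The block estimate with the number of columns `Q` of order `ρ²`, where `M = ρ¹²`. -/
lemma IsPhase.norm_block_le (h : IsPhase κ K T M M' Φ Φ1 Φ2) {ρ : ℝ} (hρ : 1 ≤ ρ)
    (hM : (M : ℝ) = ρ ^ 12) (hT1 : ρ ^ 10 ≤ T) (hT2 : T ≤ K * ρ ^ 12) {Q k : ℕ}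
    (hQ1 : ρ ^ 2 ≤ Q) (hQ2 : Q ≤ 2 * ρ ^ 2) (hk : 0 < k) (hkQ : (k * Q : ℝ) ≤ 2 * ρ ^ 6)
    {A B : ℕ → ℝ} {A₀ B₀ : ℝ} (hA₀ : 0 ≤ A₀) (hB₀ : 0 ≤ B₀)
    (hA : ∀ m, 0 < m → m ≤ M' → |A m| ≤ A₀) (hB : ∀ n ∈ Ico (k * Q) (k * Q + Q), |B n| ≤ B₀) :
    ‖∑ n ∈ Ico (k * Q) (k * Q + Q), ∑ m ∈ Ioc (M / n) (M' / n), (A m * B n : ℂ) * ee (Φ (n * m))‖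
      ≤ A₀ * B₀ * √(typeIIConst κ K) * ρ ^ 11 * (1 / k) := by
  have hκ := h.pos_κ
  have hκK := h.κ_le
  have hK : 0 < K := hκ.trans_le hκK
  have hT := h.pos_T
  have hρ0 : 0 < ρ := by linarith
  have hQ0 : (0 : ℝ) < Q := lt_of_lt_of_le (by positivity) hQ1
  have hk0 : (0 : ℝ) < k := by exact_mod_cast hk
  have hQn : 0 < Q := by exact_mod_cast hQ0
  have hC : 0 < typeIIConst κ K := by unfold typeIIConst; positivity
  have key := h.norm_block_sq_le (ν := k * Q) (Q := Q) (Nat.mul_pos hk hQn)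
    (Nat.le_mul_of_pos_left Q hk) hB₀ hA hB
  refine le_of_sq_le_sq ?_ (by positivity)
  refine key.trans ?_
  rw [hM]
  push_cast
  set ν : ℝ := k * Q with hν
  have hν0 : 0 < ν := by positivity
  have t1 : 3 * ρ ^ 12 / ν * (Q * (3 * ρ ^ 12 / ν)) ≤ 9 * (ρ ^ 22 * (1 / k) ^ 2) := by
    calc 3 * ρ ^ 12 / ν * (Q * (3 * ρ ^ 12 / ν)) = 9 * (ρ ^ 24 / Q * (1 / k) ^ 2) := by
          rw [hν]; field_simp; ring
      _ ≤ 9 * (ρ ^ 24 / ρ ^ 2 * (1 / k) ^ 2) := by gcongr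
      _ = _ := by field_simp
  have s2 : √(κ * T * Q * ν / 3) ≤ 2 * K * ρ ^ 10 := by
    rw [Real.sqrt_le_left (by positivity)]
    calc κ * T * Q * ν / 3 ≤ K * (K * ρ ^ 12) * (2 * ρ ^ 2) * (2 * ρ ^ 6) / 3 := by gcongr
      _ ≤ _ := by
        have : 0 ≤ K ^ 2 * ρ ^ 20 := by positivity
        nlinarith
  have t2 : 3 * ρ ^ 12 / ν * (Q ^ 2 * (11 * (18 * K / (κ * ν) * √(κ * T * Q * ν / 3))))
      ≤ 1188 * K ^ 2 / κ * (ρ ^ 22 * (1 / k) ^ 2) := by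
    calc _ ≤ 3 * ρ ^ 12 / ν * (Q ^ 2 * (11 * (18 * K / (κ * ν) * (2 * K * ρ ^ 10)))) := by
          gcongr
      _ = _ := by rw [hν]; field_simp; ring
  have s3 : ν / √(κ * T * ν / 3) ≤ √(6 / κ) / ρ ^ 2 := by
    have e1 : ν / √(κ * T * ν / 3) = √(3 * ν / (κ * T)) := by
      have : ν = √(ν ^ 2) := (Real.sqrt_sq hν0.le).symm
      conv_lhs => rw [this]
      rw [Real.sqrt_sq hν0.le]
      nth_rw 1 [this]
      rw [← Real.sqrt_div (by positivity)]
      congr 1; field_simp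
    have e2 : √(6 / κ) / ρ ^ 2 = √(6 / κ / ρ ^ 4) := by
      rw [show ρ ^ 4 = (ρ ^ 2) ^ 2 by ring,
        Real.sqrt_div (show 0 ≤ 6 / κ by positivity) ((ρ ^ 2) ^ 2), Real.sqrt_sq (by positivity)]
    rw [e1, e2]
    apply Real.sqrt_le_sqrt
    calc 3 * ν / (κ * T) ≤ 3 * (2 * ρ ^ 6) / (κ * ρ ^ 10) := by gcongr
      _ = _ := by field_simp; ring
  have t3 : 3 * ρ ^ 12 / ν * (Q ^ 2 * (11 * (ρ ^ 12 / √(κ * T * ν / 3))))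
      ≤ 33 * √(6 / κ) * (ρ ^ 22 * (1 / k) ^ 2) := by
    have hs : 0 < √(κ * T * ν / 3) := Real.sqrt_pos.2 (by positivity)
    calc _ = 33 * ρ ^ 24 * (1 / k) ^ 2 * (ν / √(κ * T * ν / 3)) := by
          rw [hν]; field_simp; ring
      _ ≤ 33 * ρ ^ 24 * (1 / k) ^ 2 * (√(6 / κ) / ρ ^ 2) := by gcongr
      _ = _ := by field_simp
  have hAB : 0 ≤ A₀ ^ 2 * B₀ ^ 2 := by positivity
  calc _ = A₀ ^ 2 * B₀ ^ 2 * (3 * ρ ^ 12 / ν * (Q * (3 * ρ ^ 12 / ν))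
        + 3 * ρ ^ 12 / ν * (Q ^ 2 * (11 * (18 * K / (κ * ν) * √(κ * T * Q * ν / 3))))
        + 3 * ρ ^ 12 / ν * (Q ^ 2 * (11 * (ρ ^ 12 / √(κ * T * ν / 3))))) := by ring
    _ ≤ A₀ ^ 2 * B₀ ^ 2 * (typeIIConst κ K * (ρ ^ 22 * (1 / k) ^ 2)) := by
        refine mul_le_mul_of_nonneg_left ?_ hAB
        unfold typeIIConst
        linarith
    _ = A₀ ^ 2 * B₀ ^ 2 * (√(typeIIConst κ K) ^ 2 * (ρ ^ 22 * (1 / k) ^ 2)) := by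
        rw [Real.sq_sqrt hC.le]
    _ = _ := by ring

lemma sum_Ico_blocks (f : ℕ → ℂ) (Q k : ℕ) :
    ∑ n ∈ Ico Q ((k + 1) * Q), f n
      = ∑ j ∈ Ico 1 (k + 1), ∑ n ∈ Ico (j * Q) (j * Q + Q), f n := by
  induction k with
  | zero => simp
  | succ k ih =>
    rw [sum_Ico_succ_top (by omega), ← ih, ← sum_Ico_consecutive f (n := (k + 1) * Q)
      (by nlinarith) (by nlinarith)]
    congr 2
    ring_nf

lemma sum_inv_le_one_add_log {k N : ℕ} (hk : k ≤ N) :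
    ∑ j ∈ Ico 1 (k + 1), (1 / j : ℝ) ≤ 1 + Real.log N := by
  rcases Nat.eq_zero_or_pos k with rfl | hk0
  · simpa using le_trans zero_le_one (by
      have : 0 ≤ Real.log N := Real.log_natCast_nonneg N
      linarith : (1 : ℝ) ≤ 1 + Real.log N)
  have h1 := harmonic_le_one_add_log k
  have h2 : ((harmonic k : ℚ) : ℝ) = ∑ j ∈ Ico 1 (k + 1), (1 / j : ℝ) := by
    rw [harmonic, range_eq_Ico, sum_Ico_eq_sum_range, sum_Ico_eq_sum_range]
    push_cast
    simp only [Nat.sub_zero, one_div]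
    refine sum_congr rfl fun x _ => ?_
    congr 1; ring
  rw [← h2]
  refine h1.trans ?_
  have : Real.log k ≤ Real.log N :=
    Real.log_le_log (by exact_mod_cast hk0) (by exact_mod_cast hk)
  linarith

/-- A Type II sum whose smooth variable `n` runs over a range of length at most `√M'`. -/
lemma IsPhase.norm_typeII_half_le (h : IsPhase κ K T M M' Φ Φ1 Φ2) {ρ : ℝ} (hρ : 1 ≤ ρ)
    (hM : (M : ℝ) = ρ ^ 12) (hT1 : ρ ^ 10 ≤ T) (hT2 : T ≤ K * ρ ^ 12) {Q R : ℕ}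
    (hQ1 : ρ ^ 2 ≤ Q) (hQ2 : Q ≤ 2 * ρ ^ 2) (hR : R * R ≤ M')
    {A B : ℕ → ℝ} {A₀ B₀ : ℝ} (hA₀ : 0 ≤ A₀) (hB₀ : 0 ≤ B₀)
    (hA : ∀ m, 0 < m → m ≤ M' → |A m| ≤ A₀) (hB : ∀ n, 0 < n → n ≤ R → |B n| ≤ B₀)
    (hBQ : ∀ n < Q, B n = 0) :
    ‖∑ n ∈ Ioc 0 R, ∑ m ∈ Ioc (M / n) (M' / n), (A m * B n : ℂ) * ee (Φ (n * m))‖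
      ≤ A₀ * B₀ * √(typeIIConst κ K) * ρ ^ 11 * (1 + Real.log M') := by
  have hM0 := h.pos_M
  have hρ0 : 0 < ρ := by linarith
  have hQ0 : (0 : ℝ) < Q := lt_of_lt_of_le (by positivity) hQ1
  have hQn : 0 < Q := by exact_mod_cast hQ0
  rcases Nat.eq_zero_or_pos R with rfl | hR0
  · have : 0 ≤ Real.log M' := Real.log_natCast_nonneg M'
    simp only [Ioc_self, sum_empty, norm_zero]
    positivity
  have hRM : R ≤ M' := (Nat.le_mul_self R).trans hR
  set k := R / Q with hk
  have hk1 : R < (k + 1) * Q := by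
    have := Nat.lt_mul_div_succ R hQn
    rwa [mul_comm] at this
  have hk2 : k * Q ≤ R := Nat.div_mul_le_self R Q
  have hR6 : (R : ℝ) ≤ 2 * ρ ^ 6 := by
    refine le_of_sq_le_sq ?_ (by positivity)
    have h1 : (R * R : ℝ) ≤ M' := by exact_mod_cast hR
    have h2 : (M' : ℝ) ≤ 3 * M := by exact_mod_cast h.M'_le
    have h3 : 0 < ρ ^ 12 := by positivity
    nlinarith
  set B' : ℕ → ℝ := fun n => if n ≤ R then B n else 0 with hB'
  set G : ℕ → ℂ := fun n => ∑ m ∈ Ioc (M / n) (M' / n), (A m * B' n : ℂ) * ee (Φ (n * m)) with hG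
  have e1 : ∑ n ∈ Ioc 0 R, ∑ m ∈ Ioc (M / n) (M' / n), (A m * B n : ℂ) * ee (Φ (n * m))
      = ∑ n ∈ Ico Q ((k + 1) * Q), G n := by
    have hG1 : ∀ n ∈ Ioc 0 R,
        ∑ m ∈ Ioc (M / n) (M' / n), (A m * B n : ℂ) * ee (Φ (n * m)) = G n := by
      intro n hn
      rw [mem_Ioc] at hn
      simp [hG, hB', hn.2]
    rw [sum_congr rfl hG1]
    have hz : ∀ n, (n < Q ∨ R < n) → G n = 0 := by
      intro n hn
      have : B' n = 0 := by
        simp only [hB']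
        split_ifs with h1
        · rcases hn with h2 | h2
          · exact hBQ n h2
          · omega
        · rfl
      simp [hG, this]
    rw [← sum_subset (s₁ := Ioc 0 R ∩ Ico Q ((k + 1) * Q)) inter_subset_left, ← sum_subset
      (s₁ := Ioc 0 R ∩ Ico Q ((k + 1) * Q)) (s₂ := Ico Q ((k + 1) * Q)) inter_subset_right]
    · intro n h1 h2
      apply hz
      simp only [mem_inter, mem_Ioc, mem_Ico] at h1 h2
      by_contra hcon
      push Not at hcon
      exact h2 ⟨⟨by omega, hcon.2⟩, h1⟩
    · intro n h1 h2
      apply hz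
      simp only [mem_inter, mem_Ioc, mem_Ico] at h1 h2
      by_contra hcon
      push Not at hcon
      exact h2 ⟨h1, hcon.1, by omega⟩
  rw [e1, sum_Ico_blocks]
  have hB'0 : ∀ n, 0 < n → |B' n| ≤ B₀ := by
    intro n hn
    simp only [hB']
    split_ifs with h1
    · exact hB n hn h1
    · simpa using hB₀
  calc _ ≤ ∑ j ∈ Ico 1 (k + 1), A₀ * B₀ * √(typeIIConst κ K) * ρ ^ 11 * (1 / j : ℝ) := by
        refine (norm_sum_le _ _).trans (sum_le_sum fun j hj => ?_)
        rw [mem_Ico] at hj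
        refine h.norm_block_le hρ hM hT1 hT2 hQ1 hQ2 hj.1 ?_ hA₀ hB₀ hA fun n hn => hB'0 n ?_
        · refine le_trans ?_ hR6
          have : j * Q ≤ R := (Nat.mul_le_mul_right Q (by omega : j ≤ k)).trans hk2
          exact_mod_cast this
        · rw [mem_Ico] at hn
          have : 0 < j * Q := Nat.mul_pos hj.1 hQn
          omega
    _ = A₀ * B₀ * √(typeIIConst κ K) * ρ ^ 11 * ∑ j ∈ Ico 1 (k + 1), (1 / j : ℝ) := by
        rw [mul_sum]
    _ ≤ _ := by
        gcongr
        exact sum_inv_le_one_add_log ((Nat.div_le_self R Q).trans hRM)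

/-- Summation over a hyperbolic region, by columns. -/
lemma sum_divisorsAntidiagonal_eq (M M' : ℕ) (F : ℕ → ℕ → ℂ) :
    ∑ l ∈ Ioc M M', ∑ x ∈ l.divisorsAntidiagonal, F x.1 x.2
      = ∑ n ∈ Ioc 0 M', ∑ m ∈ Ioc (M / n) (M' / n), F m n := by
  rw [sum_sigma', sum_sigma']
  refine sum_bij' (fun x _ => ⟨x.2.2, x.2.1⟩) (fun y _ => ⟨y.2 * y.1, (y.2, y.1)⟩) ?_ ?_ ?_ ?_ ?_
  · rintro ⟨l, m, n⟩ hx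
    simp only [mem_sigma, mem_Ioc, Nat.mem_divisorsAntidiagonal] at hx ⊢
    obtain ⟨⟨h1, h2⟩, rfl, h3⟩ := hx
    have hm : 0 < m := Nat.pos_of_ne_zero fun h => h3 (by simp [h])
    have hn : 0 < n := Nat.pos_of_ne_zero fun h => h3 (by simp [h])
    refine ⟨⟨hn, (Nat.le_mul_of_pos_left n hm).trans h2⟩, ?_, ?_⟩
    · rwa [Nat.div_lt_iff_lt_mul hn]
    · rwa [Nat.le_div_iff_mul_le hn]
  · rintro ⟨n, m⟩ hx
    simp only [mem_sigma, mem_Ioc, Nat.mem_divisorsAntidiagonal] at hx ⊢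
    obtain ⟨⟨h1, h2⟩, h3, h4⟩ := hx
    rw [Nat.div_lt_iff_lt_mul h1] at h3
    rw [Nat.le_div_iff_mul_le h1] at h4
    exact ⟨⟨h3, h4⟩, trivial, by omega⟩
  · rintro ⟨l, m, n⟩ hx
    simp only [mem_sigma, mem_Ioc, Nat.mem_divisorsAntidiagonal] at hx
    obtain ⟨⟨h1, h2⟩, rfl, h3⟩ := hx
    rfl
  · rintro ⟨n, m⟩ hx
    rfl
  · rintro ⟨l, m, n⟩ hx
    rfl

/-- The Type II estimate: both variables are at least `Q`. One of them is at most `√M'`, and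
that one is cut into blocks of length `Q`. -/
lemma IsPhase.norm_typeII_le (h : IsPhase κ K T M M' Φ Φ1 Φ2) {ρ : ℝ} (hρ : 1 ≤ ρ)
    (hM : (M : ℝ) = ρ ^ 12) (hT1 : ρ ^ 10 ≤ T) (hT2 : T ≤ K * ρ ^ 12) {Q : ℕ}
    (hQ1 : ρ ^ 2 ≤ Q) (hQ2 : Q ≤ 2 * ρ ^ 2)
    {A B : ℕ → ℝ} {A₀ B₀ : ℝ} (hA₀ : 0 ≤ A₀) (hB₀ : 0 ≤ B₀)
    (hA : ∀ m, 0 < m → m ≤ M' → |A m| ≤ A₀) (hB : ∀ n, 0 < n → n ≤ M' → |B n| ≤ B₀)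
    (hAQ : ∀ m < Q, A m = 0) (hBQ : ∀ n < Q, B n = 0) :
    ‖∑ l ∈ Ioc M M', ∑ x ∈ l.divisorsAntidiagonal, (A x.1 * B x.2 : ℂ) * ee (Φ l)‖
      ≤ 2 * (A₀ * B₀ * √(typeIIConst κ K) * ρ ^ 11 * (1 + Real.log M')) := by
  set R := Nat.sqrt M' with hRdef
  have hR : R * R ≤ M' := Nat.sqrt_le M'
  have hR' : M' < (R + 1) * (R + 1) := Nat.lt_succ_sqrt M'
  have hRM : R ≤ M' := Nat.sqrt_le_self M'
  set B1 : ℕ → ℝ := fun n => if n ≤ R then B n else 0 with hB1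
  set B2 : ℕ → ℝ := fun n => if n ≤ R then 0 else B n with hB2
  have hsplit : ∑ l ∈ Ioc M M', ∑ x ∈ l.divisorsAntidiagonal, (A x.1 * B x.2 : ℂ) * ee (Φ l)
      = ∑ l ∈ Ioc M M', ∑ x ∈ l.divisorsAntidiagonal, (A x.1 * B1 x.2 : ℂ) * ee (Φ (x.2 * x.1))
      + ∑ l ∈ Ioc M M', ∑ x ∈ l.divisorsAntidiagonal,
        (B2 x.1 * A x.2 : ℂ) * ee (Φ (x.2 * x.1)) := by
    rw [← sum_add_distrib]
    refine sum_congr rfl fun l hl => ?_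
    have hswap : ∑ x ∈ l.divisorsAntidiagonal, (B2 x.1 * A x.2 : ℂ) * ee (Φ (x.2 * x.1))
        = ∑ x ∈ l.divisorsAntidiagonal, (B2 x.2 * A x.1 : ℂ) * ee (Φ (x.1 * x.2)) :=
      sum_equiv (Equiv.prodComm ℕ ℕ) (fun x => by simp) (fun x _ => rfl)
    rw [hswap, ← sum_add_distrib]
    refine sum_congr rfl fun x hx => ?_
    have : (l : ℝ) = x.1 * x.2 := by
      rw [← (Nat.mem_divisorsAntidiagonal.1 hx).1]; push_cast; ring
    rw [this, mul_comm (x.2 : ℝ)]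
    simp only [hB1, hB2]
    split_ifs <;> push_cast <;> ring
  have cut : ∀ (A' B' : ℕ → ℝ), (∀ m n, R < n → m * n ≤ M' → A' m * B' n = 0) →
      ∑ l ∈ Ioc M M', ∑ x ∈ l.divisorsAntidiagonal, (A' x.1 * B' x.2 : ℂ) * ee (Φ (x.2 * x.1))
      = ∑ n ∈ Ioc 0 R, ∑ m ∈ Ioc (M / n) (M' / n), (A' m * B' n : ℂ) * ee (Φ (n * m)) := by
    intro A' B' hz
    rw [sum_divisorsAntidiagonal_eq M M' (fun m n => (A' m * B' n : ℂ) * ee (Φ (n * m)))]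
    symm
    refine sum_subset (Ioc_subset_Ioc_right hRM) fun n hn hn' => ?_
    rw [mem_Ioc] at hn hn'
    refine sum_eq_zero fun m hm => ?_
    rw [mem_Ioc, Nat.le_div_iff_mul_le hn.1] at hm
    have := hz m n (by omega) hm.2
    have : (A' m * B' n : ℂ) = 0 := by exact_mod_cast this
    rw [this, zero_mul]
  rw [hsplit, cut A B1 (fun m n hn _ => by simp [hB1, hn]), cut B2 A (fun m n hn hmn => ?_), two_mul]
  · refine (norm_add_le _ _).trans (add_le_add ?_ ?_)
    · refine h.norm_typeII_half_le hρ hM hT1 hT2 hQ1 hQ2 hR hA₀ hB₀ hA (fun n hn hn' => ?_)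
        (fun n hn => ?_)
      · simp only [hB1, if_pos hn']
        exact hB n hn (hn'.trans hRM)
      · simp [hB1, hBQ n hn]
    · rw [mul_comm A₀ B₀]
      refine h.norm_typeII_half_le hρ hM hT1 hT2 hQ1 hQ2 hR hB₀ hA₀ (fun n hn hn' => ?_)
        (fun n hn hn' => hA n hn (hn'.trans hRM)) hAQ
      simp only [hB2]
      split_ifs
      · simpa using hB₀
      · exact hB n hn hn'
  · have : m ≤ R := by
      by_contra hcon
      push Not at hcon
      have : (R + 1) * (R + 1) ≤ m * n := Nat.mul_le_mul hcon hn
      omega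
    simp [hB2, this]

/-- The constant in the Type I estimate. -/
def typeIConst (κ K : ℝ) : ℝ := 11 * (9 * K ^ 2 / κ + 3 / √κ)

/-- The inner sums of a Type I sum are uniformly small. -/
lemma IsPhase.norm_typeI_inner_le (h : IsPhase κ K T M M' Φ Φ1 Φ2) {ρ : ℝ} (hρ : 1 ≤ ρ)
    (hM : (M : ℝ) = ρ ^ 12) (hT1 : ρ ^ 10 ≤ T) (hT2 : T ≤ K * ρ ^ 12) {n a : ℕ} (hn : 0 < n)
    (ha : M / n ≤ a) :
    ‖∑ m ∈ Ioc a (M' / n), ee (Φ (n * m))‖ ≤ typeIConst κ K * ρ ^ 7 := by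
  have hκ := h.pos_κ
  have hκK := h.κ_le
  have hK : 0 < K := hκ.trans_le hκK
  have hT := h.pos_T
  have hρ0 : 0 < ρ := by linarith
  have hn1 : (1 : ℝ) ≤ n := by exact_mod_cast hn
  have key := h.norm_sum_mul_le (a := a) (b := M' / n) hn
    (by
      have := (Nat.lt_mul_div_succ M hn).le
      exact this.trans (Nat.mul_le_mul_left n (by omega)))
    (Nat.mul_div_le M' n)
  refine key.trans ?_
  have s1 : √(κ * T) ≤ K * ρ ^ 6 := by
    rw [Real.sqrt_le_left (by positivity)]
    calc κ * T ≤ K * (K * ρ ^ 12) := by gcongr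
      _ = _ := by ring
  have s2 : √κ * ρ ^ 5 ≤ √(κ * T) := by
    rw [Real.sqrt_mul hκ.le]
    gcongr
    rw [Real.le_sqrt (by positivity) hT.le]
    calc (ρ ^ 5) ^ 2 = ρ ^ 10 := by ring
      _ ≤ T := hT1
  have hs : 0 < √κ := Real.sqrt_pos.2 hκ
  unfold typeIConst
  rw [hM, mul_assoc, add_mul]
  refine mul_le_mul_of_nonneg_left (add_le_add ?_ ?_) (by norm_num)
  · calc 9 * K / κ * √(κ * T) ≤ 9 * K / κ * (K * ρ ^ 6) := by gcongr
      _ = 9 * K ^ 2 / κ * ρ ^ 6 := by ring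
      _ ≤ _ := by gcongr; norm_num
  · calc 3 * ρ ^ 12 / (n * √(κ * T)) ≤ 3 * ρ ^ 12 / (1 * (√κ * ρ ^ 5)) := by gcongr
      _ = _ := by field_simp

/-- Abel summation against a monotone weight. -/
lemma norm_sum_mul_le_of_monotone {w : ℕ → ℝ} {z : ℕ → ℂ} {q : ℕ} {E : ℝ} (hw : Monotone w)
    (hw0 : ∀ n, 0 ≤ w n) {p : ℕ} (hpq : p ≤ q)
    (hz : ∀ j, p ≤ j → ‖∑ n ∈ Ioc j q, z n‖ ≤ E) :
    ‖∑ n ∈ Ioc p q, (w n : ℂ) * z n‖ ≤ w q * E := by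
  have key : ∀ d p, p + d = q → (∀ j, p ≤ j → ‖∑ n ∈ Ioc j q, z n‖ ≤ E) →
      ‖∑ n ∈ Ioc p q, ((w n - w p : ℝ) : ℂ) * z n‖ ≤ (w q - w p) * E := by
    intro d
    induction d with
    | zero =>
      intro p hp _
      have : p = q := by omega
      subst this
      simp
    | succ d ih =>
      intro p hp hz
      have h1 := ih (p + 1) (by omega) (fun j hj => hz j (by omega))
      have hins : Ioc p q = insert (p + 1) (Ioc (p + 1) q) := by
        ext n; simp only [mem_insert, mem_Ioc]; omega
      have e : ∑ n ∈ Ioc p q, ((w n - w p : ℝ) : ℂ) * z n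
          = ∑ n ∈ Ioc (p + 1) q, ((w n - w (p + 1) : ℝ) : ℂ) * z n
            + ((w (p + 1) - w p : ℝ) : ℂ) * ∑ n ∈ Ioc p q, z n := by
        rw [hins, sum_insert (by simp), sum_insert (by simp), mul_add, mul_sum, add_left_comm,
          ← sum_add_distrib]
        congr 1
        refine sum_congr rfl fun n _ => ?_
        push_cast; ring
      rw [e]
      have hm : w p ≤ w (p + 1) := hw (Nat.le_succ p)
      refine (norm_add_le _ _).trans ?_
      rw [norm_mul, Complex.norm_real, Real.norm_of_nonneg (by linarith)]
      have h2 : (w (p + 1) - w p) * ‖∑ n ∈ Ioc p q, z n‖ ≤ (w (p + 1) - w p) * E :=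
        mul_le_mul_of_nonneg_left (hz p le_rfl) (by linarith)
      linarith
  have h1 := key (q - p) p (by omega) hz
  have e : ∑ n ∈ Ioc p q, (w n : ℂ) * z n
      = ∑ n ∈ Ioc p q, ((w n - w p : ℝ) : ℂ) * z n + (w p : ℂ) * ∑ n ∈ Ioc p q, z n := by
    rw [mul_sum, ← sum_add_distrib]
    refine sum_congr rfl fun n _ => ?_
    push_cast; ring
  rw [e]
  refine (norm_add_le _ _).trans ?_
  rw [norm_mul, Complex.norm_real, Real.norm_of_nonneg (hw0 p)]
  have h2 : w p * ‖∑ n ∈ Ioc p q, z n‖ ≤ w p * E := mul_le_mul_of_nonneg_left (hz p le_rfl) (hw0 p)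
  linarith

/-- The Type I estimate, with a monotone weight on the smooth variable. -/
lemma IsPhase.norm_typeI_le (h : IsPhase κ K T M M' Φ Φ1 Φ2) {ρ : ℝ} (hρ : 1 ≤ ρ)
    (hM : (M : ℝ) = ρ ^ 12) (hT1 : ρ ^ 10 ≤ T) (hT2 : T ≤ K * ρ ^ 12) {D : ℕ}
    (hD : D ≤ 4 * ρ ^ 4) {w A : ℕ → ℝ} {w₀ A₀ : ℝ} (hw : Monotone w) (hw0 : ∀ n, 0 ≤ w n)
    (hwM : w M' ≤ w₀) (hA₀ : 0 ≤ A₀) (hA : ∀ n, 0 < n → n ≤ M' → |A n| ≤ A₀)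
    (hAD : ∀ n, D < n → A n = 0) :
    ‖∑ l ∈ Ioc M M', ∑ x ∈ l.divisorsAntidiagonal, (w x.1 * A x.2 : ℂ) * ee (Φ l)‖
      ≤ 4 * w₀ * A₀ * typeIConst κ K * ρ ^ 11 := by
  have hκ := h.pos_κ
  have hK : 0 < K := hκ.trans_le h.κ_le
  have hρ0 : 0 < ρ := by linarith
  have hC : 0 < typeIConst κ K := by
    have : 0 < √κ := Real.sqrt_pos.2 hκ
    unfold typeIConst; positivity
  have hw₀ : 0 ≤ w₀ := (hw0 _).trans hwM
  have e : ∑ l ∈ Ioc M M', ∑ x ∈ l.divisorsAntidiagonal, (w x.1 * A x.2 : ℂ) * ee (Φ l)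
      = ∑ n ∈ Ioc 0 M', ∑ m ∈ Ioc (M / n) (M' / n), (w m * A n : ℂ) * ee (Φ (n * m)) := by
    rw [← sum_divisorsAntidiagonal_eq M M' (fun m n => (w m * A n : ℂ) * ee (Φ (n * m)))]
    refine sum_congr rfl fun l _ => sum_congr rfl fun x hx => ?_
    have : (l : ℝ) = x.2 * x.1 := by
      rw [← (Nat.mem_divisorsAntidiagonal.1 hx).1]; push_cast; ring
    rw [this]
  have hterm : ∀ n ∈ Ioc 0 M',
      ‖∑ m ∈ Ioc (M / n) (M' / n), (w m * A n : ℂ) * ee (Φ (n * m))‖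
        ≤ if n ≤ D then A₀ * (w₀ * (typeIConst κ K * ρ ^ 7)) else 0 := by
    intro n hn
    rw [mem_Ioc] at hn
    split_ifs with hnD
    · have e2 : ∑ m ∈ Ioc (M / n) (M' / n), (w m * A n : ℂ) * ee (Φ (n * m))
          = (A n : ℂ) * ∑ m ∈ Ioc (M / n) (M' / n), (w m : ℂ) * ee (Φ (n * m)) := by
        rw [mul_sum]
        refine sum_congr rfl fun m _ => ?_
        ring
      rw [e2, norm_mul, Complex.norm_real, Real.norm_eq_abs]
      refine mul_le_mul (hA n hn.1 hn.2) ?_ (norm_nonneg _) hA₀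
      rcases le_or_gt (M / n) (M' / n) with hle | hlt
      · refine (norm_sum_mul_le_of_monotone hw hw0 hle fun j hj =>
          h.norm_typeI_inner_le hρ hM hT1 hT2 hn.1 hj).trans ?_
        have : w (M' / n) ≤ w₀ := (hw (Nat.div_le_self _ _)).trans hwM
        gcongr
      · rw [Ioc_eq_empty_of_le hlt.le, sum_empty, norm_zero]; positivity
    · rw [sum_eq_zero]
      · simp
      · intro m _
        simp [hAD n (by omega)]
  rw [e]
  refine (norm_sum_le _ _).trans ((sum_le_sum hterm).trans ?_)
  rw [← sum_filter, sum_const, nsmul_eq_mul]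
  have hcard : (((Ioc 0 M').filter (fun n => n ≤ D)).card : ℝ) ≤ 4 * ρ ^ 4 := by
    refine le_trans ?_ hD
    have : ((Ioc 0 M').filter (fun n => n ≤ D)) ⊆ Ioc 0 D := fun n hn => by
      rw [mem_filter, mem_Ioc] at hn; rw [mem_Ioc]; exact ⟨hn.1.1, hn.2⟩
    have := card_le_card this
    rw [Nat.card_Ioc] at this
    exact_mod_cast this
  calc _ ≤ 4 * ρ ^ 4 * (A₀ * (w₀ * (typeIConst κ K * ρ ^ 7))) := by gcongr
    _ = _ := by ring

end

end TanPrimes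

open Finset

namespace TanPrimes

noncomputable section

/-! ### The divisor bound -/

lemma add_one_le_const_mul_rpow {ε : ℝ} (hε : 0 < ε) {p : ℕ} (hp : 2 ≤ p) (e : ℕ) :
    (e + 1 : ℝ) ≤ (1 + 1 / (ε * Real.log 2)) * ((p : ℝ) ^ e) ^ ε := by
  have hl : 0 < Real.log 2 := Real.log_pos one_lt_two
  set x := ε * Real.log 2 with hx
  have hx0 : 0 < x := by positivity
  have h1 : 1 + x * e ≤ ((2 : ℝ) ^ e) ^ ε := by
    rw [← Real.rpow_natCast, ← Real.rpow_mul (by norm_num), Real.rpow_def_of_pos (by norm_num)]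
    have := Real.add_one_le_exp (Real.log 2 * (e * ε))
    have e1 : Real.log 2 * (e * ε) = x * e := by rw [hx]; ring
    rw [e1] at this ⊢
    linarith
  have h2 : ((2 : ℝ) ^ e) ^ ε ≤ ((p : ℝ) ^ e) ^ ε := by
    have : (2 : ℝ) ≤ p := by exact_mod_cast hp
    gcongr
  calc (e + 1 : ℝ) ≤ (1 + 1 / x) * (1 + x * e) := by
        have : (1 + 1 / x) * (1 + x * e) = e + 1 + x * e + 1 / x := by field_simp; ring
        rw [this]
        have : 0 ≤ x * e + 1 / x := by positivity
        linarith
    _ ≤ _ := by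
        gcongr
        exact h1.trans h2

lemma add_one_le_rpow_of_large {ε : ℝ} (hε : 0 < ε) {p : ℕ} (hp : (2 : ℝ) ^ (1 / ε) ≤ p)
    (e : ℕ) : (e + 1 : ℝ) ≤ ((p : ℝ) ^ e) ^ ε := by
  have h1 : (2 : ℝ) ≤ (p : ℝ) ^ ε := by
    calc (2 : ℝ) = ((2 : ℝ) ^ (1 / ε)) ^ ε := by
          rw [← Real.rpow_mul (by norm_num), one_div_mul_cancel hε.ne', Real.rpow_one]
      _ ≤ _ := by gcongr
  have h2 : ((p : ℝ) ^ e) ^ ε = ((p : ℝ) ^ ε) ^ e := by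
    rw [← Real.rpow_natCast, ← Real.rpow_natCast, ← Real.rpow_mul (by positivity),
      ← Real.rpow_mul (by positivity), mul_comm]
  rw [h2]
  calc (e + 1 : ℝ) ≤ 2 ^ e := by exact_mod_cast Nat.lt_two_pow_self
    _ ≤ _ := by gcongr

/-- The number of divisors of `n` is `O(n ^ ε)`. -/
lemma exists_card_divisors_le {ε : ℝ} (hε : 0 < ε) :
    ∃ C : ℝ, 0 ≤ C ∧ ∀ n : ℕ, 0 < n → (n.divisors.card : ℝ) ≤ C * (n : ℝ) ^ ε := by
  set C₁ : ℝ := 1 + 1 / (ε * Real.log 2) with hC₁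
  have hl : 0 < Real.log 2 := Real.log_pos one_lt_two
  have hC₁1 : 1 ≤ C₁ := by
    have : 0 ≤ 1 / (ε * Real.log 2) := by positivity
    rw [hC₁]; linarith
  set P := ⌈(2 : ℝ) ^ (1 / ε)⌉₊ with hP
  refine ⟨C₁ ^ P, by positivity, fun n hn => ?_⟩
  have hn0 : n ≠ 0 := hn.ne'
  rw [Nat.card_divisors hn0]
  push_cast
  have e1 : (n : ℝ) ^ ε = ∏ p ∈ n.primeFactors, ((p : ℝ) ^ n.factorization p) ^ ε := by
    rw [Real.finsetProd_rpow _ _ (fun i _ => by positivity)]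
    congr 1
    conv_lhs => rw [← Nat.prod_factorization_pow_eq_self hn0]
    rw [Finsupp.prod, Nat.support_factorization]
    push_cast; rfl
  have h1 : ∀ p ∈ n.primeFactors, (n.factorization p + 1 : ℝ)
      ≤ (if p < P then C₁ else 1) * ((p : ℝ) ^ n.factorization p) ^ ε := by
    intro p hp
    have hp2 := (Nat.prime_of_mem_primeFactors hp).two_le
    split_ifs with h
    · exact add_one_le_const_mul_rpow hε hp2 _
    · rw [one_mul]
      exact add_one_le_rpow_of_large hε (Nat.ceil_le.1 (not_lt.1 h)) _
  calc _ ≤ ∏ p ∈ n.primeFactors,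
        ((if p < P then C₁ else 1) * ((p : ℝ) ^ n.factorization p) ^ ε) :=
        prod_le_prod (fun _ _ => by positivity) h1
    _ = (∏ p ∈ n.primeFactors, if p < P then C₁ else 1) * (n : ℝ) ^ ε := by
        rw [prod_mul_distrib, e1]
    _ ≤ C₁ ^ P * (n : ℝ) ^ ε := by
        gcongr
        rw [← prod_filter, prod_const]
        refine pow_le_pow_right₀ hC₁1 ?_
        calc _ ≤ (range P).card := card_le_card fun p hp => by
              rw [mem_filter] at hp; exact mem_range.2 hp.2
          _ = P := card_range P

/-! ### Vaughan's identity and sums over primes -/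

open ArithmeticFunction in
/-- The restriction of an arithmetic function to `[1, Q]`. -/
def truncLE (f : ArithmeticFunction ℝ) (Q : ℕ) : ArithmeticFunction ℝ :=
  ⟨fun n => if n ≤ Q then f n else 0, by simp⟩

lemma truncLE_apply (f : ArithmeticFunction ℝ) (Q n : ℕ) :
    truncLE f Q n = if n ≤ Q then f n else 0 := rfl

lemma abs_truncLE_le (f : ArithmeticFunction ℝ) (Q n : ℕ) : |truncLE f Q n| ≤ |f n| := by
  rw [truncLE_apply]; split_ifs <;> simp

lemma arithmeticFunction_sub_apply (f g : ArithmeticFunction ℝ) (n : ℕ) :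
    (f - g) n = f n - g n := by
  rw [sub_eq_add_neg, ArithmeticFunction.add_apply, ArithmeticFunction.neg_apply, sub_eq_add_neg]

lemma abs_sub_truncLE_le (f : ArithmeticFunction ℝ) (Q n : ℕ) :
    |(f - truncLE f Q) n| ≤ |f n| := by
  rw [arithmeticFunction_sub_apply, truncLE_apply]; split_ifs <;> simp

lemma sub_truncLE_of_le (f : ArithmeticFunction ℝ) {Q n : ℕ} (h : n ≤ Q) :
    (f - truncLE f Q) n = 0 := by
  rw [arithmeticFunction_sub_apply, truncLE_apply, if_pos h, sub_self]

open ArithmeticFunction ArithmeticFunction.zeta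
  ArithmeticFunction.Moebius in
/-- Vaughan's identity, with equal cut-offs. -/
lemma vaughan (Q : ℕ) :
    (Λ : ArithmeticFunction ℝ) = truncLE Λ Q + log * truncLE (μ : ArithmeticFunction ℝ) Q
      - (ζ : ArithmeticFunction ℝ) * (truncLE Λ Q * truncLE (μ : ArithmeticFunction ℝ) Q)
      + (Λ - truncLE Λ Q) *
        (((μ : ArithmeticFunction ℝ) - truncLE (μ : ArithmeticFunction ℝ) Q) * ζ) := by
  have h1 : Λ * (ζ : ArithmeticFunction ℝ) = log := vonMangoldt_mul_zeta
  have h2 : (μ : ArithmeticFunction ℝ) * ζ = 1 := coe_moebius_mul_coe_zeta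
  rw [← h1]
  linear_combination (truncLE Λ Q - Λ) * h2

lemma abs_sum_antidiagonal_le (f g : ArithmeticFunction ℝ) (n : ℕ) :
    |(f * g) n| ≤ ∑ x ∈ n.divisorsAntidiagonal, |f x.1| * |g x.2| := by
  rw [ArithmeticFunction.mul_apply]
  refine (abs_sum_le_sum_abs _ _).trans (le_of_eq ?_)
  simp_rw [abs_mul]

open ArithmeticFunction ArithmeticFunction.Moebius in
lemma abs_coe_moebius_le_one (n : ℕ) : |(μ : ArithmeticFunction ℝ) n| ≤ 1 := by
  rw [intCoe_apply]
  have := abs_moebius_le_one (n := n)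
  exact_mod_cast this

open ArithmeticFunction ArithmeticFunction.zeta
  ArithmeticFunction.Moebius in
lemma abs_truncLE_mul_truncLE_le (Q n : ℕ) :
    |(truncLE Λ Q * truncLE (μ : ArithmeticFunction ℝ) Q) n| ≤ Real.log n := by
  refine (abs_sum_antidiagonal_le _ _ n).trans ?_
  rw [← vonMangoldt_sum, ← Nat.sum_divisorsAntidiagonal (f := fun i _ => Λ i)]
  refine sum_le_sum fun x _ => ?_
  calc _ ≤ |Λ x.1| * 1 :=
        mul_le_mul (abs_truncLE_le _ _ _) ((abs_truncLE_le _ _ _).trans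
          (abs_coe_moebius_le_one _)) (abs_nonneg _) (abs_nonneg _)
    _ = Λ x.1 := by rw [mul_one, abs_of_nonneg vonMangoldt_nonneg]

open ArithmeticFunction ArithmeticFunction.zeta ArithmeticFunction.Moebius in
lemma abs_sub_truncLE_mul_zeta_le (Q n : ℕ) :
    |(((μ : ArithmeticFunction ℝ) - truncLE (μ : ArithmeticFunction ℝ) Q) *
      (ζ : ArithmeticFunction ℝ)) n| ≤ n.divisors.card := by
  refine (abs_sum_antidiagonal_le _ _ n).trans ?_
  have hc : n.divisors.card = n.divisorsAntidiagonal.card := by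
    rw [← Nat.map_div_right_divisors, card_map]
  rw [hc, card_eq_sum_ones]
  push_cast
  refine sum_le_sum fun x _ => ?_
  refine mul_le_one₀ ((abs_sub_truncLE_le _ _ _).trans (abs_coe_moebius_le_one _)) (abs_nonneg _) ?_
  rw [natCoe_apply, zeta_apply]
  split_ifs <;> simp

lemma mul_apply_eq_zero_of_le (f g : ArithmeticFunction ℝ) {Q n : ℕ} (hn : n ≤ Q)
    (hf : ∀ m ≤ Q, f m = 0) : (f * g) n = 0 := by
  rw [ArithmeticFunction.mul_apply]
  refine sum_eq_zero fun x hx => ?_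
  have hx' := Nat.mem_divisorsAntidiagonal.1 hx
  have : x.1 ≤ n := by
    rw [← hx'.1]
    exact Nat.le_mul_of_pos_right _ (Nat.pos_of_ne_zero fun h => hx'.2 (by rw [← hx'.1, h, mul_zero]))
  rw [hf _ (this.trans hn), zero_mul]

variable {κ K T : ℝ} {M M' : ℕ} {Φ Φ1 Φ2 : ℝ → ℝ}

lemma sum_coe_mul_apply (f g : ArithmeticFunction ℝ) (l : ℕ) (z : ℂ) :
    (((f * g) l : ℝ) : ℂ) * z = ∑ x ∈ l.divisorsAntidiagonal, (f x.1 * g x.2 : ℂ) * z := by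
  rw [ArithmeticFunction.mul_apply, ← sum_mul]
  push_cast
  rfl

lemma monotone_log_natCast : Monotone (fun n : ℕ => Real.log n) := by
  intro a b hab
  rcases Nat.eq_zero_or_pos a with rfl | ha
  · simpa using Real.log_natCast_nonneg b
  · exact Real.log_le_log (by exact_mod_cast ha) (by exact_mod_cast hab)

open ArithmeticFunction ArithmeticFunction.zeta
  ArithmeticFunction.Moebius in
/-- The sum of `Λ(l) e(Φ(l))` in terms of a bound `B₀` for the divisor function. The cut-off in
Vaughan's identity is `Q = ⌈ρ²⌉`. -/
lemma IsPhase.norm_vonMangoldt_sum_le (h : IsPhase κ K T M M' Φ Φ1 Φ2) {ρ : ℝ} (hρ : 1 ≤ ρ)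
    (hM : (M : ℝ) = ρ ^ 12) (hT1 : ρ ^ 10 ≤ T) (hT2 : T ≤ K * ρ ^ 12) {B₀ : ℝ}
    (hB₀ : 0 ≤ B₀) (hB : ∀ n, 0 < n → n ≤ M' → (n.divisors.card : ℝ) ≤ B₀) :
    ‖∑ l ∈ Ioc M M', (Λ l : ℂ) * ee (Φ l)‖
      ≤ (8 * typeIConst κ K * Real.log M' + 2 * Real.log M' * B₀ * √(typeIIConst κ K) *
        (1 + Real.log M')) * ρ ^ 11 := by
  have hρ0 : 0 < ρ := by linarith
  have hρ2 : 1 ≤ ρ ^ 2 := one_le_pow₀ hρ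
  set Q := ⌈ρ ^ 2⌉₊ with hQ
  have hQ1 : ρ ^ 2 ≤ Q := Nat.le_ceil _
  have hQ2 : (Q : ℝ) ≤ 2 * ρ ^ 2 := by
    have := (Nat.ceil_lt_add_one (show 0 ≤ ρ ^ 2 by positivity)).le
    linarith
  have hQM : Q ≤ M := by
    rw [hQ, Nat.ceil_le, hM]
    exact pow_le_pow_right₀ hρ (by norm_num)
  have hL : 0 ≤ Real.log M' := Real.log_natCast_nonneg M'
  have hlog : ∀ m : ℕ, 0 < m → m ≤ M' → Real.log m ≤ Real.log M' := fun m h1 h2 =>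
    Real.log_le_log (by exact_mod_cast h1) (by exact_mod_cast h2)
  have hD : ((Q * Q : ℕ) : ℝ) ≤ 4 * ρ ^ 4 := by
    push_cast
    calc (Q * Q : ℝ) ≤ (2 * ρ ^ 2) * (2 * ρ ^ 2) := by gcongr
      _ = _ := by ring
  set tΛ := truncLE Λ Q
  set tμ := truncLE (μ : ArithmeticFunction ℝ) Q
  have hdec : ∑ l ∈ Ioc M M', (Λ l : ℂ) * ee (Φ l)
      = ∑ l ∈ Ioc M M', ∑ x ∈ l.divisorsAntidiagonal, (Real.log x.1 * tμ x.2 : ℂ) * ee (Φ l)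
      - ∑ l ∈ Ioc M M', ∑ x ∈ l.divisorsAntidiagonal,
          (((fun _ => 1 : ℕ → ℝ) x.1 : ℝ) * (tΛ * tμ) x.2 : ℂ) * ee (Φ l)
      + ∑ l ∈ Ioc M M', ∑ x ∈ l.divisorsAntidiagonal,
          ((Λ - tΛ) x.1 * (((μ : ArithmeticFunction ℝ) - tμ) * ζ) x.2 : ℂ) * ee (Φ l) := by
    rw [← sum_sub_distrib, ← sum_add_distrib]
    refine sum_congr rfl fun l hl => ?_
    rw [mem_Ioc] at hl
    have hz : tΛ l = 0 := by
      simp only [tΛ, truncLE_apply]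
      rw [if_neg (by omega)]
    have hone : ∑ x ∈ l.divisorsAntidiagonal,
          (((fun _ => 1 : ℕ → ℝ) x.1 : ℝ) * (tΛ * tμ) x.2 : ℂ) * ee (Φ l)
        = ∑ x ∈ l.divisorsAntidiagonal,
          (((ζ : ArithmeticFunction ℝ) x.1 : ℝ) * (tΛ * tμ) x.2 : ℂ) * ee (Φ l) := by
      refine sum_congr rfl fun x hx => ?_
      have : x.1 ≠ 0 := fun h0 => by
        have := Nat.mem_divisorsAntidiagonal.1 hx
        exact this.2 (by rw [← this.1, h0, zero_mul])
      rw [natCoe_apply, zeta_apply, if_neg this]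
      simp
    have hlogs : ∑ x ∈ l.divisorsAntidiagonal, (Real.log x.1 * tμ x.2 : ℂ) * ee (Φ l)
        = ∑ x ∈ l.divisorsAntidiagonal, (log x.1 * tμ x.2 : ℂ) * ee (Φ l) := rfl
    rw [hone, hlogs, ← sum_coe_mul_apply, ← sum_coe_mul_apply, ← sum_coe_mul_apply]
    conv_lhs => rw [vaughan Q]
    simp only [ArithmeticFunction.add_apply, arithmeticFunction_sub_apply]
    rw [show truncLE Λ Q l = 0 from hz]
    push_cast
    ring
  rw [hdec]
  have b1 := h.norm_typeI_le hρ hM hT1 hT2 hD (w := fun n => Real.log n) (A := fun n => tμ n)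
    (w₀ := Real.log M') (A₀ := 1) monotone_log_natCast (fun n => Real.log_natCast_nonneg n) le_rfl
    zero_le_one (fun n _ _ => (abs_truncLE_le _ _ _).trans (abs_coe_moebius_le_one _))
    (fun n hn => by
      simp only [tμ, truncLE_apply]
      rw [if_neg]
      have : Q ≤ Q * Q := Nat.le_mul_self Q
      omega)
  have b2 := h.norm_typeI_le hρ hM hT1 hT2 hD (w := fun _ => 1) (A := fun n => (tΛ * tμ) n)
    (w₀ := 1) (A₀ := Real.log M') monotone_const (fun n => zero_le_one) le_rfl
    hL (fun n h1 h2 => (abs_truncLE_mul_truncLE_le Q n).trans (hlog n h1 h2))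
    (fun n hn => by
      rw [ArithmeticFunction.mul_apply]
      refine sum_eq_zero fun x hx => ?_
      have hx' := (Nat.mem_divisorsAntidiagonal.1 hx).1
      simp only [tΛ, tμ, truncLE_apply]
      by_cases h1 : x.1 ≤ Q
      · by_cases h2 : x.2 ≤ Q
        · have := Nat.mul_le_mul h1 h2
          omega
        · simp [h2]
      · simp [h1])
  have b3 := h.norm_typeII_le hρ hM hT1 hT2 hQ1 hQ2 (A := fun n => (Λ - tΛ) n)
    (B := fun n => (((μ : ArithmeticFunction ℝ) - tμ) * ζ) n) (A₀ := Real.log M') hL hB₀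
    (fun n h1 h2 => (abs_sub_truncLE_le _ _ _).trans (by
      rw [abs_of_nonneg vonMangoldt_nonneg]
      exact vonMangoldt_le_log.trans (hlog n h1 h2)))
    (fun n h1 h2 => (abs_sub_truncLE_mul_zeta_le Q n).trans (hB n h1 h2))
    (fun n hn => sub_truncLE_of_le _ hn.le)
    (fun n hn => mul_apply_eq_zero_of_le _ _ hn.le (fun m hm => sub_truncLE_of_le _ hm))
  refine (norm_add_le _ _).trans ((add_le_add ((norm_sub_le _ _).trans (add_le_add b1 b2)) b3).trans
    (le_of_eq ?_))
  ring

open ArithmeticFunction in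
/-- Exponential sums over primes: `∑ Λ(l) e(Φ(l)) ≪ M ^ (11/12 + ε)` for a phase of size between
`M ^ (5/6)` and `M`. -/
theorem exists_norm_vonMangoldt_sum_le {κ K : ℝ} (hκ : 0 < κ) (hκK : κ ≤ K) {ε : ℝ} (hε : 0 < ε)
    (hε1 : ε ≤ 1) :
    ∃ C : ℝ, 0 ≤ C ∧ ∀ {T : ℝ} {M M' : ℕ} {Φ Φ1 Φ2 : ℝ → ℝ}, IsPhase κ K T M M' Φ Φ1 Φ2 →
      (M : ℝ) ^ (5 / 6 : ℝ) ≤ T → T ≤ K * M →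
      ‖∑ l ∈ Ioc M M', (Λ l : ℂ) * ee (Φ l)‖ ≤ C * (M : ℝ) ^ (11 / 12 + ε) := by
  have hδ : 0 < ε / 3 := by positivity
  obtain ⟨C₁, hC₁, hdiv⟩ := exists_card_divisors_le hδ
  have hK : 0 < K := hκ.trans_le hκK
  have hI : 0 ≤ typeIConst κ K := by
    have : 0 < √κ := Real.sqrt_pos.2 hκ
    unfold typeIConst; positivity
  set a := 3 / ε with ha
  have ha0 : 0 < a := by positivity
  refine ⟨(8 * typeIConst κ K * a + 2 * a * C₁ * √(typeIIConst κ K) * (1 + a)) * 3, by positivity, ?_⟩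
  intro T M M' Φ Φ1 Φ2 h hT1 hT2
  have hM0 : (1 : ℝ) ≤ M := by exact_mod_cast h.pos_M
  set ρ : ℝ := (M : ℝ) ^ (1 / 12 : ℝ) with hρdef
  have hρ : 1 ≤ ρ := Real.one_le_rpow hM0 (by norm_num)
  have hpow : ∀ k : ℕ, ρ ^ k = (M : ℝ) ^ ((k : ℝ) / 12) := fun k => by
    rw [hρdef, ← Real.rpow_natCast, ← Real.rpow_mul (by positivity)]; congr 1; ring
  have hM : (M : ℝ) = ρ ^ 12 := by rw [hpow]; norm_num
  have h10 : ρ ^ 10 ≤ T := by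
    rw [hpow]; refine le_trans (le_of_eq ?_) hT1; norm_num
  have h11 : ρ ^ 11 = (M : ℝ) ^ (11 / 12 : ℝ) := by rw [hpow]; norm_num
  rcases Nat.lt_or_ge M M' with hMM | hMM
  swap
  · rw [Ioc_eq_empty_of_le hMM, sum_empty, norm_zero]; positivity
  have hM'1 : (1 : ℝ) ≤ M' := by exact_mod_cast (by omega : 1 ≤ M')
  set X : ℝ := (M' : ℝ) ^ (ε / 3) with hX
  have hX1 : 1 ≤ X := Real.one_le_rpow hM'1 hδ.le
  have hlog : Real.log M' ≤ a * X := by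
    have := Real.log_le_rpow_div (show (0 : ℝ) ≤ M' by positivity) hδ
    refine this.trans (le_of_eq ?_)
    rw [ha, hX]; field_simp
  have hL : 0 ≤ Real.log M' := Real.log_natCast_nonneg M'
  have hX3 : X ^ 3 ≤ 3 * (M : ℝ) ^ ε := by
    have h3 : (M' : ℝ) ≤ 3 * M := by exact_mod_cast h.M'_le
    calc X ^ 3 = (M' : ℝ) ^ ε := by
          rw [hX, ← Real.rpow_natCast, ← Real.rpow_mul (by positivity)]; congr 1; push_cast; ring
      _ ≤ (3 * M : ℝ) ^ ε := by gcongr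
      _ = 3 ^ ε * (M : ℝ) ^ ε := Real.mul_rpow (by norm_num) (by positivity)
      _ ≤ 3 ^ (1 : ℝ) * (M : ℝ) ^ ε := by gcongr; norm_num
      _ = _ := by rw [Real.rpow_one]
  have key := h.norm_vonMangoldt_sum_le hρ hM h10 (by rw [← hM]; exact hT2) (B₀ := C₁ * X)
    (by positivity) (fun n h1 h2 => (hdiv n h1).trans (by
      have : (n : ℝ) ≤ M' := by exact_mod_cast h2
      rw [hX]
      gcongr))
  refine key.trans ?_
  have hX13 : X ≤ X ^ 3 := le_self_pow₀ hX1 (by norm_num)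
  calc _ ≤ (8 * typeIConst κ K * (a * X) + 2 * (a * X) * (C₁ * X) * √(typeIIConst κ K) *
        (X + a * X)) * ρ ^ 11 := by gcongr
    _ = (8 * typeIConst κ K * a * X + 2 * a * C₁ * √(typeIIConst κ K) * (1 + a) * X ^ 3)
        * ρ ^ 11 := by ring
    _ ≤ (8 * typeIConst κ K * a * X ^ 3 + 2 * a * C₁ * √(typeIIConst κ K) * (1 + a) * X ^ 3)
        * ρ ^ 11 := by gcongr
    _ = (8 * typeIConst κ K * a + 2 * a * C₁ * √(typeIIConst κ K) * (1 + a)) * X ^ 3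
        * ρ ^ 11 := by ring
    _ ≤ (8 * typeIConst κ K * a + 2 * a * C₁ * √(typeIIConst κ K) * (1 + a)) *
        (3 * (M : ℝ) ^ ε) * ρ ^ 11 := by gcongr
    _ = _ := by rw [h11, Real.rpow_add (by linarith)]; ring

end

end TanPrimes

open Finset

namespace TanPrimes

noncomputable section

/-! ### Points near integers: a trigonometric minorant -/

/-- Fejér's extremal trigonometric polynomial `∑ sin (πj/n) e(jt)`. -/
def fejerSum (n : ℕ) (t : ℝ) : ℂ :=
  ∑ j ∈ range n, (Real.sin (j * (Real.pi / n)) : ℂ) * ee (j * t)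

lemma ee_nat_mul (j : ℕ) (t : ℝ) : ee (j * t) = ee t ^ j := by
  induction j with
  | zero => simp
  | succ j ih => rw [pow_succ, ← ih, ← ee_add]; congr 1; push_cast; ring

lemma ee_mul_conj (t : ℝ) : ee t * (starRingEnd ℂ) (ee t) = 1 := by
  rw [← ee_sub, sub_self, ee_zero]

lemma ee_add_conj (t : ℝ) :
    ee t + (starRingEnd ℂ) (ee t) = ((2 * Real.cos (2 * Real.pi * t) : ℝ) : ℂ) := by
  rw [Complex.add_conj, ee, Complex.exp_ofReal_mul_I_re]

/-- The Fejér sum is annihilated, up to end terms, by `z ↦ z² + 1 - 2 z cos α`, because `sin (jα)`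
satisfies the corresponding linear recurrence. -/
lemma sin_recurrence (α : ℝ) (m : ℕ) (z : ℂ) :
    (z ^ 2 + 1 - 2 * Real.cos α * z) * ∑ j ∈ range (m + 1), (Real.sin (j * α) : ℂ) * z ^ j
      = Real.sin α * z - Real.sin ((m + 1 : ℕ) * α) * z ^ (m + 1)
        + Real.sin (m * α) * z ^ (m + 2) := by
  induction m with
  | zero => simp
  | succ m ih =>
    rw [sum_range_succ, mul_add, ih]
    have h : Real.sin (m * α) + Real.sin ((m + 1 + 1 : ℕ) * α)
        = 2 * Real.cos α * Real.sin ((m + 1 : ℕ) * α) := by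
      have e1 : (m * α : ℝ) = (m + 1 : ℕ) * α - α := by push_cast; ring
      have e2 : ((m + 1 + 1 : ℕ) * α : ℝ) = (m + 1 : ℕ) * α + α := by push_cast; ring
      rw [e1, e2, Real.sin_sub, Real.sin_add]; ring
    have h' : (Real.sin (m * α) : ℂ) + Real.sin ((m + 1 + 1 : ℕ) * α)
        = 2 * Real.cos α * Real.sin ((m + 1 : ℕ) * α) := by exact_mod_cast h
    linear_combination z ^ (m + 2) * h'

/-- For `α = π/n` the end terms of `sin_recurrence` are as small as possible: multiplied by
`2 cos (2πt) - 2 cos α`, the Fejér sum is `sin α * (1 + e(nt))`. -/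
lemma fejerSum_mul (n : ℕ) (hn : 0 < n) (t : ℝ) :
    (ee t + (starRingEnd ℂ) (ee t) - 2 * Real.cos (Real.pi / n)) * fejerSum n t
      = Real.sin (Real.pi / n) * (1 + ee (n * t)) := by
  obtain ⟨m, rfl⟩ : ∃ m, n = m + 1 := ⟨n - 1, by omega⟩
  set α := Real.pi / (m + 1 : ℕ) with hα
  have hm : ((m + 1 : ℕ) : ℝ) * α = Real.pi := by
    rw [hα]; field_simp
  have h := sin_recurrence α m (ee t)
  have e1 : Real.sin (m * α) = Real.sin α := by
    have : (m * α : ℝ) = Real.pi - α := by rw [← hm]; push_cast; ring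
    rw [this, Real.sin_pi_sub]
  have e2 : fejerSum (m + 1) t = ∑ j ∈ range (m + 1), (Real.sin (j * α) : ℂ) * ee t ^ j := by
    unfold fejerSum
    exact sum_congr rfl fun j _ => by rw [ee_nat_mul]
  rw [hm, Real.sin_pi, e1, ← e2] at h
  have hz := ee_mul_conj t
  have hz0 : ee t ≠ 0 := fun h0 => by rw [h0, zero_mul] at hz; exact zero_ne_one hz
  apply mul_left_cancel₀ hz0
  rw [ee_nat_mul]
  push_cast at h ⊢
  linear_combination h + fejerSum (m + 1) t * hz

lemma sum_sin_sq (n : ℕ) (hn : 2 ≤ n) :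
    ∑ j ∈ range n, Real.sin (j * (Real.pi / n)) ^ 2 = n / 2 := by
  have hn0 : (n : ℝ) ≠ 0 := by positivity
  have hroot : ∑ j ∈ range n, ee (1 / n) ^ j = 0 := by
    have h1 : ee (1 / n) ≠ 1 := by
      intro h
      unfold ee at h
      rw [Complex.exp_eq_one_iff] at h
      obtain ⟨k, hk⟩ := h
      have hpi : (Real.pi : ℂ) ≠ 0 := by exact_mod_cast Real.pi_ne_zero
      have h2 : (1 / n : ℂ) = k := by
        have h4 : (2 * Real.pi * Complex.I : ℂ) ≠ 0 := by simp [hpi]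
        apply mul_right_cancel₀ h4
        rw [← hk]; push_cast; ring
      have h5 : (1 : ℝ) = k * n := by
        have h3 : ((1 / n : ℝ) : ℂ) = ((k : ℝ) : ℂ) := by push_cast; exact h2
        have : (1 / n : ℝ) = k := Complex.ofReal_injective h3
        rw [← this]; field_simp
      have h6 : (1 : ℤ) = k * n := by exact_mod_cast h5
      have := Int.eq_one_or_neg_one_of_mul_eq_one' h6.symm
      omega
    have h3 := mul_geom_sum (ee (1 / n)) n
    rw [← ee_nat_mul, mul_one_div_cancel hn0, show (1 : ℝ) = ((1 : ℤ) : ℝ) by norm_num,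
      ee_intCast, sub_self] at h3
    rcases mul_eq_zero.1 h3 with h4 | h4
    · exact absurd (sub_eq_zero.1 h4) (by simpa using h1)
    · simpa using h4
  have hcos : ∑ j ∈ range n, Real.cos (2 * (j * (Real.pi / n))) = 0 := by
    have h1 : ∀ j : ℕ, (ee (1 / n) ^ j).re = Real.cos (2 * (j * (Real.pi / n))) := by
      intro j
      rw [← ee_nat_mul, ee, Complex.exp_ofReal_mul_I_re]
      congr 1; ring
    rw [← sum_congr rfl fun j _ => h1 j, ← Complex.re_sum, hroot, Complex.zero_re]
  have h2 : ∀ j : ℕ, Real.sin (j * (Real.pi / n)) ^ 2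
      = 1 / 2 - Real.cos (2 * (j * (Real.pi / n))) / 2 := fun j => Real.sin_sq_eq_half_sub _
  simp_rw [h2]
  rw [sum_sub_distrib, ← sum_div, ← sum_div, hcos]
  simp

/-- The minorant: a nonnegative kernel times `2 cos (2πt) - 2 cos (2π/n)`, which is positive only
within `1/n` of an integer. -/
def minorant (n : ℕ) (t : ℝ) : ℝ :=
  ‖fejerSum n t‖ ^ 2 * (2 * Real.cos (2 * Real.pi * t) - 2 * Real.cos (2 * (Real.pi / n)))

lemma norm_fejerSum_le (n : ℕ) (t : ℝ) : ‖fejerSum n t‖ ≤ n := by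
  unfold fejerSum
  refine (norm_sum_le _ _).trans ((sum_le_sum (g := fun _ => (1 : ℝ)) fun j _ => ?_).trans ?_)
  · rw [norm_mul, norm_ee, mul_one, Complex.norm_real]
    exact Real.abs_sin_le_one _
  · simp

lemma minorant_le (n : ℕ) (hn : 0 < n) (t : ℝ) : minorant n t ≤ 4 * Real.pi ^ 2 := by
  have h1 := norm_fejerSum_le n t
  have h2 : 2 * Real.cos (2 * Real.pi * t) - 2 * Real.cos (2 * (Real.pi / n))
      ≤ (2 * (Real.pi / n)) ^ 2 := by
    have := Real.one_sub_sq_div_two_le_cos (x := 2 * (Real.pi / n))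
    have := Real.cos_le_one (2 * Real.pi * t)
    linarith
  have hn' : (0 : ℝ) < n := by exact_mod_cast hn
  calc minorant n t ≤ ‖fejerSum n t‖ ^ 2 * (2 * (Real.pi / n)) ^ 2 := by
        unfold minorant; gcongr
    _ ≤ (n : ℝ) ^ 2 * (2 * (Real.pi / n)) ^ 2 := by gcongr
    _ = _ := by field_simp; ring

lemma near_integer_of_minorant_pos {n : ℕ} (hn : 2 ≤ n) {t : ℝ} (h : 0 < minorant n t) :
    |t - round t| < 1 / n := by
  have hpi := Real.pi_pos
  have hn' : (0 : ℝ) < n := by positivity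
  have hc : Real.cos (2 * (Real.pi / n)) < Real.cos (2 * Real.pi * t) := by
    by_contra hcon
    have : minorant n t ≤ 0 := mul_nonpos_of_nonneg_of_nonpos (by positivity) (by linarith)
    linarith
  by_contra hcon
  push Not at hcon
  set x := |t - round t| with hx
  have hx2 : x ≤ 1 / 2 := abs_sub_round t
  have e : Real.cos (2 * Real.pi * t) = Real.cos (2 * Real.pi * x) := by
    have h1 : Real.cos (2 * Real.pi * t) = Real.cos (2 * Real.pi * (t - round t)) := by
      have : 2 * Real.pi * (t - round t) = 2 * Real.pi * t - (round t : ℤ) * (2 * Real.pi) := by ring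
      rw [this, Real.cos_sub_int_mul_two_pi]
    rw [h1, ← Real.cos_abs, abs_mul, abs_of_pos (by positivity : (0 : ℝ) < 2 * Real.pi)]
  rw [e] at hc
  have h3 : Real.cos (2 * Real.pi * x) ≤ Real.cos (2 * (Real.pi / n)) := by
    apply Real.cos_le_cos_of_nonneg_of_le_pi (by positivity) (by nlinarith)
    calc 2 * (Real.pi / n) = 2 * Real.pi * (1 / n) := by ring
      _ ≤ _ := by gcongr
  linarith

/-- The Fourier expansion of the minorant, from
`2 cos (2πt) - 2 cos (2α) = (2 cos (2πt) - 2 cos α) + (2 cos α - 2 cos (2α))` with `α = π/n`.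
All frequencies are at most `n` in absolute value. -/
lemma minorant_eq (n : ℕ) (hn : 0 < n) (t : ℝ) :
    (minorant n t : ℂ) = Real.sin (Real.pi / n) * ∑ j ∈ range n,
        (Real.sin (j * (Real.pi / n)) : ℂ) * (ee (((-j : ℤ) : ℝ) * t) + ee (((n - j : ℤ) : ℝ) * t))
      + (2 * Real.cos (Real.pi / n) - 2 * Real.cos (2 * (Real.pi / n)) : ℝ) *
        ∑ j ∈ range n, ∑ k ∈ range n, (Real.sin (j * (Real.pi / n)) : ℂ) *
          Real.sin (k * (Real.pi / n)) * ee (((j - k : ℤ) : ℝ) * t) := by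
  have h1 := fejerSum_mul n hn t
  rw [ee_add_conj] at h1
  set P := fejerSum n t with hP
  have hPP : ((‖P‖ ^ 2 : ℝ) : ℂ) = (starRingEnd ℂ) P * P := by
    push_cast; rw [Complex.conj_mul']
  have hconj : (starRingEnd ℂ) P
      = ∑ j ∈ range n, (Real.sin (j * (Real.pi / n)) : ℂ) * ee (-(j * t)) := by
    rw [hP, fejerSum, map_sum]
    exact sum_congr rfl fun j _ => by rw [map_mul, Complex.conj_ofReal, ee_neg]
  have e1 : (starRingEnd ℂ) P * (1 + ee (n * t)) = ∑ j ∈ range n,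
        (Real.sin (j * (Real.pi / n)) : ℂ) * (ee (((-j : ℤ) : ℝ) * t) + ee (((n - j : ℤ) : ℝ) * t)) := by
    rw [hconj, sum_mul]
    refine sum_congr rfl fun j _ => ?_
    have : ee (((n - j : ℤ) : ℝ) * t) = ee (-(j * t)) * ee (n * t) := by
      rw [← ee_add]; congr 1; push_cast; ring
    rw [this]
    push_cast
    rw [neg_mul]; ring
  have e2 : (starRingEnd ℂ) P * P = ∑ j ∈ range n, ∑ k ∈ range n,
      (Real.sin (j * (Real.pi / n)) : ℂ) * Real.sin (k * (Real.pi / n)) *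
        ee (((j - k : ℤ) : ℝ) * t) := by
    rw [mul_comm]
    conv_lhs => rw [hconj, hP, fejerSum]
    rw [sum_mul_sum]
    refine sum_congr rfl fun j _ => sum_congr rfl fun k _ => ?_
    have : ee (((j - k : ℤ) : ℝ) * t) = ee (j * t) * ee (-(k * t)) := by
      rw [← ee_add]; congr 1; push_cast; ring
    rw [this]; ring
  rw [← e1, ← e2]
  unfold minorant
  rw [← hP]
  rw [Complex.ofReal_mul, hPP]
  push_cast at h1 ⊢
  linear_combination (starRingEnd ℂ) P * h1

/-- If the weighted points `t i` have small exponential sums up to frequency `n`, then the points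
within `1/n` of an integer carry their fair share of the weight, up to a constant. -/
lemma weight_le_of_exponential_sums {ι : Type*} (s : Finset ι) (w t : ι → ℝ)
    (hw : ∀ i ∈ s, 0 ≤ w i) {n : ℕ} (hn : 3 ≤ n) {E : ℝ}
    (hE : ∀ k : ℕ, 1 ≤ k → k ≤ n → ‖∑ i ∈ s, (w i : ℂ) * ee (k * t i)‖ ≤ E) :
    (∑ i ∈ s, w i) / n ≤ 7 * ∑ i ∈ s with |t i - round (t i)| < 1 / n, w i + 7 * E := by
  classical
  have hpi := Real.pi_pos
  have hpi4 := Real.pi_lt_d2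
  have hn' : (0 : ℝ) < n := by positivity
  have hn3 : (3 : ℝ) ≤ n := by exact_mod_cast hn
  set α := Real.pi / n with hα
  have hα0 : 0 < α := by positivity
  have hα3 : α ≤ Real.pi / 3 := by rw [hα]; gcongr
  have hnα : n * α = Real.pi := by rw [hα]; field_simp
  set S : ℤ → ℂ := fun k => ∑ i ∈ s, (w i : ℂ) * ee (k * t i) with hS
  have hE0 : 0 ≤ E := (norm_nonneg _).trans (hE 1 le_rfl (by omega))
  have hSpos : ∀ k : ℤ, 1 ≤ k → k ≤ n → ‖S k‖ ≤ E := by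
    intro k h1 h2
    obtain ⟨m, rfl⟩ := Int.eq_ofNat_of_zero_le (by omega : 0 ≤ k)
    have := hE m (by omega) (by omega)
    simpa [hS] using this
  have hSneg : ∀ k : ℤ, ‖S (-k)‖ = ‖S k‖ := by
    intro k
    rw [← RCLike.norm_conj (S k)]
    congr 1
    simp only [hS, map_sum]
    refine sum_congr rfl fun i _ => ?_
    rw [map_mul, Complex.conj_ofReal, ← ee_neg]
    congr 2; push_cast; ring
  have hSabs : ∀ k : ℤ, k ≠ 0 → k ≤ n → -k ≤ n → ‖S k‖ ≤ E := by
    intro k h0 h1 h2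
    rcases lt_or_gt_of_ne h0 with h | h
    · rw [← hSneg]; exact hSpos _ (by omega) h2
    · exact hSpos k (by omega) h1
  set W := ∑ i ∈ s, w i with hW
  have hS0 : S 0 = W := by simp [hS, hW]
  set b : ℕ → ℝ := fun j => Real.sin (j * α) with hb
  have hb1 : ∀ j, |b j| ≤ 1 := fun j => Real.abs_sin_le_one _
  set c2 := 2 * Real.cos α - 2 * Real.cos (2 * α) with hc2
  have hc2l : 12 / (n : ℝ) ^ 2 ≤ c2 := by
    have e : c2 = 4 * Real.sin (3 * α / 2) * Real.sin (α / 2) := by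
      have := Real.cos_sub_cos α (2 * α)
      rw [show (α + 2 * α) / 2 = 3 * α / 2 by ring, show (α - 2 * α) / 2 = -(α / 2) by ring,
        Real.sin_neg] at this
      rw [hc2]; linarith
    have h1 := Real.mul_le_sin (x := 3 * α / 2) (by positivity) (by linarith)
    have h2 := Real.mul_le_sin (x := α / 2) (by positivity) (by linarith)
    have h1' : 0 ≤ Real.sin (3 * α / 2) := le_trans (by positivity) h1
    rw [e]
    calc 12 / (n : ℝ) ^ 2 = 4 * (2 / Real.pi * (3 * α / 2)) * (2 / Real.pi * (α / 2)) := by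
          rw [hα]; field_simp; ring
      _ ≤ _ := by gcongr
  have hc20 : 0 < c2 := lt_of_lt_of_le (by positivity) hc2l
  have hc2u : c2 ≤ 30 / (n : ℝ) ^ 2 := by
    have h1 : c2 = 2 * (1 - Real.cos α) * (2 * Real.cos α + 1) := by
      rw [hc2, Real.cos_two_mul]; ring
    have h2 := Real.one_sub_sq_div_two_le_cos (x := α)
    have h3 := Real.cos_le_one α
    have h4 : 0 ≤ Real.cos α :=
      Real.cos_nonneg_of_neg_pi_div_two_le_of_le (by linarith) (by linarith)
    calc c2 ≤ 2 * (α ^ 2 / 2) * (2 * 1 + 1) := by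
          rw [h1]
          gcongr
          linarith
      _ = 3 * Real.pi ^ 2 / (n : ℝ) ^ 2 := by rw [hα]; field_simp; ring
      _ ≤ _ := by gcongr; nlinarith
  have hsin0 : 0 ≤ Real.sin α := Real.sin_nonneg_of_nonneg_of_le_pi hα0.le (by linarith)
  have hsin : Real.sin α ≤ α := Real.sin_le hα0.le
  have htot : ((∑ i ∈ s, w i * minorant n (t i) : ℝ) : ℂ)
      = Real.sin α * ∑ j ∈ range n, (b j : ℂ) * (S (-j) + S (n - j))
        + c2 * ∑ j ∈ range n, ∑ k ∈ range n, (b j : ℂ) * b k * S (j - k) := by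
    rw [Complex.ofReal_sum, sum_congr rfl fun i _ => by
      rw [Complex.ofReal_mul, minorant_eq n (by omega), mul_add], sum_add_distrib]
    congr 1
    · have hA : ∀ j : ℕ, S (-j) + S (n - j) = ∑ i ∈ s, (w i : ℂ) *
          (ee (((-j : ℤ) : ℝ) * t i) + ee (((n - j : ℤ) : ℝ) * t i)) := by
        intro j
        simp only [hS]
        rw [← sum_add_distrib]
        exact sum_congr rfl fun i _ => by ring
      simp only [hA, mul_sum]
      rw [sum_comm]
      refine sum_congr rfl fun j _ => sum_congr rfl fun i _ => ?_
      simp only [hb, ← hα]; ring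
    · simp only [hS, mul_sum]
      rw [sum_comm]
      refine sum_congr rfl fun j _ => ?_
      rw [sum_comm]
      refine sum_congr rfl fun k _ => sum_congr rfl fun i _ => ?_
      simp only [hb, ← hα, hc2]; ring
  -- The zero frequencies give the main term `n W / 2`.
  have hdiag : ∑ j ∈ range n, ∑ k ∈ range n, (b j : ℂ) * b k * S (j - k)
      = ((n / 2 * W : ℝ) : ℂ)
        + ∑ j ∈ range n, ∑ k ∈ range n, if j = k then 0 else (b j : ℂ) * b k * S (j - k) := by
    have h1 : ∑ j ∈ range n, ∑ k ∈ range n, (b j : ℂ) * b k * S (j - k)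
        = ∑ j ∈ range n, ∑ k ∈ range n, ((if j = k then (b j : ℂ) ^ 2 * W else 0)
          + if j = k then 0 else (b j : ℂ) * b k * S (j - k)) := by
      refine sum_congr rfl fun j _ => sum_congr rfl fun k _ => ?_
      split_ifs with h
      · subst h; rw [sub_self, hS0]; ring
      · ring
    rw [h1]
    simp_rw [sum_add_distrib]
    congr 1
    rw [sum_congr rfl fun j hj => by rw [sum_ite_eq, if_pos hj], ← sum_mul,
      ← sum_sin_sq n (by omega)]
    simp only [hb, ← hα]
    push_cast
    rfl
  have hoff : ‖∑ j ∈ range n, ∑ k ∈ range n,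
      if j = k then (0 : ℂ) else (b j : ℂ) * b k * S (j - k)‖ ≤ n ^ 2 * E := by
    refine (norm_sum_le _ _).trans ((sum_le_sum (g := fun _ => n * E) fun j hj => ?_).trans ?_)
    · refine (norm_sum_le _ _).trans ((sum_le_sum (g := fun _ => E) fun k hk => ?_).trans ?_)
      · rw [mem_range] at hj hk
        split_ifs with h
        · simpa using hE0
        · rw [norm_mul, norm_mul, Complex.norm_real, Complex.norm_real, Real.norm_eq_abs,
            Real.norm_eq_abs]
          have h1 : |b j| * |b k| ≤ 1 := mul_le_one₀ (hb1 j) (abs_nonneg _) (hb1 k)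
          have h2 := hSabs (j - k) (by omega) (by omega) (by omega)
          calc _ ≤ 1 * E := mul_le_mul h1 h2 (norm_nonneg _) zero_le_one
            _ = E := one_mul E
      · simp
    · simp only [sum_const, card_range, nsmul_eq_mul]
      exact le_of_eq (by ring)
  have hedge : ‖∑ j ∈ range n, (b j : ℂ) * (S (-j) + S (n - j))‖ ≤ n * (2 * E) := by
    refine (norm_sum_le _ _).trans ((sum_le_sum (g := fun _ => 2 * E) fun j hj => ?_).trans ?_)
    · rw [mem_range] at hj
      rcases Nat.eq_zero_or_pos j with rfl | hj0
      · simp [hb]; positivity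
      · rw [norm_mul, Complex.norm_real, Real.norm_eq_abs]
        have h1 := hSabs (-j) (by omega) (by omega) (by omega)
        have h2 := hSabs (n - j) (by omega) (by omega) (by omega)
        calc _ ≤ 1 * (E + E) := mul_le_mul (hb1 j) ((norm_add_le _ _).trans (add_le_add h1 h2))
              (norm_nonneg _) zero_le_one
          _ = 2 * E := by ring
    · simp
  have hlow : c2 * (n / 2 * W) - (Real.sin α * (n * (2 * E)) + c2 * (n ^ 2 * E))
      ≤ ∑ i ∈ s, w i * minorant n (t i) := by
    set A := ∑ i ∈ s, w i * minorant n (t i) with hA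
    have h1 : ((A - c2 * (n / 2 * W) : ℝ) : ℂ)
        = Real.sin α * ∑ j ∈ range n, (b j : ℂ) * (S (-j) + S (n - j))
        + c2 * ∑ j ∈ range n, ∑ k ∈ range n,
          if j = k then 0 else (b j : ℂ) * b k * S (j - k) := by
      rw [Complex.ofReal_sub, htot, hdiag]; push_cast; ring
    have h2 : |A - c2 * (n / 2 * W)| ≤ Real.sin α * (n * (2 * E)) + c2 * (n ^ 2 * E) := by
      rw [← Real.norm_eq_abs, ← Complex.norm_real, h1]
      refine (norm_add_le _ _).trans ?_
      rw [norm_mul, norm_mul, Complex.norm_real, Complex.norm_real, Real.norm_of_nonneg hsin0,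
        Real.norm_of_nonneg hc20.le]
      gcongr
    linarith [(abs_le.1 h2).1]
  have hupp : ∑ i ∈ s, w i * minorant n (t i)
      ≤ 4 * Real.pi ^ 2 * ∑ i ∈ s with |t i - round (t i)| < 1 / n, w i := by
    rw [sum_filter, mul_sum]
    refine sum_le_sum fun i hi => ?_
    split_ifs with h
    · rw [mul_comm]
      exact mul_le_mul_of_nonneg_right (minorant_le n (by omega) _) (hw i hi)
    · rw [mul_zero]
      refine mul_nonpos_of_nonneg_of_nonpos (hw i hi) ?_
      by_contra hcon
      exact h (near_integer_of_minorant_pos (by omega) (not_le.1 hcon))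
  set G := ∑ i ∈ s with |t i - round (t i)| < 1 / n, w i with hG
  have hG0 : 0 ≤ G := sum_nonneg fun i hi => hw i (mem_filter.1 hi).1
  have hW0 : 0 ≤ W := sum_nonneg hw
  have f1 : 6 * (W / n) ≤ c2 * (n / 2 * W) := by
    calc 6 * (W / n) = 12 / (n : ℝ) ^ 2 * (n / 2 * W) := by field_simp; ring
      _ ≤ _ := by gcongr
  have f2 : Real.sin α * (n * (2 * E)) ≤ 8 * E := by
    calc _ ≤ α * (n * (2 * E)) := by gcongr
      _ = 2 * (n * α) * E := by ring
      _ ≤ _ := by rw [hnα]; gcongr; linarith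
  have f3 : c2 * (n ^ 2 * E) ≤ 30 * E := by
    calc _ ≤ 30 / (n : ℝ) ^ 2 * (n ^ 2 * E) := by gcongr
      _ = _ := by field_simp
  have f4 : 4 * Real.pi ^ 2 * G ≤ 40 * G := by gcongr; nlinarith
  linarith

end

end TanPrimes

namespace TanPrimes

noncomputable section

/-! ### The inverse function of `x ^ c * tan (log x) ^ θ` -/

/-- The function `c u + θ log (tan u)` in the coordinate `s = log (tan u)`. -/
def logTerm (c θ s : ℝ) : ℝ := c * Real.arctan (Real.exp s) + θ * s

/-- `sin (2u) / 2` in the coordinate `s = log (tan u)`. -/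
def halfSin (s : ℝ) : ℝ := Real.exp s / (1 + Real.exp s ^ 2)

/-- `cos (2u)` in the coordinate `s = log (tan u)`. -/
def cosDouble (s : ℝ) : ℝ := (1 - Real.exp s ^ 2) / (1 + Real.exp s ^ 2)

/-- The derivative of `logTerm`. -/
def logTermDeriv (c θ s : ℝ) : ℝ := c * halfSin s + θ

/-- `e ^ u` in the coordinate `s = log (tan u)`. -/
def expAngle (s : ℝ) : ℝ := Real.exp (Real.arctan (Real.exp s))

/-- The logarithmic derivative of `e ^ u` with respect to `logTerm`. -/
def slope (c θ s : ℝ) : ℝ := halfSin s / logTermDeriv c θ s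

/-- The derivative of `slope` with respect to `logTerm`. -/
def slopeDeriv (c θ s : ℝ) : ℝ := θ * halfSin s * cosDouble s / logTermDeriv c θ s ^ 3

/-- The factor `q` for which `z² F''(z) = F(z) q`, where `F` is `e ^ u` as a function
of `z = exp logTerm`. -/
def curvature (c θ s : ℝ) : ℝ := slope c θ s ^ 2 - slope c θ s + slopeDeriv c θ s

/-- The derivative of `slopeDeriv` in the coordinate `s`. -/
def slopeDeriv' (c θ s : ℝ) : ℝ :=
  θ * halfSin s * ((cosDouble s ^ 2 - 4 * halfSin s ^ 2) * logTermDeriv c θ s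
    - 3 * c * halfSin s * cosDouble s ^ 2) / logTermDeriv c θ s ^ 4

/-- The factor `E` for which `z² F''(z)` has derivative `F(z) E / z`. -/
def curvatureSlope (c θ s : ℝ) : ℝ :=
  slope c θ s * curvature c θ s + (2 * slope c θ s * slopeDeriv c θ s - slopeDeriv c θ s
    + slopeDeriv' c θ s / logTermDeriv c θ s)

lemma halfSin_pos (s : ℝ) : 0 < halfSin s := by unfold halfSin; positivity

lemma logTermDeriv_pos {c θ : ℝ} (hc : 1 < c) (hθ : 1 < θ) (s : ℝ) : 0 < logTermDeriv c θ s := by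
  have := halfSin_pos s
  unfold logTermDeriv; positivity

lemma hasDerivAt_halfSin (s : ℝ) : HasDerivAt halfSin (halfSin s * cosDouble s) s := by
  have h := (Real.hasDerivAt_exp s).div (((Real.hasDerivAt_exp s).pow 2).const_add 1)
    (show 1 + Real.exp s ^ 2 ≠ 0 by positivity)
  refine h.congr_deriv ?_
  unfold halfSin cosDouble
  simp only [Pi.pow_apply]
  field_simp
  push_cast
  ring

lemma hasDerivAt_cosDouble (s : ℝ) : HasDerivAt cosDouble (-4 * halfSin s ^ 2) s := by
  have h := (((Real.hasDerivAt_exp s).pow 2).const_sub 1).div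
    (((Real.hasDerivAt_exp s).pow 2).const_add 1) (show 1 + Real.exp s ^ 2 ≠ 0 by positivity)
  refine h.congr_deriv ?_
  unfold halfSin
  simp only [Pi.pow_apply]
  field_simp
  push_cast
  ring

lemma hasDerivAt_arctan_exp (s : ℝ) :
    HasDerivAt (fun s => Real.arctan (Real.exp s)) (halfSin s) s := by
  refine ((Real.hasDerivAt_exp s).arctan).congr_deriv ?_
  unfold halfSin; ring

lemma hasDerivAt_logTerm (c θ s : ℝ) : HasDerivAt (logTerm c θ) (logTermDeriv c θ s) s := by
  refine (((hasDerivAt_arctan_exp s).const_mul c).add ((hasDerivAt_id s).const_mul θ)).congr_deriv ?_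
  unfold logTermDeriv; ring

lemma hasDerivAt_logTermDeriv (c θ s : ℝ) :
    HasDerivAt (logTermDeriv c θ) (c * (halfSin s * cosDouble s)) s :=
  ((hasDerivAt_halfSin s).const_mul c).add_const θ

lemma hasDerivAt_expAngle (s : ℝ) : HasDerivAt expAngle (expAngle s * halfSin s) s :=
  (hasDerivAt_arctan_exp s).exp

lemma hasDerivAt_slope {c θ : ℝ} (hc : 1 < c) (hθ : 1 < θ) (s : ℝ) :
    HasDerivAt (slope c θ) (logTermDeriv c θ s * slopeDeriv c θ s) s := by
  have hW := logTermDeriv_pos hc hθ s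
  refine ((hasDerivAt_halfSin s).div (hasDerivAt_logTermDeriv c θ s) hW.ne').congr_deriv ?_
  have e : θ = logTermDeriv c θ s - c * halfSin s := by unfold logTermDeriv; ring
  unfold slopeDeriv
  nth_rw 4 [e]
  field_simp

lemma hasDerivAt_slopeDeriv {c θ : ℝ} (hc : 1 < c) (hθ : 1 < θ) (s : ℝ) :
    HasDerivAt (slopeDeriv c θ) (slopeDeriv' c θ s) s := by
  have hW := logTermDeriv_pos hc hθ s
  refine ((((hasDerivAt_halfSin s).const_mul θ).mul (hasDerivAt_cosDouble s)).div
    ((hasDerivAt_logTermDeriv c θ s).pow 3)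
    (show logTermDeriv c θ s ^ 3 ≠ 0 by positivity)).congr_deriv ?_
  unfold slopeDeriv'
  simp only [Pi.pow_apply, Pi.mul_apply]
  field_simp
  push_cast
  ring

lemma hasDerivAt_curvature {c θ : ℝ} (hc : 1 < c) (hθ : 1 < θ) (s : ℝ) :
    HasDerivAt (curvature c θ) (logTermDeriv c θ s * (2 * slope c θ s * slopeDeriv c θ s
      - slopeDeriv c θ s + slopeDeriv' c θ s / logTermDeriv c θ s)) s := by
  have hW := logTermDeriv_pos hc hθ s
  refine ((((hasDerivAt_slope hc hθ s).pow 2).sub (hasDerivAt_slope hc hθ s)).add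
    (hasDerivAt_slopeDeriv hc hθ s)).congr_deriv ?_
  field_simp
  push_cast
  ring

lemma slope_pos {c θ : ℝ} (hc : 1 < c) (hθ : 1 < θ) (s : ℝ) : 0 < slope c θ s :=
  div_pos (halfSin_pos s) (logTermDeriv_pos hc hθ s)

lemma slope_lt_one {c θ : ℝ} (hc : 1 < c) (hθ : 1 < θ) (s : ℝ) : slope c θ s < 1 := by
  have hW := logTermDeriv_pos hc hθ s
  have hr := halfSin_pos s
  unfold slope
  rw [div_lt_one hW]
  unfold logTermDeriv
  nlinarith

lemma cosDouble_nonpos {s : ℝ} (hs : 0 ≤ s) : cosDouble s ≤ 0 := by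
  have : 1 ≤ Real.exp s := Real.one_le_exp hs
  exact div_nonpos_of_nonpos_of_nonneg (by nlinarith) (by positivity)

/-- On the range `tan u ≥ 1` the inverse function is concave. -/
lemma curvature_neg {c θ : ℝ} (hc : 1 < c) (hθ : 1 < θ) {s : ℝ} (hs : 0 ≤ s) :
    curvature c θ s < 0 := by
  have hW := logTermDeriv_pos hc hθ s
  have hr := halfSin_pos s
  have h1 := slope_pos hc hθ s
  have h2 := slope_lt_one hc hθ s
  have h3 : slopeDeriv c θ s ≤ 0 :=
    div_nonpos_of_nonpos_of_nonneg
      (mul_nonpos_of_nonneg_of_nonpos (by positivity) (cosDouble_nonpos hs)) (by positivity)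
  unfold curvature
  nlinarith

/-- If `t = tan u ≥ 1` satisfies `t² ≤ t + 1`, then `|cos 2u| ≤ sin 2u / 2`, and `z² F''(z)` is
decreasing. For large `θ` this fails once `t² > t + 1`. -/
lemma curvatureSlope_neg {c θ : ℝ} (hc : 1 < c) (hθ : 1 < θ) {s : ℝ} (hs : 0 ≤ s)
    (ht : Real.exp s ^ 2 ≤ Real.exp s + 1) : curvatureSlope c θ s < 0 := by
  have hW := logTermDeriv_pos hc hθ s
  have hr := halfSin_pos s
  have hv := cosDouble_nonpos hs
  have hx : -cosDouble s ≤ halfSin s := by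
    unfold cosDouble halfSin
    rw [← neg_div]
    gcongr
    linarith
  have hWr : halfSin s + θ ≤ logTermDeriv c θ s := by unfold logTermDeriv; nlinarith
  have e : curvatureSlope c θ s = halfSin s / logTermDeriv c θ s ^ 5 *
      (halfSin s * logTermDeriv c θ s ^ 2 * (halfSin s - logTermDeriv c θ s)
        + 3 * halfSin s * θ * cosDouble s * logTermDeriv c θ s
        - θ * cosDouble s * logTermDeriv c θ s ^ 2
        + θ * (cosDouble s ^ 2 - 4 * halfSin s ^ 2) * logTermDeriv c θ s
        - 3 * c * θ * halfSin s * cosDouble s ^ 2) := by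
    unfold curvatureSlope curvature slopeDeriv' slopeDeriv slope
    field_simp
    ring
  rw [e]
  set r := halfSin s
  set v := cosDouble s
  set W := logTermDeriv c θ s
  have hθ0 : 0 < θ := by linarith
  have hc0 : 0 < c := by linarith
  apply mul_neg_of_pos_of_neg (by positivity)
  -- `-θ v W²` is the only positive term; as `-v ≤ r`, it is outweighed by `r W² (r - W)`.
  have t1 : r * W ^ 2 * (r - W) ≤ r * W ^ 2 * (-θ) := by gcongr; linarith
  have t2 : θ * W ^ 2 * (-v) ≤ θ * W ^ 2 * r := by gcongr
  have t3 : 3 * r * θ * W * v ≤ 0 := mul_nonpos_of_nonneg_of_nonpos (by positivity) hv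
  have t4 : θ * W * (v ^ 2 - 4 * r ^ 2) < 0 :=
    mul_neg_of_pos_of_neg (by positivity) (by nlinarith)
  have t5 : 0 ≤ 3 * c * θ * r * v ^ 2 := by positivity
  nlinarith

lemma continuous_of_hasDerivAt {f f' : ℝ → ℝ} (h : ∀ x, HasDerivAt f (f' x) x) : Continuous f :=
  continuous_iff_continuousAt.2 fun x => (h x).continuousAt

lemma continuous_expAngle : Continuous expAngle := continuous_of_hasDerivAt hasDerivAt_expAngle

lemma continuous_curvature {c θ : ℝ} (hc : 1 < c) (hθ : 1 < θ) : Continuous (curvature c θ) :=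
  continuous_of_hasDerivAt (hasDerivAt_curvature hc hθ)

lemma continuous_slope {c θ : ℝ} (hc : 1 < c) (hθ : 1 < θ) : Continuous (slope c θ) :=
  continuous_of_hasDerivAt (hasDerivAt_slope hc hθ)

lemma continuous_curvatureSlope {c θ : ℝ} (hc : 1 < c) (hθ : 1 < θ) :
    Continuous (curvatureSlope c θ) := by
  have h1 := continuous_slope hc hθ
  have h2 := continuous_curvature hc hθ
  have h3 := continuous_of_hasDerivAt (hasDerivAt_slopeDeriv hc hθ)
  have h4 := continuous_of_hasDerivAt hasDerivAt_halfSin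
  have h5 := continuous_of_hasDerivAt hasDerivAt_cosDouble
  have h6 := continuous_of_hasDerivAt (hasDerivAt_logTermDeriv c θ)
  have h7 : Continuous (slopeDeriv' c θ) := by
    unfold slopeDeriv'
    refine Continuous.div (by fun_prop) (by fun_prop) fun s => ?_
    have := logTermDeriv_pos hc hθ s
    positivity
  unfold curvatureSlope
  have h8 : Continuous fun s => slopeDeriv' c θ s / logTermDeriv c θ s :=
    h7.div h6 fun s => (logTermDeriv_pos hc hθ s).ne'
  fun_prop

lemma exists_bounds_of_pos {g : ℝ → ℝ} (hg : Continuous g) {a b : ℝ} (hab : a ≤ b)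
    (hpos : ∀ s, a ≤ s → s ≤ b → 0 < g s) :
    ∃ κ K : ℝ, 0 < κ ∧ ∀ s, a ≤ s → s ≤ b → κ ≤ g s ∧ g s ≤ K := by
  have hne : (Set.Icc a b).Nonempty := Set.nonempty_Icc.2 hab
  obtain ⟨x, hx, hmin⟩ := isCompact_Icc.exists_isMinOn hne hg.continuousOn
  obtain ⟨y, hy, hmax⟩ := isCompact_Icc.exists_isMaxOn hne hg.continuousOn
  exact ⟨g x, g y, hpos x hx.1 hx.2, fun s h1 h2 => ⟨hmin ⟨h1, h2⟩, hmax ⟨h1, h2⟩⟩⟩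

/-- The inverse of `logTerm`. -/
lemma exists_inverse_logTerm {c θ : ℝ} (hc : 1 < c) (hθ : 1 < θ) :
    ∃ σ : ℝ → ℝ, (∀ x, logTerm c θ (σ x) = x) ∧ (∀ s, σ (logTerm c θ s) = s) ∧ StrictMono σ ∧
      ∀ x, HasDerivAt σ (logTermDeriv c θ (σ x))⁻¹ x := by
  have hcont : Continuous (logTerm c θ) := continuous_of_hasDerivAt (hasDerivAt_logTerm c θ)
  have hmono : StrictMono (logTerm c θ) := strictMono_of_hasDerivAt_pos
    (hasDerivAt_logTerm c θ) (logTermDeriv_pos hc hθ)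
  have hθ0 : 0 < θ := by linarith
  have hc0 : 0 < c := by linarith
  have htop : Filter.Tendsto (logTerm c θ) Filter.atTop Filter.atTop := by
    refine Filter.tendsto_atTop_mono (f := fun s => θ * s) (fun s => ?_)
      (Filter.tendsto_id.const_mul_atTop hθ0)
    have : 0 ≤ Real.arctan (Real.exp s) := Real.arctan_nonneg.2 (Real.exp_pos s).le
    unfold logTerm
    have : 0 ≤ c * Real.arctan (Real.exp s) := by positivity
    linarith
  have hbot : Filter.Tendsto (logTerm c θ) Filter.atBot Filter.atBot := by
    refine Filter.tendsto_atBot_mono (f := fun s => c * (Real.pi / 2) + θ * s) (fun s => ?_)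
      (Filter.tendsto_atBot_add_const_left _ _ (Filter.tendsto_id.const_mul_atBot hθ0))
    have := Real.arctan_lt_pi_div_two (Real.exp s)
    unfold logTerm
    gcongr
  have hsurj : Function.Surjective (logTerm c θ) := hcont.surjective htop hbot
  set e := hmono.orderIsoOfSurjective _ hsurj with he
  have hright : ∀ x, logTerm c θ (e.symm x) = x := fun x =>
    StrictMono.orderIsoOfSurjective_self_symm_apply _ _ _ x
  refine ⟨e.symm, hright, fun s => StrictMono.orderIsoOfSurjective_symm_apply_self _ _ _ s,
    e.symm.strictMono, fun x => ?_⟩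
  exact HasDerivAt.of_local_left_inverse e.symm.continuous.continuousAt (hasDerivAt_logTerm c θ _)
    (logTermDeriv_pos hc hθ _).ne' (Filter.Eventually.of_forall hright)

end

end TanPrimes

namespace TanPrimes

noncomputable section

/-- The inverse of `x ↦ x ^ c * tan (log x) ^ θ` near `Δ`, where `N = Δ ^ c` and `σ` is the
inverse of `logTerm c θ`. -/
def invTerm (σ : ℝ → ℝ) (Δ N y : ℝ) : ℝ := Δ * expAngle (σ (Real.log y - Real.log N))

/-- The first derivative of `invTerm`. -/
def invTerm1 (c θ : ℝ) (σ : ℝ → ℝ) (Δ N y : ℝ) : ℝ :=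
  Δ * (expAngle (σ (Real.log y - Real.log N)) * slope c θ (σ (Real.log y - Real.log N))) / y

/-- The second derivative of `invTerm`. -/
def invTerm2 (c θ : ℝ) (σ : ℝ → ℝ) (Δ N y : ℝ) : ℝ :=
  Δ * (expAngle (σ (Real.log y - Real.log N)) * curvature c θ (σ (Real.log y - Real.log N))) / y ^ 2

section Derivatives

variable {c θ : ℝ} {σ : ℝ → ℝ} {Δ N y : ℝ}

lemma hasDerivAt_angle (hσ : ∀ x, HasDerivAt σ (logTermDeriv c θ (σ x))⁻¹ x) (hy : 0 < y) :
    HasDerivAt (fun y => σ (Real.log y - Real.log N))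
      ((logTermDeriv c θ (σ (Real.log y - Real.log N)))⁻¹ * y⁻¹) y :=
  (hσ _).comp y ((Real.hasDerivAt_log hy.ne').sub_const _)

lemma hasDerivAt_invTerm (hσ : ∀ x, HasDerivAt σ (logTermDeriv c θ (σ x))⁻¹ x) (hy : 0 < y) :
    HasDerivAt (invTerm σ Δ N) (invTerm1 c θ σ Δ N y) y := by
  refine (((hasDerivAt_expAngle _).comp y (hasDerivAt_angle hσ hy)).const_mul Δ).congr_deriv ?_
  unfold invTerm1 slope
  rw [div_eq_mul_inv, div_eq_mul_inv]
  ring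

lemma hasDerivAt_invTerm1 (hc : 1 < c) (hθ : 1 < θ)
    (hσ : ∀ x, HasDerivAt σ (logTermDeriv c θ (σ x))⁻¹ x) (hy : 0 < y) :
    HasDerivAt (invTerm1 c θ σ Δ N) (invTerm2 c θ σ Δ N y) y := by
  have hs := hasDerivAt_angle (N := N) hσ hy
  have h := ((((hasDerivAt_expAngle _).comp y hs).mul
    ((hasDerivAt_slope hc hθ _).comp y hs)).const_mul Δ).div (hasDerivAt_id y) hy.ne'
  refine h.congr_deriv ?_
  have hW := logTermDeriv_pos hc hθ (σ (Real.log y - Real.log N))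
  simp only [Function.comp_apply, Pi.mul_apply, id]
  unfold invTerm2 curvature
  set s := σ (Real.log y - Real.log N)
  have e : halfSin s = slope c θ s * logTermDeriv c θ s := by
    unfold slope; field_simp
  rw [e]
  field_simp
  ring

lemma hasDerivAt_curvatureTerm (hc : 1 < c) (hθ : 1 < θ)
    (hσ : ∀ x, HasDerivAt σ (logTermDeriv c θ (σ x))⁻¹ x) (hy : 0 < y) :
    HasDerivAt (fun y => Δ * (expAngle (σ (Real.log y - Real.log N)) *
        curvature c θ (σ (Real.log y - Real.log N))))
      (Δ * (expAngle (σ (Real.log y - Real.log N)) *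
        curvatureSlope c θ (σ (Real.log y - Real.log N))) / y) y := by
  have hs := hasDerivAt_angle (N := N) hσ hy
  have h := (((hasDerivAt_expAngle _).comp y hs).mul
    ((hasDerivAt_curvature hc hθ _).comp y hs)).const_mul Δ
  refine h.congr_deriv ?_
  have hW := logTermDeriv_pos hc hθ (σ (Real.log y - Real.log N))
  simp only [Function.comp_apply]
  unfold curvatureSlope
  set s := σ (Real.log y - Real.log N)
  have e : halfSin s = slope c θ s * logTermDeriv c θ s := by
    unfold slope; field_simp
  rw [e]
  field_simp

end Derivatives

/-- The upper end of the range of `s = log (tan u)`. Here `tan u = 1.61` is below the golden ratio,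
as needed for `curvatureSlope_neg`, and yet large enough for `log_ratio_le_logTerm`. -/
def sMax : ℝ := Real.log (161 / 100)

lemma exp_sMax : Real.exp sMax = 161 / 100 := Real.exp_log (by norm_num)

lemma sMax_pos : 0 < sMax := Real.log_pos (by norm_num)

lemma logTerm_zero (c θ : ℝ) : logTerm c θ 0 = c * (Real.pi / 4) := by
  unfold logTerm; rw [Real.exp_zero, Real.arctan_one]; ring

lemma arctan_sub_ge : Real.pi / 4 + 0.2225 ≤ Real.arctan (161 / 100) := by
  have hpi := Real.pi_gt_three
  set y : ℝ := 0.2225 with hy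
  have hs : Real.sin y ≤ y := Real.sin_le (by norm_num [hy])
  have hc : 1 - y ^ 2 / 2 ≤ Real.cos y := Real.one_sub_sq_div_two_le_cos
  have hc0 : 0 < Real.cos y := lt_of_lt_of_le (by norm_num [hy]) hc
  have ht : Real.tan y ≤ 61 / 261 := by
    rw [Real.tan_eq_sin_div_cos, div_le_iff₀ hc0]
    norm_num [hy] at hs hc ⊢
    linarith
  have h0 : 0 < Real.cos (Real.pi / 4 + y) :=
    Real.cos_pos_of_mem_Ioo ⟨by norm_num [hy]; linarith, by norm_num [hy]; linarith⟩
  have h1 : Real.tan (Real.pi / 4 + y) ≤ 161 / 100 := by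
    rw [Real.tan_eq_sin_div_cos, div_le_iff₀ h0, Real.sin_add, Real.cos_add, Real.sin_pi_div_four,
      Real.cos_pi_div_four]
    rw [Real.tan_eq_sin_div_cos, div_le_iff₀ hc0] at ht
    have : 0 < √2 := by positivity
    nlinarith
  rw [← Real.arctan_tan (x := Real.pi / 4 + y) (by norm_num [hy]; linarith)
    (by norm_num [hy]; linarith)]
  exact Real.arctan_strictMono.monotone h1

/-- The range of `s` contains values of `exp logTerm` whose ratio exceeds `2`. -/
lemma log_ratio_le_logTerm {c θ : ℝ} (hc : 1 < c) (hθ : 1 < θ) :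
    c * (Real.pi / 4) + Real.log (201 / 100) ≤ logTerm c θ sMax := by
  have h1 := arctan_sub_ge
  have h2 : Real.log (201 / 100) ≤ 0.2225 + sMax := by
    have h3 : (201 / 161 : ℝ) ≤ Real.exp 0.2225 := by
      have := Real.sum_le_exp_of_nonneg (x := 0.2225) (by norm_num) 4
      refine le_trans ?_ this
      norm_num [Finset.sum_range_succ, Nat.factorial]
    have h4 : Real.log (201 / 161) ≤ 0.2225 := by
      rw [Real.log_le_iff_le_exp (by norm_num)]; exact h3
    have h5 : Real.log (201 / 100) = Real.log (201 / 161) + sMax := by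
      unfold sMax
      rw [← Real.log_mul (by norm_num) (by norm_num)]; norm_num
    linarith
  unfold logTerm
  rw [exp_sMax]
  have h6 : c * (Real.pi / 4 + 0.2225) ≤ c * Real.arctan (161 / 100) := by gcongr
  have h7 := sMax_pos
  norm_num at h2 h6 ⊢
  nlinarith

section Range

variable {c θ : ℝ} {σ : ℝ → ℝ} {N y : ℝ}

/-- The scale of the range: `tan u = 1` corresponds to `y = startRatio c * N`. -/
def startRatio (c : ℝ) : ℝ := Real.exp (c * (Real.pi / 4))

lemma startRatio_pos (c : ℝ) : 0 < startRatio c := Real.exp_pos _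

lemma angle_mem (hc : 1 < c) (hθ : 1 < θ) (hσ1 : ∀ s, σ (logTerm c θ s) = s)
    (hσ2 : StrictMono σ) (hN : 0 < N) (h1 : startRatio c * N ≤ y)
    (h2 : y ≤ 201 / 100 * (startRatio c * N)) :
    0 ≤ σ (Real.log y - Real.log N) ∧ σ (Real.log y - Real.log N) ≤ sMax := by
  have ha := startRatio_pos c
  have hy : 0 < y := lt_of_lt_of_le (by positivity) h1
  have e : Real.log (startRatio c * N) = c * (Real.pi / 4) + Real.log N := by
    rw [Real.log_mul ha.ne' hN.ne', startRatio, Real.log_exp]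
  constructor
  · rw [← hσ1 0, logTerm_zero]
    apply hσ2.monotone
    have := Real.log_le_log (by positivity) h1
    linarith
  · rw [← hσ1 sMax]
    apply hσ2.monotone
    have h3 := Real.log_le_log hy h2
    rw [Real.log_mul (by norm_num) (by positivity), e] at h3
    have := log_ratio_le_logTerm hc hθ
    linarith

end Range

/-- The multiples `h φ` of the inverse function are phases of size `h Δ`, with constants that
depend only on `c` and `θ`, and `φ` moves by `≫ Δ / N` over unit steps. -/
lemma exists_isPhase_invTerm {c θ : ℝ} (hc : 1 < c) (hθ : 1 < θ) {σ : ℝ → ℝ}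
    (hσ1 : ∀ s, σ (logTerm c θ s) = s) (hσ2 : StrictMono σ)
    (hσ : ∀ x, HasDerivAt σ (logTermDeriv c θ (σ x))⁻¹ x) :
    ∃ κ K : ℝ, 0 < κ ∧ κ ≤ K ∧ ∀ {Δ N : ℝ}, 0 < Δ → 0 < N →
      (∀ {M M' : ℕ}, 0 < M → M' ≤ 3 * M → startRatio c * N ≤ M →
        (M' : ℝ) ≤ 201 / 100 * (startRatio c * N) → ∀ h : ℕ, 1 ≤ h →
        IsPhase κ K (h * Δ) M M' (fun y => h * invTerm σ Δ N y)
          (fun y => h * invTerm1 c θ σ Δ N y) (fun y => h * invTerm2 c θ σ Δ N y)) ∧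
      ∀ y, startRatio c * N ≤ y → y + 1 ≤ 201 / 100 * (startRatio c * N) →
        κ * Δ / N ≤ invTerm σ Δ N (y + 1) - invTerm σ Δ N y := by
  have hF : ∀ s, 0 < expAngle s := fun s => Real.exp_pos _
  have ha := startRatio_pos c
  have hgold : ∀ s, s ≤ sMax → Real.exp s ^ 2 ≤ Real.exp s + 1 := by
    intro s hs
    have h1 : Real.exp s ≤ 161 / 100 := by rw [← exp_sMax]; exact Real.exp_le_exp.2 hs
    have := Real.exp_pos s
    nlinarith
  obtain ⟨κ₁, K₁, hκ₁, hb₁⟩ := exists_bounds_of_pos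
    (g := fun s => expAngle s * -curvature c θ s)
    (continuous_expAngle.mul (continuous_curvature hc hθ).neg) sMax_pos.le
    (fun s h1 _ => mul_pos (hF s) (neg_pos.2 (curvature_neg hc hθ h1)))
  obtain ⟨κ₂, K₂, hκ₂, hb₂⟩ := exists_bounds_of_pos
    (g := fun s => expAngle s * -curvatureSlope c θ s)
    (continuous_expAngle.mul (continuous_curvatureSlope hc hθ).neg) sMax_pos.le
    (fun s h1 h2 => mul_pos (hF s) (neg_pos.2 (curvatureSlope_neg hc hθ h1 (hgold s h2))))
  obtain ⟨κ₃, K₃, hκ₃, hb₃⟩ := exists_bounds_of_pos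
    (g := fun s => expAngle s * slope c θ s)
    (continuous_expAngle.mul (continuous_slope hc hθ)) sMax_pos.le
    (fun s _ _ => mul_pos (hF s) (slope_pos hc hθ s))
  -- `κ₂ / 3` and `κ₃ / (2.01 * startRatio c)` account for division by a point `ξ` of the range.
  set κ := min κ₁ (min (κ₂ / 3) (κ₃ / (201 / 100 * startRatio c))) with hκdef
  have k1 : κ ≤ κ₁ := min_le_left _ _
  have k2 : κ ≤ κ₂ / 3 := (min_le_right _ _).trans (min_le_left _ _)
  have k3 : κ ≤ κ₃ / (201 / 100 * startRatio c) := (min_le_right _ _).trans (min_le_right _ _)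
  have hκ : 0 < κ := lt_min hκ₁ (lt_min (by positivity) (by positivity))
  have hK₂ : 0 ≤ K₂ := by
    have := hb₂ 0 le_rfl sMax_pos.le
    linarith
  refine ⟨κ, max K₁ K₂, hκ, k1.trans (((hb₁ 0 le_rfl sMax_pos.le).1.trans
    (hb₁ 0 le_rfl sMax_pos.le).2).trans (le_max_left _ _)), ?_⟩
  intro Δ N hΔ hN
  constructor
  · intro M M' hM hM' hlo hhi h hh
    have hM0 : (0 : ℝ) < M := by exact_mod_cast hM
    have hh0 : (0 : ℝ) < h := by exact_mod_cast hh
    have hM3 : (M' : ℝ) ≤ 3 * M := by exact_mod_cast hM'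
    have hang : ∀ y : ℝ, (M : ℝ) ≤ y → y ≤ M' →
        0 ≤ σ (Real.log y - Real.log N) ∧ σ (Real.log y - Real.log N) ≤ sMax := fun y h1 h2 =>
      angle_mem hc hθ hσ1 hσ2 hN (hlo.trans h1) (h2.trans hhi)
    have heq : ∀ y : ℝ, 0 < y → y ^ 2 * (h * invTerm2 c θ σ Δ N y) =
        (h * Δ) * (expAngle (σ (Real.log y - Real.log N)) *
          curvature c θ (σ (Real.log y - Real.log N))) := by
      intro y hy
      unfold invTerm2
      field_simp
    refine ⟨hM, hM', hκ, k1.trans (((hb₁ 0 le_rfl sMax_pos.le).1.trans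
      (hb₁ 0 le_rfl sMax_pos.le).2).trans (le_max_left _ _)), by positivity, ?_, ?_, ?_, ?_⟩
    · exact fun y h1 _ => (hasDerivAt_invTerm hσ (hM0.trans_le h1)).const_mul _
    · exact fun y h1 _ => (hasDerivAt_invTerm1 hc hθ hσ (hM0.trans_le h1)).const_mul _
    · intro y h1 h2
      have hy := hM0.trans_le h1
      obtain ⟨b1, b2⟩ := hb₁ _ (hang y h1 h2).1 (hang y h1 h2).2
      rw [heq y hy, ← mul_neg, ← mul_neg, mul_comm κ, mul_comm (max K₁ K₂)]
      constructor
      · gcongr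
        exact k1.trans b1
      · gcongr
        exact b2.trans (le_max_left _ _)
    · intro y z h1 h2 h3
      have hy := hM0.trans_le h1
      have hz := hy.trans_le h2
      rw [heq y hy, heq z hz]
      rcases h2.eq_or_lt with rfl | hlt
      · simp
      obtain ⟨ξ, hξ, e⟩ := exists_hasDerivAt_eq_slope
        (fun y => (h * Δ) * (expAngle (σ (Real.log y - Real.log N)) *
          curvature c θ (σ (Real.log y - Real.log N))))
        (fun y => (h * Δ) * (expAngle (σ (Real.log y - Real.log N)) *
          curvatureSlope c θ (σ (Real.log y - Real.log N))) / y) hlt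
        (fun x hx => (hasDerivAt_curvatureTerm hc hθ hσ
          (hy.trans_le hx.1)).continuousAt.continuousWithinAt)
        (fun x hx => hasDerivAt_curvatureTerm hc hθ hσ (hy.trans hx.1))
      have hξ1 : (M : ℝ) ≤ ξ := h1.trans hξ.1.le
      have hξ2 : ξ ≤ M' := hξ.2.le.trans h3
      have hξ0 : 0 < ξ := hM0.trans_le hξ1
      obtain ⟨b1, b2⟩ := hb₂ _ (hang ξ hξ1 hξ2).1 (hang ξ hξ1 hξ2).2
      have hzy : 0 < z - y := by linarith
      rw [eq_div_iff hzy.ne'] at e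
      set gy := (h * Δ) * (expAngle (σ (Real.log y - Real.log N)) *
          curvature c θ (σ (Real.log y - Real.log N)))
      set gz := (h * Δ) * (expAngle (σ (Real.log z - Real.log N)) *
          curvature c θ (σ (Real.log z - Real.log N)))
      have e2 : gy - gz = h * Δ * (z - y) * (expAngle (σ (Real.log ξ - Real.log N)) *
          -curvatureSlope c θ (σ (Real.log ξ - Real.log N))) / ξ := by
        rw [← neg_sub gz gy, ← e]; ring
      rw [e2]
      constructor
      · calc κ * (h * Δ) * (z - y) / M ≤ κ₂ / 3 * (h * Δ) * (z - y) / M := by gcongr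
          _ = h * Δ * (z - y) * κ₂ / (3 * M) := by field_simp
          _ ≤ _ := by
            gcongr
            · exact mul_nonneg (by positivity) (hκ₂.le.trans b1)
            · exact hξ2.trans hM3
      · calc _ ≤ h * Δ * (z - y) * max K₁ K₂ / M := by
              gcongr
              exact b2.trans (le_max_right _ _)
          _ = _ := by ring
  · intro y h1 h2
    have hy : 0 < y := lt_of_lt_of_le (by positivity) h1
    obtain ⟨ξ, hξ, e⟩ := exists_hasDerivAt_eq_slope (invTerm σ Δ N) (invTerm1 c θ σ Δ N)
      (show y < y + 1 by linarith)
      (fun x hx => (hasDerivAt_invTerm hσ (hy.trans_le hx.1)).continuousAt.continuousWithinAt)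
      (fun x hx => hasDerivAt_invTerm hσ (hy.trans hx.1))
    rw [add_sub_cancel_left, div_one] at e
    rw [← e]
    have hξ0 : 0 < ξ := hy.trans hξ.1
    have hξ2 : ξ ≤ 201 / 100 * (startRatio c * N) := hξ.2.le.trans h2
    obtain ⟨a1, a2⟩ := angle_mem hc hθ hσ1 hσ2 hN (h1.trans hξ.1.le) hξ2
    obtain ⟨b1, -⟩ := hb₃ _ a1 a2
    unfold invTerm1
    calc κ * Δ / N ≤ κ₃ / (201 / 100 * startRatio c) * Δ / N := by gcongr
      _ = Δ * κ₃ / (201 / 100 * (startRatio c * N)) := by field_simp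
      _ ≤ _ := by
        gcongr
        exact mul_nonneg hΔ.le (mul_nonneg (hF _).le (slope_pos hc hθ _).le)

end

end TanPrimes

open Finset

namespace TanPrimes

noncomputable section

/-! ### Primes `p` for which an integer lies between `φ(p)` and `φ(p + 1)` -/

lemma IsPhase.mono {κ K K' T : ℝ} {M M' : ℕ} {Φ Φ1 Φ2 : ℝ → ℝ}
    (h : IsPhase κ K T M M' Φ Φ1 Φ2) (hK : K ≤ K') : IsPhase κ K' T M M' Φ Φ1 Φ2 where
  pos_M := h.pos_M
  M'_le := h.M'_le
  pos_κ := h.pos_κ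
  κ_le := h.κ_le.trans hK
  pos_T := h.pos_T
  hasDeriv := h.hasDeriv
  hasDeriv' := h.hasDeriv'
  bound := fun y h1 h2 => ⟨(h.bound y h1 h2).1, (h.bound y h1 h2).2.trans
    (mul_le_mul_of_nonneg_right hK h.pos_T.le)⟩
  bound' := fun y z h1 h2 h3 => ⟨(h.bound' y z h1 h2 h3).1, (h.bound' y z h1 h2 h3).2.trans (by
    have := h.pos_T
    have : 0 ≤ z - y := by linarith
    gcongr)⟩

open ArithmeticFunction in
/-- Exponential sums over primes with logarithmic weights: the prime powers in
`exists_norm_vonMangoldt_sum_le` contribute only `O(√M)`. -/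
lemma exists_norm_prime_sum_le {κ K : ℝ} (hκ : 0 < κ) (hκK : κ ≤ K) {ε : ℝ} (hε : 0 < ε)
    (hε1 : ε ≤ 1) :
    ∃ C : ℝ, 0 ≤ C ∧ ∀ {T : ℝ} {M M' : ℕ} {Φ Φ1 Φ2 : ℝ → ℝ}, IsPhase κ K T M M' Φ Φ1 Φ2 →
      (M : ℝ) ^ (5 / 6 : ℝ) ≤ T → T ≤ K * M →
      ‖∑ p ∈ (Ioc M M').filter Nat.Prime, (Real.log p : ℂ) * ee (Φ p)‖
        ≤ C * (M : ℝ) ^ (11 / 12 + ε) := by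
  obtain ⟨C₁, hC₁, h₁⟩ := exists_norm_vonMangoldt_sum_le hκ hκK hε hε1
  obtain ⟨C₂, h₂⟩ := Chebyshev.psi_sub_theta_le_mul_sqrt
  refine ⟨C₁ + 2 * |C₂|, by positivity, ?_⟩
  intro T M M' Φ Φ1 Φ2 h hT1 hT2
  have hM1 : (1 : ℝ) ≤ M := by exact_mod_cast h.pos_M
  have key := h₁ h hT1 hT2
  have hsplit : ∑ l ∈ Ioc M M', (Λ l : ℂ) * ee (Φ l)
      = ∑ p ∈ (Ioc M M').filter Nat.Prime, (Real.log p : ℂ) * ee (Φ p)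
        + ∑ l ∈ (Ioc M M').filter (fun l => ¬ l.Prime), (Λ l : ℂ) * ee (Φ l) := by
    rw [← sum_filter_add_sum_filter_not _ Nat.Prime]
    congr 1
    refine sum_congr rfl fun p hp => ?_
    rw [vonMangoldt_apply_prime (mem_filter.1 hp).2]
  have hpow : ‖∑ l ∈ (Ioc M M').filter (fun l => ¬ l.Prime), (Λ l : ℂ) * ee (Φ l)‖
      ≤ 2 * |C₂| * (M : ℝ) ^ (11 / 12 + ε) := by
    calc _ ≤ ∑ l ∈ (Ioc M M').filter (fun l => ¬ l.Prime), Λ l := by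
          refine (norm_sum_le _ _).trans (sum_le_sum fun l _ => ?_)
          rw [norm_mul, norm_ee, mul_one, Complex.norm_real,
            Real.norm_of_nonneg vonMangoldt_nonneg]
      _ ≤ ∑ l ∈ (Ioc 0 ⌊(M' : ℝ)⌋₊).filter (fun l => ¬ l.Prime), Λ l := by
          rw [Nat.floor_natCast]
          exact sum_le_sum_of_subset_of_nonneg
            (filter_subset_filter _ (Ioc_subset_Ioc_left (Nat.zero_le M)))
            fun _ _ _ => vonMangoldt_nonneg
      _ = Chebyshev.psi M' - Chebyshev.theta M' := (Chebyshev.psi_sub_theta_eq_sum_not_prime _).symm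
      _ ≤ C₂ * √M' := h₂ _
      _ ≤ |C₂| * √((2 : ℝ) ^ 2 * M) := by
          have h3 : (M' : ℝ) ≤ 3 * M := by exact_mod_cast h.M'_le
          refine mul_le_mul (le_abs_self _) (Real.sqrt_le_sqrt (by linarith))
            (Real.sqrt_nonneg _) (abs_nonneg _)
      _ = 2 * |C₂| * (M : ℝ) ^ (1 / 2 : ℝ) := by
          rw [Real.sqrt_mul (by norm_num), Real.sqrt_sq (by norm_num), Real.sqrt_eq_rpow]; ring
      _ ≤ _ := by
          gcongr
          linarith
  have e : ∑ p ∈ (Ioc M M').filter Nat.Prime, (Real.log p : ℂ) * ee (Φ p)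
      = ∑ l ∈ Ioc M M', (Λ l : ℂ) * ee (Φ l)
        - ∑ l ∈ (Ioc M M').filter (fun l => ¬ l.Prime), (Λ l : ℂ) * ee (Φ l) := by
    rw [hsplit]; ring
  rw [e]
  refine (norm_sub_le _ _).trans ((add_le_add key hpow).trans (le_of_eq ?_))
  ring

lemma sum_log_primes_eq {M M' : ℕ} (h : M ≤ M') :
    ∑ p ∈ (Ioc M M').filter Nat.Prime, Real.log p = Chebyshev.theta M' - Chebyshev.theta M := by
  unfold Chebyshev.theta
  rw [Nat.floor_natCast, Nat.floor_natCast, eq_sub_iff_add_eq, ← sum_union]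
  · congr 1
    rw [← filter_union, union_comm, Ioc_union_Ioc_eq_Ioc (Nat.zero_le M) h]
  · apply disjoint_filter_filter
    rw [disjoint_left]
    intro p h1 h2
    rw [mem_Ioc] at h1 h2
    omega

/-- Chebyshev's bounds give a positive proportion of primes in `(M, M']` as soon as `M' / M`
stays above `2`. -/
lemma eventually_sum_log_primes_ge :
    ∀ᶠ M : ℕ in Filter.atTop, ∀ M' : ℕ, 2005 / 1000 * (M : ℝ) ≤ M' → M' ≤ 3 * M →
      (M : ℝ) / 1000 ≤ ∑ p ∈ (Ioc M M').filter Nat.Prime, Real.log p := by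
  have h1 : ∀ᶠ M : ℕ in Filter.atTop, (40000 : ℝ) ≤ (M : ℝ) ^ (1 / 4 : ℝ) :=
    ((tendsto_rpow_atTop (by norm_num)).comp tendsto_natCast_atTop_atTop).eventually_ge_atTop _
  filter_upwards [h1, Filter.eventually_ge_atTop 2] with M hM hM2 M' hlo hhi
  have hM2' : (2 : ℝ) ≤ M := by exact_mod_cast hM2
  have hhi' : (M' : ℝ) ≤ 3 * M := by exact_mod_cast hhi
  have hMM : (M : ℝ) ≤ M' := by linarith
  have hMMn : M ≤ M' := by exact_mod_cast hMM
  rw [sum_log_primes_eq hMMn]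
  have hup := Chebyshev.theta_le_log4_mul_x (x := (M : ℝ)) (by positivity)
  have hlow := Chebyshev.theta_ge M'
  -- The main term is `M' log 2 - M log 4 ≥ 0.005 M log 2`.
  have hx1 : (1 : ℝ) ≤ M' := by linarith
  have hl4 : Real.log 4 = 2 * Real.log 2 := by
    rw [show (4 : ℝ) = 2 ^ 2 by norm_num, Real.log_pow]; norm_num
  have hl2 := Real.log_two_gt_d9
  have hs1 : 1 ≤ √(M' : ℝ) := Real.one_le_sqrt.2 hx1
  have hlog0 : 0 ≤ Real.log M' := Real.log_natCast_nonneg _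
  have hlog1 : Real.log (M' + 1) ≤ 2 * √M' * Real.log M' := by
    have h3 : Real.log (M' + 1) ≤ Real.log ((M' : ℝ) ^ 2) :=
      Real.log_le_log (by positivity) (by nlinarith)
    rw [Real.log_pow] at h3
    push_cast at h3
    calc _ ≤ 2 * Real.log M' := h3
      _ = 2 * 1 * Real.log M' := by ring
      _ ≤ _ := by gcongr
  have hq : Real.log M' ≤ 4 * (M' : ℝ) ^ (1 / 4 : ℝ) := by
    have := Real.log_le_rpow_div (show (0 : ℝ) ≤ M' by positivity) (show (0 : ℝ) < 1 / 4 by norm_num)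
    linarith
  have hX : (40000 : ℝ) ≤ (M' : ℝ) ^ (1 / 4 : ℝ) := hM.trans (by gcongr)
  set X := (M' : ℝ) ^ (1 / 4 : ℝ) with hXdef
  have hsX : √(M' : ℝ) = X ^ 2 := by
    rw [Real.sqrt_eq_rpow, hXdef, ← Real.rpow_natCast, ← Real.rpow_mul (by positivity)]; norm_num
  have hM4 : (M' : ℝ) = X ^ 4 := by
    rw [hXdef, ← Real.rpow_natCast, ← Real.rpow_mul (by positivity)]; norm_num
  have herr : 4 * √M' * Real.log M' ≤ 4 / 10000 * M' := by
    calc 4 * √M' * Real.log M' ≤ 4 * X ^ 2 * (4 * X) := by rw [hsX]; gcongr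
      _ = 4 / 10000 * (40000 * X ^ 3) := by ring
      _ ≤ 4 / 10000 * (X * X ^ 3) := by gcongr
      _ = _ := by rw [hM4]; ring
  have hmain : 5 / 1000 * M * Real.log 2 ≤ (M' - 2 * M) * Real.log 2 := by
    gcongr; linarith
  have hmain2 : 5 / 1000 * (M : ℝ) * 0.69 ≤ 5 / 1000 * M * Real.log 2 := by
    gcongr; linarith
  rw [hl4] at hup
  norm_num at hmain2
  linarith

lemma eventually_mul_rpow_le {c ω A η : ℝ} (hA : 0 ≤ A) (hω : c * ω < 1) (hη : 0 < η) :
    ∀ᶠ Δ : ℝ in Filter.atTop, (A * Δ ^ c) ^ ω ≤ η * Δ := by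
  have h1 : Filter.Tendsto (fun Δ : ℝ => A ^ ω * Δ ^ (-(1 - c * ω))) Filter.atTop (nhds (A ^ ω * 0)) :=
    (tendsto_rpow_neg_atTop (by linarith)).const_mul _
  rw [mul_zero] at h1
  filter_upwards [h1.eventually_le_const hη, Filter.eventually_gt_atTop 0] with Δ h2 h3
  rw [Real.mul_rpow hA (by positivity), ← Real.rpow_mul h3.le]
  calc A ^ ω * Δ ^ (c * ω) = A ^ ω * Δ ^ (-(1 - c * ω)) * Δ := by
        rw [mul_assoc]
        congr 1
        rw [← Real.rpow_add_one h3.ne']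
        congr 1; ring
    _ ≤ η * Δ := by gcongr

set_option maxHeartbeats 1000000 in
/-- For large `Δ`, a proportion `≫ Δ / N` of the primes `p ≍ N = Δ ^ c` has an integer between
`φ(p)` and `φ(p + 1)`. -/
lemma eventually_exists_primes {c θ : ℝ} (hc : 1 < c) (hc2 : c < 12 / 11) (hθ : 1 < θ)
    {σ : ℝ → ℝ} (hσ1 : ∀ s, σ (logTerm c θ s) = s) (hσ2 : StrictMono σ)
    (hσ : ∀ x, HasDerivAt σ (logTermDeriv c θ (σ x))⁻¹ x) :
    ∃ c₀ : ℝ, 0 < c₀ ∧ ∀ᶠ Δ : ℝ in Filter.atTop, ∃ G : Finset ℕ,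
      c₀ * Δ ≤ G.card * Real.log Δ ∧ ∀ p ∈ G, p.Prime ∧ startRatio c * Δ ^ c ≤ p ∧
        (p + 1 : ℝ) ≤ 201 / 100 * (startRatio c * Δ ^ c) ∧
        ∃ m : ℤ, invTerm σ Δ (Δ ^ c) p ≤ m ∧ (m : ℝ) < invTerm σ Δ (Δ ^ c) (p + 1) := by
  obtain ⟨κ, K, hκ, hκK, hφ⟩ := exists_isPhase_invTerm hc hθ hσ1 hσ2 hσ
  set a := startRatio c with ha_def
  have ha : 0 < a := startRatio_pos c
  -- `(2 / κ + 1) / a` bounds `n Δ / (a N)` for the largest frequency `n` used below.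
  set K' := max K ((2 / κ + 1) / a) with hK'
  have hKK' : K ≤ K' := le_max_left _ _
  set ε : ℝ := (12 / 11 - c) / 3 with hε
  have hε0 : 0 < ε := by rw [hε]; linarith
  have hε1 : ε ≤ 1 := by rw [hε]; linarith
  have hcε : c * (11 / 12 + ε) < 1 := by rw [hε]; nlinarith
  obtain ⟨C, hC, hsum⟩ := exists_norm_prime_sum_le hκ (hκK.trans hKK') hε0 hε1
  -- With `W ≥ a N / 1000` and `1 / n ≥ κ Δ / (3 N)`, the main term `W / n` is at least `7 c₃ Δ`.
  set c₃ : ℝ := a * κ / 21000 with hc₃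
  have hc₃0 : 0 < c₃ := by positivity
  refine ⟨c₃ / 6, by positivity, ?_⟩
  have hNtop : Filter.Tendsto (fun Δ : ℝ => Δ ^ c) Filter.atTop Filter.atTop :=
    tendsto_rpow_atTop (by linarith)
  have hceil : Filter.Tendsto (fun Δ : ℝ => ⌈a * Δ ^ c⌉₊) Filter.atTop Filter.atTop :=
    tendsto_nat_ceil_atTop.comp (hNtop.const_mul_atTop ha)
  have hδ : ∀ᶠ Δ : ℝ in Filter.atTop, κ * Δ / Δ ^ c ≤ 1 / 2 := by
    have h1 : Filter.Tendsto (fun Δ : ℝ => κ * Δ ^ (-(c - 1))) Filter.atTop (nhds (κ * 0)) :=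
      (tendsto_rpow_neg_atTop (by linarith)).const_mul _
    rw [mul_zero] at h1
    filter_upwards [h1.eventually_le_const (show (0 : ℝ) < 1 / 2 by norm_num),
      Filter.eventually_gt_atTop 0] with Δ h2 h3
    refine le_trans (le_of_eq ?_) h2
    rw [mul_div_assoc]
    congr 1
    rw [neg_sub, Real.rpow_sub h3, Real.rpow_one]
  filter_upwards [hδ, hceil.eventually eventually_sum_log_primes_ge,
    (hNtop.const_mul_atTop ha).eventually_ge_atTop 2000,
    eventually_mul_rpow_le (c := c) (ω := 5 / 6) (A := 2 * a) (η := 1) (by positivity)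
      (by linarith) one_pos,
    eventually_mul_rpow_le (c := c) (ω := 11 / 12 + ε) (A := 2 * a) (η := c₃ / (2 * (C + 1)))
      (by positivity) hcε (by positivity),
    Filter.eventually_ge_atTop (6 * a), Filter.eventually_gt_atTop 1]
    with Δ h1 h2 h3 h4 h5 h6 h7
  have hΔ0 : 0 < Δ := by linarith
  set N := Δ ^ c with hN
  have hN0 : 0 < N := by positivity
  obtain ⟨hph, hstep⟩ := hφ hΔ0 hN0
  set M := ⌈a * N⌉₊ with hM
  set M' := ⌊201 / 100 * (a * N)⌋₊ - 1 with hM'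
  have hMlo : a * N ≤ M := Nat.le_ceil _
  have hMhi : (M : ℝ) ≤ a * N + 1 := (Nat.ceil_lt_add_one (by positivity)).le
  have hfl1 : (⌊201 / 100 * (a * N)⌋₊ : ℝ) ≤ 201 / 100 * (a * N) := Nat.floor_le (by positivity)
  have hfl2 : 201 / 100 * (a * N) < ⌊201 / 100 * (a * N)⌋₊ + 1 := Nat.lt_floor_add_one _
  have hflpos : 1 ≤ ⌊201 / 100 * (a * N)⌋₊ := by
    rw [Nat.one_le_floor_iff]; linarith
  have hM'eq : (M' : ℝ) = ⌊201 / 100 * (a * N)⌋₊ - 1 := by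
    rw [hM', Nat.cast_sub hflpos, Nat.cast_one]
  have hMpos : 0 < M := by
    have : (0 : ℝ) < M := by linarith
    exact_mod_cast this
  have hM3 : M' ≤ 3 * M := by
    have : (M' : ℝ) ≤ 3 * M := by linarith
    exact_mod_cast this
  have hM2 : (M : ℝ) ≤ 2 * a * N := by linarith
  set δ := κ * Δ / N with hδdef
  have hδ0 : 0 < δ := by positivity
  -- `φ(p + 1) - φ(p) ≥ δ`, so an integer within `1 / n ≤ δ / 2` of `φ(p) + δ / 2` is as required.
  set n := ⌈2 / δ⌉₊ with hn
  have hn1 : 2 / δ ≤ n := Nat.le_ceil _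
  have hn2 : (n : ℝ) ≤ 2 / δ + 1 := (Nat.ceil_lt_add_one (by positivity)).le
  have hδ4 : 4 ≤ 2 / δ := by rw [le_div_iff₀ hδ0]; linarith
  have hn3 : 3 ≤ n := by
    have : (3 : ℝ) ≤ n := by linarith
    exact_mod_cast this
  have hn0 : (0 : ℝ) < n := by linarith
  have hnδ : 1 / (n : ℝ) ≤ δ / 2 := by
    rw [div_le_div_iff₀ hn0 two_pos]
    rw [div_le_iff₀ hδ0] at hn1
    linarith
  have hn4 : (n : ℝ) ≤ 3 / δ := by
    have e : 3 / δ = 2 / δ + 1 / δ := by ring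
    have : 1 ≤ 1 / δ := by rw [le_div_iff₀ hδ0]; linarith
    rw [e]; linarith
  set t : ℕ → ℝ := fun p => invTerm σ Δ N p + δ / 2 with ht
  set s := (Ioc M M').filter Nat.Prime with hs
  set E := C * (M : ℝ) ^ (11 / 12 + ε) with hE
  have hsumE : ∀ k : ℕ, 1 ≤ k → k ≤ n → ‖∑ p ∈ s, (Real.log p : ℂ) * ee (k * t p)‖ ≤ E := by
    intro k hk1 hk2
    have hk1' : (1 : ℝ) ≤ k := by exact_mod_cast hk1
    have hk2' : (k : ℝ) ≤ n := by exact_mod_cast hk2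
    have hphase := (hph hMpos hM3 hMlo (by linarith) k hk1).mono hKK'
    have hb := hsum hphase (by
      calc (M : ℝ) ^ (5 / 6 : ℝ) ≤ (2 * a * N) ^ (5 / 6 : ℝ) := by gcongr
        _ ≤ 1 * Δ := h4
        _ ≤ k * Δ := by gcongr) (by
      calc k * Δ ≤ (2 / δ + 1) * Δ := by gcongr; linarith
        _ = 2 / κ * N + Δ := by rw [hδdef]; field_simp
        _ ≤ 2 / κ * N + N := by
            gcongr
            rw [hN]
            exact Real.self_le_rpow_of_one_le h7.le hc.le
        _ = (2 / κ + 1) / a * (a * N) := by field_simp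
        _ ≤ K' * M := by gcongr; exact le_max_right _ _)
    have e : ∑ p ∈ s, (Real.log p : ℂ) * ee (k * t p)
        = (∑ p ∈ s, (Real.log p : ℂ) * ee (k * invTerm σ Δ N p)) * ee (k * (δ / 2)) := by
      rw [sum_mul]
      refine sum_congr rfl fun p _ => ?_
      rw [ht, mul_assoc, ← ee_add, ← mul_add]
    rw [e, norm_mul, norm_ee, mul_one]
    exact hb
  have key := weight_le_of_exponential_sums s (fun p => Real.log p) t
    (fun p _ => Real.log_natCast_nonneg p) hn3 hsumE
  set G := s.filter (fun p => |t p - round (t p)| < 1 / n) with hG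
  have hW : (M : ℝ) / 1000 ≤ ∑ p ∈ s, Real.log p := h2 M' (by linarith) hM3
  have hEle : E ≤ c₃ / 2 * Δ := by
    calc E ≤ C * (2 * a * N) ^ (11 / 12 + ε) := by rw [hE]; gcongr
      _ ≤ C * (c₃ / (2 * (C + 1)) * Δ) := by gcongr
      _ = C / (C + 1) * (c₃ / 2 * Δ) := by field_simp
      _ ≤ 1 * (c₃ / 2 * Δ) := by
          gcongr
          rw [div_le_one (by positivity)]; linarith
      _ = _ := one_mul _
  have hWn : 7 * (c₃ * Δ) ≤ (∑ p ∈ s, Real.log p) / n := by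
    calc 7 * (c₃ * Δ) = a * N / 1000 / (3 / δ) := by rw [hc₃, hδdef]; field_simp; norm_num
      _ ≤ (∑ p ∈ s, Real.log p) / n := by
          gcongr
          exact le_trans (by linarith) hW
  have hM'pos : 0 < M' := by
    have : (0 : ℝ) < M' := by linarith
    exact_mod_cast this
  have hlogM' : Real.log M' ≤ 3 * Real.log Δ := by
    have hM'0 : (0 : ℝ) < M' := by exact_mod_cast hM'pos
    calc Real.log M' ≤ Real.log (Δ * Δ ^ c) := by
          apply Real.log_le_log hM'0
          calc (M' : ℝ) ≤ 6 * a * N := by nlinarith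
            _ ≤ Δ * Δ ^ c := by rw [← hN]; gcongr
      _ = (1 + c) * Real.log Δ := by
          rw [Real.log_mul hΔ0.ne' (by positivity), Real.log_rpow hΔ0]; ring
      _ ≤ _ := by
          have := Real.log_pos h7
          gcongr; linarith
  refine ⟨G, ?_, ?_⟩
  · have hGsum : ∑ p ∈ G, Real.log p ≤ G.card * Real.log M' := by
      rw [← nsmul_eq_mul]
      refine sum_le_card_nsmul _ _ _ fun p hp => ?_
      have hp' := (mem_filter.1 (mem_filter.1 hp).1)
      have hp2 := (mem_Ioc.1 hp'.1).2
      exact Real.log_le_log (by exact_mod_cast hp'.2.pos) (by exact_mod_cast hp2)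
    have hGl : (G.card : ℝ) * Real.log M' ≤ G.card * (3 * Real.log Δ) := by gcongr
    linarith
  · intro p hp
    have hp' := (mem_filter.1 (mem_filter.1 hp).1)
    have hp1 := mem_Ioc.1 hp'.1
    have hnear := (mem_filter.1 hp).2
    have p1 : (M : ℝ) ≤ p := by exact_mod_cast hp1.1.le
    have p2 : (p : ℝ) ≤ M' := by exact_mod_cast hp1.2
    have p3 : (p + 1 : ℝ) ≤ 201 / 100 * (a * N) := by linarith
    have hst := hstep p (hMlo.trans p1) p3
    refine ⟨hp'.2, hMlo.trans p1, p3, round (t p), ?_, ?_⟩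
    · have := (abs_lt.1 hnear).2
      simp only [ht] at this ⊢
      linarith
    · have := (abs_lt.1 hnear).1
      simp only [ht] at this ⊢
      linarith

end

end TanPrimes

namespace TanPrimes

noncomputable section

/-! ### From the inverse function back to `[n ^ c * tan (log n) ^ θ]` -/

/-- An integer in `[φ(p), φ(p + 1))` is mapped to `p`. -/
lemma exists_term_eq {c θ : ℝ} (hc : 1 < c) (hθ : 1 < θ) {σ : ℝ → ℝ}
    (hσ0 : ∀ x, logTerm c θ (σ x) = x) (hσ1 : ∀ s, σ (logTerm c θ s) = s) (hσ2 : StrictMono σ)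
    {k : ℤ} {Δ : ℝ} (hΔ : Δ = Real.exp (Real.pi * k)) {p : ℕ} {m : ℤ}
    (hp1 : startRatio c * Δ ^ c ≤ p) (hp2 : (p + 1 : ℝ) ≤ 201 / 100 * (startRatio c * Δ ^ c))
    (hm1 : invTerm σ Δ (Δ ^ c) p ≤ m) (hm2 : (m : ℝ) < invTerm σ Δ (Δ ^ c) (p + 1)) :
    ∃ n : ℕ, Real.exp (Real.pi * k + Real.arctan 1) ≤ n ∧
      (n : ℝ) < Real.exp (Real.pi * k + Real.arctan 2) ∧ term c θ n = p := by
  have hmono : StrictMono (logTerm c θ) := fun a b hab => by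
    by_contra! h
    have := hσ2.monotone h
    rw [hσ1, hσ1] at this
    linarith
  have hΔ0 : 0 < Δ := hΔ ▸ Real.exp_pos _
  set N := Δ ^ c with hN
  have hN0 : 0 < N := by positivity
  have ha := startRatio_pos c
  have hp0 : (0 : ℝ) < p := lt_of_lt_of_le (by positivity) hp1
  obtain ⟨s1, -⟩ := angle_mem hc hθ hσ1 hσ2 hN0 hp1 (by linarith)
  obtain ⟨-, s2⟩ := angle_mem hc hθ hσ1 hσ2 hN0 (show startRatio c * N ≤ p + 1 by linarith) hp2
  have einv : ∀ y, invTerm σ Δ N y =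
      Real.exp (Real.pi * k + Real.arctan (Real.exp (σ (Real.log y - Real.log N)))) := fun y => by
    rw [invTerm, expAngle, Real.exp_add, hΔ]
  rw [einv] at hm1 hm2
  have hm0 : (0 : ℝ) < m := (Real.exp_pos _).trans_le hm1
  have hm0' : 0 < m := by exact_mod_cast hm0
  lift m to ℕ using hm0'.le
  rw [Int.cast_natCast] at hm0 hm1 hm2
  have l1 := (Real.le_log_iff_exp_le hm0).2 hm1
  have l2 := (Real.log_lt_iff_lt_exp hm0).2 hm2
  set u : ℝ := Real.log m - Real.pi * k with hu
  have b1 : Real.arctan 1 ≤ Real.arctan (Real.exp (σ (Real.log p - Real.log N))) :=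
    Real.arctan_strictMono.monotone (Real.one_le_exp s1)
  have b2 : Real.arctan (Real.exp (σ (Real.log (p + 1) - Real.log N))) < Real.arctan 2 := by
    apply Real.arctan_strictMono
    have := Real.exp_le_exp.2 s2
    rw [exp_sMax] at this
    linarith
  have u1 : 0 < u := by
    have := Real.arctan_pos.2 one_pos
    linarith
  have u2 : u < Real.pi / 2 := by
    have := Real.arctan_lt_pi_div_two 2
    linarith
  have ht : Real.tan (Real.log m) = Real.tan u := by
    rw [hu, mul_comm, Real.tan_sub_int_mul_pi]
  have ht0 : 0 < Real.tan u := Real.tan_pos_of_pos_of_lt_pi_div_two u1 u2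
  set s := Real.log (Real.tan u) with hs
  have hus : u = Real.arctan (Real.exp s) := by
    rw [hs, Real.exp_log ht0, Real.arctan_tan (by linarith [Real.pi_pos]) u2]
  have hval : (m : ℝ) ^ c * Real.tan (Real.log m) ^ θ = Real.exp (Real.log N + logTerm c θ s) := by
    rw [ht, Real.rpow_def_of_pos hm0, Real.rpow_def_of_pos ht0, ← Real.exp_add, logTerm, ← hus,
      hN, Real.log_rpow hΔ0, hΔ, Real.log_exp, ← hs, hu]
    congr 1; ring
  have c1 : σ (Real.log p - Real.log N) ≤ s := by
    have : Real.arctan (Real.exp (σ (Real.log p - Real.log N))) ≤ Real.arctan (Real.exp s) := by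
      rw [← hus]; linarith
    exact Real.exp_le_exp.1 (Real.arctan_strictMono.le_iff_le.1 this)
  have c2 : s < σ (Real.log (p + 1) - Real.log N) := by
    have : Real.arctan (Real.exp s) < Real.arctan (Real.exp (σ (Real.log (p + 1) - Real.log N))) := by
      rw [← hus]; linarith
    exact Real.exp_lt_exp.1 (Real.arctan_strictMono.lt_iff_lt.1 this)
  refine ⟨m, hm1.trans' (Real.exp_le_exp.2 (by linarith)),
    hm2.trans (Real.exp_lt_exp.2 (by linarith)), ?_⟩
  unfold term
  rw [Int.floor_eq_iff, hval, Int.cast_natCast]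
  constructor
  · rw [← Real.log_le_iff_le_exp hp0]
    have := hmono.monotone c1
    rw [hσ0] at this
    linarith
  · rw [← Real.lt_log_iff_exp_lt (by positivity)]
    have := hmono c2
    rw [hσ0] at this
    linarith

/-- `exp (π [log x / π])` is `x` up to a factor of at most `e ^ π`. -/
lemma exp_pi_mul_floor_bounds {x : ℝ} (hx : 0 < x) :
    Real.exp (Real.pi * ⌊Real.log x / Real.pi⌋) ≤ x ∧
      x ≤ Real.exp Real.pi * Real.exp (Real.pi * ⌊Real.log x / Real.pi⌋) := by
  have hpi := Real.pi_pos
  have h1 := Int.floor_le (Real.log x / Real.pi)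
  have h2 := (Int.lt_floor_add_one (Real.log x / Real.pi)).le
  rw [le_div_iff₀ hpi] at h1
  rw [div_le_iff₀ hpi] at h2
  rw [← Real.exp_add]
  exact ⟨(Real.le_log_iff_exp_le hx).1 (by linarith), (Real.log_le_iff_le_exp hx).1 (by linarith)⟩

lemma card_le_S {c θ x : ℝ} {G : Finset ℕ}
    (hG : ∀ p ∈ G, p.Prime ∧ ∃ n : ℕ, Delta 1 x ≤ n ∧ (n : ℝ) < Delta 2 x ∧ term c θ n = p) :
    G.card ≤ S c θ x := by
  have hsub : ((G : Set ℕ)) ⊆ (fun n => (term c θ n).toNat) '' countedSet c θ x := by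
    intro p hp
    obtain ⟨hpr, n, h1, h2, h3⟩ := hG p hp
    exact ⟨n, ⟨h1, h2, p, hpr, h3⟩, by simp [h3]⟩
  have hfin := countedSet_finite c θ x
  calc G.card = (G : Set ℕ).ncard := (Set.ncard_coe_finset G).symm
    _ ≤ _ := Set.ncard_le_ncard hsub (hfin.image _)
    _ ≤ _ := Set.ncard_image_le hfin

/-- The lower bound for `S`, for a constant depending only on `c` and `θ`. -/
lemma exists_le_S {c θ : ℝ} (hc1 : 1 < c) (hc2 : c < 12 / 11) (hθ : 1 < θ) :
    ∃ C : ℝ, 0 < C ∧ ∃ x₀ : ℝ, ∀ x : ℝ, x₀ ≤ x → C * (x / Real.log x) ≤ (S c θ x : ℝ) := by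
  obtain ⟨σ, hσ0, hσ1, hσ2, hσ⟩ := exists_inverse_logTerm hc1 hθ
  obtain ⟨c₀, hc₀, hev⟩ := eventually_exists_primes hc1 hc2 hθ hσ1 hσ2 hσ
  obtain ⟨D, hD⟩ := Filter.eventually_atTop.1 hev
  have hE := Real.exp_pos Real.pi
  refine ⟨c₀ / Real.exp Real.pi, by positivity, Real.exp Real.pi * max D 2, ?_⟩
  intro x hx
  have hx0 : 0 < x := lt_of_lt_of_le (by positivity) hx
  obtain ⟨hle, hge⟩ := exp_pi_mul_floor_bounds hx0
  set k := ⌊Real.log x / Real.pi⌋ with hk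
  set Δ := Real.exp (Real.pi * k) with hΔ
  have hmax : max D 2 ≤ Δ := le_of_mul_le_mul_left (hx.trans hge) hE
  obtain ⟨G, hcard, hG⟩ := hD Δ ((le_max_left _ _).trans hmax)
  have hΔ2 : 2 ≤ Δ := (le_max_right _ _).trans hmax
  have hlog : 0 < Real.log Δ := Real.log_pos (by linarith)
  have hlogx : Real.log Δ ≤ Real.log x := Real.log_le_log (by linarith) hle
  have hS : (G.card : ℝ) ≤ S c θ x := by
    refine Nat.cast_le.2 (card_le_S fun p hp => ?_)
    obtain ⟨hpr, h1, h2, m, h3, h4⟩ := hG p hp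
    exact ⟨hpr, exists_term_eq hc1 hθ hσ0 hσ1 hσ2 hΔ h1 h2 h3 h4⟩
  calc c₀ / Real.exp Real.pi * (x / Real.log x)
      ≤ c₀ / Real.exp Real.pi * (Real.exp Real.pi * Δ / Real.log Δ) := by gcongr
    _ = c₀ * Δ / Real.log Δ := by field_simp
    _ ≤ G.card := by rw [div_le_iff₀ hlog]; exact hcard
    _ ≤ _ := hS

/-- For large `x` some `n` is counted; as `tan (log n) ≥ 1`, its prime is at least `n`, which is at
least `x / e ^ π`. -/
lemma T_infinite {c θ C x₀ : ℝ} (hc : 1 ≤ c) (hθ : 0 ≤ θ) (hC : 0 < C)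
    (hS : ∀ x : ℝ, x₀ ≤ x → C * (x / Real.log x) ≤ (S c θ x : ℝ)) : (T c θ).Infinite := by
  refine Set.infinite_of_forall_exists_gt fun B => ?_
  have hE := Real.exp_pos Real.pi
  obtain ⟨x, hx1, hx2⟩ : ∃ x : ℝ, x₀ ≤ x ∧ Real.exp Real.pi * (B + 2) ≤ x :=
    ⟨_, le_max_left _ _, le_max_right _ _⟩
  have hB : (0 : ℝ) ≤ B := B.cast_nonneg
  have hx1' : 1 < x := by
    have := Real.add_one_le_exp Real.pi
    have := Real.pi_pos
    nlinarith
  have hx0 : 0 < x := by linarith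
  have hpos : (0 : ℝ) < S c θ x :=
    lt_of_lt_of_le (mul_pos hC (div_pos hx0 (Real.log_pos hx1'))) (hS x hx1)
  have hne : (countedSet c θ x).Nonempty :=
    Set.nonempty_of_ncard_ne_zero (Nat.cast_pos.1 hpos).ne'
  obtain ⟨n, h1, h2, p, hp, hnp⟩ := hne
  have htan := (tan_log_mem h1 h2).1
  have hn : (B + 2 : ℝ) ≤ n := by
    refine le_trans (le_of_mul_le_mul_left
      (hx2.trans (exp_pi_mul_floor_bounds hx0).2) hE) (le_trans ?_ h1)
    refine Real.exp_le_exp.2 ?_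
    have := Real.arctan_pos.2 one_pos
    linarith
  have hn' : B + 2 ≤ n := by exact_mod_cast hn
  refine ⟨p, ⟨hp, n, by omega, by linarith, hnp⟩, ?_⟩
  have hle : (n : ℤ) ≤ term c θ n := by
    unfold term
    rw [Int.le_floor, Int.cast_natCast]
    calc (n : ℝ) = n * 1 := (mul_one _).symm
      _ ≤ _ := mul_le_mul (Real.self_le_rpow_of_one_le (by linarith) hc)
        (Real.one_le_rpow htan hθ) zero_le_one (by positivity)
  rw [hnp] at hle
  omega

end

end TanPrimes

theorem mainTheorem1 (c θ : ℝ) (hc1 : 1 < c) (hc2 : c < 12 / 11) (hθ : 1 < θ) :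
    (∃ C : ℝ, 0 < C ∧ ∃ x₀ : ℝ, ∀ x : ℝ, x₀ ≤ x →
      C * (x / Real.log x) ≤ (TanPrimes.S c θ x : ℝ)) ∧
    (TanPrimes.T c θ).Infinite := by
  obtain ⟨C, hC, x₀, h⟩ := TanPrimes.exists_le_S hc1 hc2 hθ
  exact ⟨⟨C, hC, x₀, h⟩, TanPrimes.T_infinite hc1.le (by linarith) hC h⟩
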